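/- For an integer $n\ge 2$ write $B_r=\{x\in\mathbb R^n:|x|<r\}$. For a $C^2$ function $\psi$ let $$F[\psi]=\nabla^2\psi+\nabla\psi\otimes\nabla\psi-\tfrac12|\nabla\psi|^2 I$$ (a symmetric $n\times n$ matrix at each point), and let $\lambda(F[\psi])\in\mathbb R^n$ be the vector of its eigenvalues, counted with multiplicity. For $1\le k\le n$ let $\sigma_k(\lambda)=\sum_{1\le i_1<\dots<i_k\le n}\lambda_{i_1}\cdots\lambda_{i_k}$, let $\Gamma_k$ be the connected component of $\{\lambda\in\mathbb R^n:\sigma_k(\lambda)>0\}$ containing the positive cone $\{\lambda:\lambda_1,\dots,\lambda_n>0\}$, and let $\bar\Gamma_k$ be its closure. Proposition. Let $n\ge 2$, $p\in(0,\infty]$, $q_1\in(0,\infty)$ and $\Lambda\in[0,\infty)$. There is a constant $C>0$, depending only on $n$, $p$, $q_1$ and $\Lambda$, such that the following holds. Let $k$ be an integer with $1\le k\le n/2$ and $p>\frac{n}{2k}$, let $\psi\in C^2(B_2)$, and let $f\in L^p(B_2)$ be a real function with $\|f\|_{L^p(B_2)}\le\Lambda$. Suppose that $$\sigma_k(\lambda(F[\psi]))\le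 f \ \text{ a.e. in } B_2\qquad\text{and}\qquad \lambda(F[\psi])\in\bar\Gamma_k \ \text{ in } B_2 .$$ Then $$\|e^{-\psi}\|_{L^\infty(B_{1/2})}\le C\,\|e^{-\psi}\|_{L^{q_1}(B_1)},$$ where for $0<q<\infty$ we write $\|h\|_{L^{q}(B_1)}=\big(\int_{B_1}|h|^{q}\,dx\big)^{1/q}$ (also when $q<1$). -/

import Mathlib

open MeasureTheory Metric
open scoped ENNReal NNReal

noncomputable section

namespace SigmaK

/-- The partial derivative `∂_i ψ` at `x`. -/
def partialDeriv {n : ℕ} (ψ : EuclideanSpace ℝ (Fin n) → ℝ) (i : Fin n)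
    (x : EuclideanSpace ℝ (Fin n)) : ℝ :=
  fderiv ℝ ψ x (EuclideanSpace.single i 1)

/-- The matrix-valued operator `F[ψ] = ∇²ψ + ∇ψ ⊗ ∇ψ - (1/2) |∇ψ|² I` at `x`. -/
def F {n : ℕ} (ψ : EuclideanSpace ℝ (Fin n) → ℝ) (x : EuclideanSpace ℝ (Fin n)) :
    Matrix (Fin n) (Fin n) ℝ :=
  Matrix.of fun i j =>
    fderiv ℝ (fderiv ℝ ψ) x (EuclideanSpace.single i 1) (EuclideanSpace.single j 1)
      + partialDeriv ψ i x * partialDeriv ψ j x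
      - if i = j then (1 / 2) * ∑ m, partialDeriv ψ m x ^ 2 else 0

open Classical in
/-- The vector `λ(M)` of the `n` eigenvalues, with multiplicity, of a real symmetric matrix `M`
(with the value `0` if `M` is not symmetric; `F ψ x` is symmetric wherever `ψ` is `C²`,
see `F_isHermitian`). -/
def eigenvalues {n : ℕ} (M : Matrix (Fin n) (Fin n) ℝ) : Fin n → ℝ :=
  if h : M.IsHermitian then h.eigenvalues else 0

/-- The `k`-th elementary symmetric function `σ_k` on `ℝⁿ`. -/
def sigma {n : ℕ} (k : ℕ) (l : Fin n → ℝ) : ℝ :=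
  ∑ s ∈ Finset.powersetCard k (Finset.univ : Finset (Fin n)), ∏ i ∈ s, l i

/-- The cone `Γ_k`: the connected component of `{σ_k > 0} ⊆ ℝⁿ` that contains `(1, …, 1)`, which is
the one containing the positive cone, see `pos_subset_Gamma`. -/
def Gamma (n k : ℕ) : Set (Fin n → ℝ) :=
  connectedComponentIn {l | 0 < sigma k l} (fun _ => 1)

/-- `F[ψ]` is a symmetric matrix at every point of an open set on which `ψ` is `C²`. -/
theorem F_isHermitian {n : ℕ} {ψ : EuclideanSpace ℝ (Fin n) → ℝ}
    {s : Set (EuclideanSpace ℝ (Fin n))} (hs : IsOpen s) (hψ : ContDiffOn ℝ 2 ψ s)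
    {x : EuclideanSpace ℝ (Fin n)} (hx : x ∈ s) : (F ψ x).IsHermitian := by
  have h : IsSymmSndFDerivAt ℝ ψ x :=
    (hψ.contDiffAt (hs.mem_nhds hx)).isSymmSndFDerivAt (by simp)
  ext i j
  simp only [F, Matrix.conjTranspose_apply, Matrix.of_apply, star_trivial]
  rw [h.eq, mul_comm (partialDeriv ψ j x)]
  simp only [eq_comm]

/-- `Γ_k` contains the positive cone. -/
theorem pos_subset_Gamma {n k : ℕ} (hk : k ≤ n) : {l | ∀ i, 0 < l i} ⊆ Gamma n k := by
  have hconv : Convex ℝ {l : Fin n → ℝ | ∀ i, 0 < l i} := by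
    intro a ha b hb s t hs ht hst i
    exact (convex_Ioi (0 : ℝ)) (ha i) (hb i) hs ht hst
  refine hconv.isPreconnected.subset_connectedComponentIn (fun _ => one_pos) ?_
  intro l hl
  refine Finset.sum_pos (fun s _ => Finset.prod_pos fun i _ => hl i) ?_
  exact Finset.powersetCard_nonempty.2 (by simpa using hk)

end SigmaK

end

/-!
# Local boundedness of `e^{-ψ}` for supersolutions of a `σ_k` equation

The matrix `A = F[ψ]` is the Schouten tensor of the metric `e^{-2ψ}|dx|²`. Its Newton tensors
`T_j = σ_j I - A T_{j-1}` satisfy `div T_j = (n - 2j) T_j ∇ψ - (n - j) σ_j ∇ψ`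
(`div_newtonTensor`), so that the divergence of `|∇ψ|^{2m} T_j ∇ψ` is an algebraic expression in
`∇ψ` and `∇²ψ` (`div_pow_mul_newtonTensor_mulVec`). Mollification gives this identity in weak form
for `ψ` of class `C²` (`integral_fluxDiv_mul`).

On the closure of `Γ_k` the functions `σ_j`, `j ≤ k`, are nonnegative and the tensors `T_j`,
`j < k`, are positive semidefinite (`Gamma_subset`, `newtonTensor_quadratic_bounds`). The identity
with `m = k - j - 1`, tested with `η^{2k} e^{-aψ}` for a cutoff function `η` and `a ≥ n`, then has
the term `-(n - j)/2 σ_j |∇ψ|^{2(k-j)}` and a nonpositive contribution of `T_j(∇ψ, ∇ψ)`; this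
bounds `∫ σ_j |∇ψ|^{2(k-j)} η^{2k} e^{-aψ}` by the same integral for `j + 1`, up to remainders in
which powers of `|∇ψ|` are replaced by powers of `|∇η|` (`energyTerm_le`). The identity with
`m = 0` controls the remainders (`energyTerm_succ_zero_le`), and a chain of absorptions gives

  `∫ |∇ψ|^{2k} η^{2k} e^{-aψ} ≤ D a^N (∫ σ_k η^{2k} e^{-aψ} + sup |∇η|^{2k} ∫ e^{-aψ})`

(`exists_energy_estimate`). Hence the `L^{2k}` norm of the gradient of `η e^{-aψ/(2k)}` is under
control once `σ_k ≤ f` with `f ∈ L^p`: by Hölder's inequality the right side is at most a multiple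
of the `L^{p'}` norm of `e^{-aψ}`. Since `p > n/(2k)`, Sobolev's inequality yields an
integrability exponent larger than `2k p'`, which is a reverse Hölder inequality for `e^{-ψ}`
(`exists_reverse_holder`). Its constant is polynomial in `a` and in the inverse of the difference
of the radii, so Moser's iteration applies (`exists_exp_le_expIntegral`). The step from a large
exponent to an arbitrary `q₁ > 0` maximises `(1 - |x|)^s e^{-ψ(x)}` over the unit ball
(`exists_exp_le_rpow_expIntegral`).
-/

noncomputable section

namespace SigmaK

/-! ### Newton tensors over a commutative ring -/

section Newton

variable {R : Type*} [CommRing R] [Algebra ℝ R] {ι : Type*} [Fintype ι] [DecidableEq ι]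

/-- The `k`-th Newton tensor `T_k(A) = ∑_{i ≤ k} (-1)^i σ_{k-i}(A) A^i` of a square matrix, defined
by the Faddeev–LeVerrier recursion `T_{k+1} = (k+1)⁻¹ tr(A T_k) I - A T_k`. -/
def newtonTensor (A : Matrix ι ι R) : ℕ → Matrix ι ι R
  | 0 => 1
  | k + 1 => (((k : ℝ) + 1)⁻¹ • (A * newtonTensor A k).trace) • 1 - A * newtonTensor A k

/-- The `k`-th elementary symmetric function `σ_k(A)` of a square matrix as a polynomial in its
entries, given by `(k+1) σ_{k+1}(A) = tr(A T_k(A))`. -/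
def newtonSigma (A : Matrix ι ι R) : ℕ → R
  | 0 => 1
  | k + 1 => ((k : ℝ) + 1)⁻¹ • (A * newtonTensor A k).trace

@[simp] lemma newtonTensor_zero (A : Matrix ι ι R) : newtonTensor A 0 = 1 := rfl

@[simp] lemma newtonSigma_zero (A : Matrix ι ι R) : newtonSigma A 0 = 1 := rfl

lemma newtonTensor_succ (A : Matrix ι ι R) (k : ℕ) :
    newtonTensor A (k + 1) = newtonSigma A (k + 1) • 1 - A * newtonTensor A k := rfl

lemma smul_eq_natCast_succ_mul (k : ℕ) (a : R) : ((k : ℝ) + 1) • a = ((k : R) + 1) * a := by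
  rw [Algebra.smul_def]; simp

lemma trace_mul_newtonTensor (A : Matrix ι ι R) (k : ℕ) :
    (A * newtonTensor A k).trace = ((k : R) + 1) * newtonSigma A (k + 1) := by
  rw [← smul_eq_natCast_succ_mul, newtonSigma, smul_smul, mul_inv_cancel₀ (by positivity), one_smul]

lemma eq_zero_of_natCast_succ_mul {k : ℕ} {a : R} (h : ((k : R) + 1) * a = 0) : a = 0 := by
  rw [← smul_eq_natCast_succ_mul] at h
  have := congrArg (((k : ℝ) + 1)⁻¹ • ·) h
  simpa [smul_smul, inv_mul_cancel₀ (show (k : ℝ) + 1 ≠ 0 by positivity)] using this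

lemma trace_newtonTensor (A : Matrix ι ι R) (k : ℕ) :
    (newtonTensor A k).trace = ((Fintype.card ι : R) - k) * newtonSigma A k := by
  cases k with
  | zero => simp
  | succ k =>
    rw [newtonTensor_succ, Matrix.trace_sub, trace_mul_newtonTensor, Matrix.trace_smul,
      Matrix.trace_one, smul_eq_mul]
    push_cast; ring

lemma newtonTensor_comm (A : Matrix ι ι R) (k : ℕ) :
    A * newtonTensor A k = newtonTensor A k * A := by
  induction k with
  | zero => simp
  | succ k ih =>
    rw [newtonTensor_succ, mul_sub, sub_mul, mul_assoc A, ← ih]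
    simp

lemma newtonTensor_transpose {A : Matrix ι ι R} (hA : A.transpose = A) (k : ℕ) :
    (newtonTensor A k).transpose = newtonTensor A k := by
  induction k with
  | zero => simp
  | succ k ih =>
    rw [newtonTensor_succ, Matrix.transpose_sub, Matrix.transpose_mul, ih, hA, newtonTensor_comm]
    simp

lemma newtonTensor_eq_sum (A : Matrix ι ι R) (k : ℕ) :
    newtonTensor A k =
      ∑ x ∈ Finset.HasAntidiagonal.antidiagonal k, ((-1) ^ x.2 * newtonSigma A x.1) • A ^ x.2 := by
  induction k with
  | zero => simp
  | succ k ih =>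
    rw [newtonTensor_succ, ih, Finset.Nat.sum_antidiagonal_succ', Finset.mul_sum, sub_eq_add_neg,
      ← Finset.sum_neg_distrib]
    congr 1
    · simp
    · refine Finset.sum_congr rfl fun x _ => ?_
      simp [pow_succ' A, pow_succ (-1 : R)]

lemma newtonTensor_map {S : Type*} [CommRing S] [Algebra ℝ S] (φ : R →ₐ[ℝ] S)
    (A : Matrix ι ι R) (k : ℕ) : (newtonTensor A k).map φ = newtonTensor (A.map φ) k := by
  induction k with
  | zero => simp [Matrix.map_one]
  | succ k ih =>
    have h : (A * newtonTensor A k).map φ = A.map φ * newtonTensor (A.map φ) k := by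
      rw [Matrix.map_mul, ih]
    ext i j
    simp only [newtonTensor, Matrix.map_apply, Matrix.sub_apply, Matrix.smul_apply, map_sub,
      smul_eq_mul, map_mul, map_smul, ← h]
    congr 3
    · simp only [Matrix.trace, Matrix.diag_apply, map_sum, Matrix.map_apply]
    · simp [Matrix.one_apply, apply_ite φ]

lemma newtonSigma_map {S : Type*} [CommRing S] [Algebra ℝ S] (φ : R →ₐ[ℝ] S)
    (A : Matrix ι ι R) (k : ℕ) : φ (newtonSigma A k) = newtonSigma (A.map φ) k := by
  cases k with
  | zero => simp
  | succ k =>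
    have h : (A * newtonTensor A k).map φ = A.map φ * newtonTensor (A.map φ) k := by
      rw [Matrix.map_mul, newtonTensor_map]
    simp only [newtonSigma, map_smul, ← h]
    simp only [Matrix.trace, Matrix.diag_apply, map_sum, Matrix.map_apply]

section Derivation

variable (D : Derivation ℝ R R)

lemma map_derivation_mul {κ : Type*} [Fintype κ] (M N : Matrix κ κ R) :
    (M * N).map D = M.map D * N + M * N.map D := by
  ext i j
  simp only [Matrix.map_apply, Matrix.mul_apply, map_sum, Derivation.leibniz, smul_eq_mul,
    Matrix.add_apply, ← Finset.sum_add_distrib]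
  exact Finset.sum_congr rfl fun x _ => by ring

lemma derivation_trace {κ : Type*} [Fintype κ] (M : Matrix κ κ R) :
    D M.trace = (M.map D).trace := by
  simp [Matrix.trace]

lemma trace_pow_mul_map_derivation_pow (A : Matrix ι ι R) (i j : ℕ) :
    (A ^ j * (A ^ (i + 1)).map D).trace = ((i : R) + 1) * (A ^ (i + j) * A.map D).trace := by
  induction i generalizing j with
  | zero => simp
  | succ i ih =>
    rw [pow_succ A (i + 1), map_derivation_mul, mul_add, Matrix.trace_add, ← mul_assoc,
      Matrix.trace_mul_comm _ A, ← mul_assoc, ← pow_succ', ih (j + 1), ← mul_assoc, ← pow_add]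
    push_cast
    rw [show i + (j + 1) = i + 1 + j by ring, show j + (i + 1) = i + 1 + j by ring]
    ring

/-- The differential of `σ_{k+1}` is `T_k`. With `S = ∑ σ_k t^k` and `P = ∑ (-1)^i tr(A^{i+1}) t^i`
one has `S' = S P`, and the formal derivative of `S` along `D` is then the solution of a linear
differential equation with zero initial value. -/
lemma derivation_newtonSigma_succ (A : Matrix ι ι R) (k : ℕ) :
    D (newtonSigma A (k + 1)) = (newtonTensor A k * A.map D).trace := by
  classical
  let q : ℕ → R := fun i => (-1) ^ i * (A ^ i * A.map D).trace
  let P : PowerSeries R := .mk fun i => (-1) ^ i * (A ^ (i + 1)).trace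
  let S : PowerSeries R := .mk (newtonSigma A)
  let S₁ : PowerSeries R := .mk fun i => D (newtonSigma A i)
  let P₁ : PowerSeries R := .mk fun i => D ((-1) ^ i * (A ^ (i + 1)).trace)
  let Q : PowerSeries R := .mk fun i => if i = 0 then 0 else q (i - 1)
  have hS (k : ℕ) : ((k : R) + 1) * newtonSigma A (k + 1) =
      ∑ x ∈ Finset.HasAntidiagonal.antidiagonal k,
        newtonSigma A x.1 * ((-1) ^ x.2 * (A ^ (x.2 + 1)).trace) := by
    rw [← trace_mul_newtonTensor, newtonTensor_eq_sum, Finset.mul_sum, Matrix.trace_sum]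
    refine Finset.sum_congr rfl fun x _ => ?_
    simp [pow_succ' A]; ring
  have hS₁ : PowerSeries.derivative R S₁ = S₁ * P + S * P₁ := by
    ext k
    rw [PowerSeries.coeff_derivative, map_add, PowerSeries.coeff_mul, PowerSeries.coeff_mul,
      ← Finset.sum_add_distrib]
    have := congrArg D (hS k)
    simp only [PowerSeries.coeff_mk, S₁, P, S, P₁]
    rw [Derivation.leibniz, map_sum] at this
    simp only [map_add, Derivation.map_natCast, Derivation.map_one_eq_zero, smul_eq_mul, add_zero,
      mul_zero] at this
    rw [mul_comm, this]
    refine Finset.sum_congr rfl fun x _ => ?_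
    rw [Derivation.leibniz, smul_eq_mul, smul_eq_mul]; ring
  have hSd : PowerSeries.derivative R S = S * P := by
    ext k
    rw [PowerSeries.coeff_derivative, PowerSeries.coeff_mul]
    simp only [PowerSeries.coeff_mk, P, S]
    rw [mul_comm, hS]
  have hQ : PowerSeries.derivative R Q = P₁ := by
    ext k
    rw [PowerSeries.coeff_derivative]
    simp only [PowerSeries.coeff_mk, Q, P₁, q]
    have := trace_pow_mul_map_derivation_pow D A k 0
    simp only [pow_zero, one_mul, add_zero] at this
    rw [Derivation.leibniz, derivation_trace, this, Derivation.leibniz_pow]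
    simp; ring
  -- The candidate for `S₁` is `S Q`; the difference `E` has to vanish.
  let E := S₁ - S * Q
  have hE : PowerSeries.derivative R E = E * P := by
    simp only [E, map_sub, Derivation.leibniz, smul_eq_mul, hS₁, hSd, hQ]; ring
  have hE0 (k : ℕ) : PowerSeries.coeff k E = 0 := by
    induction k using Nat.strong_induction_on with
    | _ k ih =>
      cases k with
      | zero => simp [E, S₁, S, Q, PowerSeries.coeff_zero_eq_constantCoeff]
      | succ k =>
        have := congrArg (PowerSeries.coeff k) hE
        rw [PowerSeries.coeff_derivative, PowerSeries.coeff_mul, Finset.sum_eq_zero, mul_comm]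
          at this
        · exact eq_zero_of_natCast_succ_mul this
        · intro x hx
          rw [ih x.1 (by have := Finset.HasAntidiagonal.mem_antidiagonal.1 hx; omega), zero_mul]
  have := hE0 (k + 1)
  simp only [E, map_sub, PowerSeries.coeff_mul, Finset.Nat.sum_antidiagonal_succ'] at this
  simp only [S₁, S, Q, q, PowerSeries.coeff_mk] at this
  rw [sub_eq_zero] at this
  rw [this, newtonTensor_eq_sum, Finset.sum_mul, Matrix.trace_sum]
  simp only [if_true, mul_zero, zero_add]
  refine Finset.sum_congr rfl fun x _ => ?_
  simp; ring

end Derivation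

/-! ### The divergence of the Newton tensors of `F[ψ]` -/

section Divergence

open Matrix

variable (p : ι → R) (H : Matrix ι ι R)

/-- The matrix `H + p ⊗ p - (1/2) |p|² I`; with `p = ∇ψ` and `H = ∇²ψ` this is `F[ψ]`. -/
def schoutenMatrix : Matrix ι ι R :=
  .of fun i j => H i j + p i * p j - if i = j then (1 / 2 : ℝ) • ∑ m, p m ^ 2 else 0

variable {p H}

lemma schoutenMatrix_transpose (hsym : H.transpose = H) :
    (schoutenMatrix p H).transpose = schoutenMatrix p H := by
  ext i j
  have : H j i = H i j := congrFun (congrFun hsym i) j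
  simp [schoutenMatrix, this, mul_comm (p j), eq_comm]

lemma two_mul_half_smul (a : R) : 2 * ((1 / 2 : ℝ) • a) = a := by
  rw [← smul_eq_mul, ← Nat.cast_ofNat, Nat.cast_smul_eq_nsmul, ← Nat.cast_smul_eq_nsmul ℝ,
    smul_smul]
  norm_num

lemma schoutenMatrix_mulVec (i : ι) :
    2 * (schoutenMatrix p H *ᵥ p) i = 2 * (H *ᵥ p) i + (∑ m, p m ^ 2) * p i := by
  have : (schoutenMatrix p H *ᵥ p) i =
      (H *ᵥ p) i + (∑ m, p m ^ 2) * p i - ((1 / 2 : ℝ) • ∑ m, p m ^ 2) * p i := by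
    simp only [schoutenMatrix, mulVec, dotProduct, of_apply, sub_mul, add_mul,
      Finset.sum_sub_distrib, Finset.sum_add_distrib, ite_mul, zero_mul, Finset.sum_ite_eq,
      Finset.mem_univ, if_true, Finset.sum_mul]
    congr 2
    exact Finset.sum_congr rfl fun x _ => by ring
  rw [this]
  linear_combination (-p i) * two_mul_half_smul (∑ m, p m ^ 2)

-- The hypotheses say that `H` is the Hessian of a potential of `p`, with commuting derivatives.
variable {D : ι → Derivation ℝ R R} (hH : ∀ i j, D j (p i) = H i j) (hsym : H.transpose = H)
  (hcod : ∀ i j l, D l (H i j) = D j (H i l))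

include hH hsym in
lemma derivation_sum_sq (i : ι) : D i (∑ m, p m ^ 2) = 2 * (H *ᵥ p) i := by
  have (m : ι) : H m i = H i m := congrFun (congrFun hsym i) m
  simp only [map_sum, Derivation.leibniz_pow, hH, mulVec, dotProduct, Finset.mul_sum, this]
  exact Finset.sum_congr rfl fun x _ => by simp; ring

include hH hsym hcod in
/-- The antisymmetrised derivative of `F[ψ]` contains no third derivatives of `ψ`. -/
lemma derivation_schoutenMatrix_sub (i l q : ι) :
    D i (schoutenMatrix p H q l) - D l (schoutenMatrix p H q i) =
      schoutenMatrix p H q i * p l - schoutenMatrix p H q l * p i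
        - (schoutenMatrix p H *ᵥ p) i * (1 : Matrix ι ι R) q l
        + (schoutenMatrix p H *ᵥ p) l * (1 : Matrix ι ι R) q i := by
  have hs (i j : ι) : H i j = H j i := congrFun (congrFun hsym j) i
  have key (i l : ι) : D i (schoutenMatrix p H q l) =
      D i (H q l) + p q * H l i + H q i * p l - (H *ᵥ p) i * (1 : Matrix ι ι R) q l := by
    have : schoutenMatrix p H q l =
        H q l + p q * p l - ((1 / 2 : ℝ) • ∑ m, p m ^ 2) * (1 : Matrix ι ι R) q l := by
      simp [schoutenMatrix, Matrix.one_apply]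
    have h1 : D i ((1 : Matrix ι ι R) q l) = 0 := by
      rw [Matrix.one_apply]; split_ifs <;> simp
    rw [this, map_sub, map_add, Derivation.leibniz, Derivation.leibniz, h1, Derivation.map_smul,
      derivation_sum_sq hH hsym, hH, hH]
    have := two_mul_half_smul ((H *ᵥ p) i)
    rw [mul_smul_comm] at this
    simp only [smul_eq_mul]
    linear_combination (-(1 : Matrix ι ι R) q l) * this
  have hA (l : ι) : 2 * schoutenMatrix p H q l =
      2 * (H q l + p q * p l) - (∑ m, p m ^ 2) * (1 : Matrix ι ι R) q l := by
    have := two_mul_half_smul (∑ m, p m ^ 2)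
    simp only [schoutenMatrix, of_apply, Matrix.one_apply]
    split_ifs
    · linear_combination -this
    · ring
  have h2 : (2 : R) * (D i (schoutenMatrix p H q l) - D l (schoutenMatrix p H q i)) = 2 * (
      schoutenMatrix p H q i * p l - schoutenMatrix p H q l * p i
        - (schoutenMatrix p H *ᵥ p) i * (1 : Matrix ι ι R) q l
        + (schoutenMatrix p H *ᵥ p) l * (1 : Matrix ι ι R) q i) := by
    rw [key, key, hcod q l i, hs l i]
    linear_combination -p l * hA i + p i * hA l
      + (1 : Matrix ι ι R) q l * schoutenMatrix_mulVec (p := p) (H := H) i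
      - (1 : Matrix ι ι R) q i * schoutenMatrix_mulVec (p := p) (H := H) l
  rw [← sub_eq_zero]
  refine eq_zero_of_natCast_succ_mul (k := 1) ?_
  push_cast
  linear_combination h2

include hH hsym hcod in
/-- `div T_k = (n - 2k) T_k ∇ψ - (n - k) σ_k ∇ψ`: the Newton tensors of the Schouten tensor of the
conformally flat metric `e^{-2ψ}|dx|²` are divergence free for that metric. -/
lemma div_newtonTensor (k : ℕ) (i : ι) :
    ∑ l, D l (newtonTensor (schoutenMatrix p H) k i l) =
      ((Fintype.card ι : R) - 2 * k) * (newtonTensor (schoutenMatrix p H) k *ᵥ p) i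
        - ((Fintype.card ι : R) - k) * newtonSigma (schoutenMatrix p H) k * p i := by
  set A := schoutenMatrix p H with hA
  have hAt : A.transpose = A := schoutenMatrix_transpose hsym
  have hAs (i j : ι) : A i j = A j i := congrFun (congrFun hAt j) i
  induction k generalizing i with
  | zero =>
    have (l : ι) : D l ((1 : Matrix ι ι R) i l) = 0 := by
      rw [Matrix.one_apply]; split_ifs <;> simp
    simp [this]
  | succ k ih =>
    set T := newtonTensor A k with hT
    have hTt : T.transpose = T := newtonTensor_transpose hAt k
    have hTs (i j : ι) : T i j = T j i := congrFun (congrFun hTt j) i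
    have e1 (l : ι) : D l (newtonTensor A (k + 1) i l) =
        D l (newtonSigma A (k + 1)) * (1 : Matrix ι ι R) i l
          - ∑ q, T q l * D l (A q i) - ∑ q, A i q * D l (T q l) := by
      have h1 : D l ((1 : Matrix ι ι R) i l) = 0 := by
        rw [Matrix.one_apply]; split_ifs <;> simp
      rw [newtonTensor_succ, Matrix.sub_apply, Matrix.smul_apply, Matrix.mul_apply, map_sub,
        smul_eq_mul, Derivation.leibniz, h1, map_sum, sub_sub, ← Finset.sum_add_distrib]
      congr 1
      · simp [mul_comm]
      · refine Finset.sum_congr rfl fun q _ => ?_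
        rw [Derivation.leibniz, smul_eq_mul, smul_eq_mul, hAs i q]; ring
    have e2 : ∑ l, ∑ q, A i q * D l (T q l) =
        ((Fintype.card ι : R) - 2 * k) * ((A * T) *ᵥ p) i
          - ((Fintype.card ι : R) - k) * newtonSigma A k * (A *ᵥ p) i := by
      rw [Finset.sum_comm]
      simp_rw [← Finset.mul_sum, ih]
      rw [← mulVec_mulVec]
      simp only [mulVec, dotProduct, mul_sub, Finset.sum_sub_distrib, Finset.mul_sum]
      congr 1 <;> refine Finset.sum_congr rfl fun q _ => ?_
      · exact Finset.sum_congr rfl fun _ _ => by ring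
      · ring
    have e3 : ∑ l, D l (newtonSigma A (k + 1)) * (1 : Matrix ι ι R) i l =
        ∑ l, ∑ q, T q l * D i (A q l) := by
      simp only [Matrix.one_apply, mul_ite, mul_one, mul_zero, Finset.sum_ite_eq, Finset.mem_univ,
        if_true, derivation_newtonSigma_succ, Matrix.trace, Matrix.diag_apply, Matrix.mul_apply,
        Matrix.map_apply]
      rw [Finset.sum_comm]
      exact Finset.sum_congr rfl fun l _ => Finset.sum_congr rfl fun q _ => by rw [hAs l q]
    have e4 : ∑ l, ∑ q, T q l * D i (A q l) - ∑ l, ∑ q, T q l * D l (A q i) =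
        ((A * T) *ᵥ p) i - (A * T).trace * p i - (A *ᵥ p) i * T.trace + ((T * A) *ᵥ p) i := by
      rw [← Finset.sum_sub_distrib]
      simp_rw [← Finset.sum_sub_distrib, ← mul_sub, hA,
        derivation_schoutenMatrix_sub hH hsym hcod, ← hA]
      simp only [mul_add, mul_sub, Finset.sum_add_distrib, Finset.sum_sub_distrib]
      congr 1
      · congr 1
        · congr 1
          · rw [← mulVec_mulVec]
            simp only [mulVec, dotProduct, Finset.mul_sum]
            rw [Finset.sum_comm]
            exact Finset.sum_congr rfl fun l _ => Finset.sum_congr rfl fun q _ => by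
              rw [hAs l i]; ring
          · simp only [Matrix.trace, Matrix.diag_apply, Matrix.mul_apply, Finset.sum_mul]
            exact Finset.sum_congr rfl fun l _ => Finset.sum_congr rfl fun q _ => by
              rw [hAs l q]; ring
        · simp [Matrix.one_apply, Matrix.trace, Finset.mul_sum, mul_comm]
      · rw [← mulVec_mulVec]
        simp [Matrix.one_apply, mulVec, dotProduct, hTs i]
    have e5 : newtonTensor A (k + 1) *ᵥ p = newtonSigma A (k + 1) • p - (A * T) *ᵥ p := by
      rw [newtonTensor_succ, sub_mulVec, smul_mulVec, one_mulVec]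
    simp_rw [e1, Finset.sum_sub_distrib]
    rw [e2, e3, e4, e5, ← newtonTensor_comm, ← hT, hT, trace_mul_newtonTensor, trace_newtonTensor]
    simp only [Pi.sub_apply, Pi.smul_apply, smul_eq_mul]
    push_cast
    ring

include hH hsym hcod in
/-- The divergence of `|∇ψ|^{2m} T_k ∇ψ`, multiplied by two. -/
lemma div_pow_mul_newtonTensor_mulVec (k m : ℕ) :
    2 * ∑ i, D i ((∑ l, p l ^ 2) ^ m * (newtonTensor (schoutenMatrix p H) k *ᵥ p) i) =
      2 * ((k : R) + 1 + 2 * m) * newtonSigma (schoutenMatrix p H) (k + 1) * (∑ l, p l ^ 2) ^ m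
        - ((Fintype.card ι : R) - k) * newtonSigma (schoutenMatrix p H) k
            * (∑ l, p l ^ 2) ^ (m + 1)
        + 2 * ((Fintype.card ι : R) - 2 * k - 1 - m)
            * (p ⬝ᵥ newtonTensor (schoutenMatrix p H) k *ᵥ p) * (∑ l, p l ^ 2) ^ m
        - 4 * m * (∑ l, p l ^ 2) ^ (m - 1)
            * (p ⬝ᵥ newtonTensor (schoutenMatrix p H) (k + 1) *ᵥ p) := by
  set A := schoutenMatrix p H with hA
  set s := ∑ l, p l ^ 2 with hs
  set T := newtonTensor A k with hT
  have hAt : A.transpose = A := schoutenMatrix_transpose hsym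
  have hTt : T.transpose = T := newtonTensor_transpose hAt k
  have hTs (i j : ι) : T i j = T j i := congrFun (congrFun hTt j) i
  have hps : p ⬝ᵥ p = s := by simp [dotProduct, hs, pow_two]
  have hAH : (2 : R) • A = (2 : R) • H + (2 : R) • vecMulVec p p - s • (1 : Matrix ι ι R) := by
    ext i j
    have := two_mul_half_smul s
    simp only [hA, schoutenMatrix, Matrix.one_apply, Matrix.smul_apply, of_apply, Matrix.sub_apply,
      Matrix.add_apply, vecMulVec_apply, smul_eq_mul, ← hs]
    split_ifs
    · linear_combination -this
    · ring
  have e1 : ∑ i, D i (s ^ m * (T *ᵥ p) i) =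
      s ^ m * ∑ i, D i ((T *ᵥ p) i) + m * s ^ (m - 1) * (2 * ((H *ᵥ p) ⬝ᵥ (T *ᵥ p))) := by
    simp only [Finset.mul_sum, dotProduct, ← Finset.sum_add_distrib]
    refine Finset.sum_congr rfl fun i _ => ?_
    rw [Derivation.leibniz, Derivation.leibniz_pow, derivation_sum_sq hH hsym]
    simp; ring
  have e2 : ∑ i, D i ((T *ᵥ p) i) = ∑ l, p l * ∑ i, D i (T l i) + (T * H).trace := by
    simp only [mulVec, dotProduct, map_sum, Derivation.leibniz, hH, smul_eq_mul,
      Finset.sum_add_distrib, Matrix.trace, Matrix.diag_apply, Matrix.mul_apply]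
    rw [add_comm]
    congr 1
    · rw [Finset.sum_comm]
      exact Finset.sum_congr rfl fun l _ => by
        rw [Finset.mul_sum]; exact Finset.sum_congr rfl fun i _ => by rw [hTs l i]
  have e3 : ∑ l, p l * ∑ i, D i (T l i) = ((Fintype.card ι : R) - 2 * k) * (p ⬝ᵥ T *ᵥ p)
      - ((Fintype.card ι : R) - k) * newtonSigma A k * s := by
    simp_rw [hT, hA, div_newtonTensor hH hsym hcod, ← hA, ← hT, ← hps]
    simp only [dotProduct, mul_sub, Finset.sum_sub_distrib, Finset.mul_sum]
    congr 1 <;> exact Finset.sum_congr rfl fun l _ => by ring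
  have e4 : 2 * (T * H).trace = 2 * (((k : R) + 1) * newtonSigma A (k + 1)) - 2 * (p ⬝ᵥ T *ᵥ p)
      + s * (((Fintype.card ι : R) - k) * newtonSigma A k) := by
    have : (2 : R) • H = (2 : R) • A - (2 : R) • vecMulVec p p + s • 1 := by rw [hAH]; abel
    calc 2 * (T * H).trace = (T * ((2 : R) • H)).trace := by simp
      _ = _ := by
        rw [this, mul_add, mul_sub, trace_add, trace_sub, ← trace_newtonTensor,
          ← trace_mul_newtonTensor, newtonTensor_comm, ← hT]
        simp only [Algebra.mul_smul_comm, trace_smul, smul_eq_mul, mul_one, mul_vecMulVec,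
          trace_vecMulVec]
        rw [dotProduct_comm p]
  have e5 : 2 * ((H *ᵥ p) ⬝ᵥ (T *ᵥ p)) =
      2 * (p ⬝ᵥ (A * T) *ᵥ p) - s * (p ⬝ᵥ T *ᵥ p) := by
    have : (2 : R) • H *ᵥ p = (2 : R) • A *ᵥ p - s • p := by
      have := congrArg (· *ᵥ p) hAH
      simp only [add_mulVec, sub_mulVec, smul_mulVec, vecMulVec_mulVec, one_mulVec, hps] at this
      rw [this]
      ext i; simp; ring
    calc 2 * ((H *ᵥ p) ⬝ᵥ (T *ᵥ p)) = ((2 : R) • H *ᵥ p) ⬝ᵥ (T *ᵥ p) := by simp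
      _ = 2 * ((A *ᵥ p) ⬝ᵥ (T *ᵥ p)) - s * (p ⬝ᵥ T *ᵥ p) := by
        rw [this, sub_dotProduct, smul_dotProduct, smul_dotProduct]; simp
      _ = _ := by
        rw [← mulVec_mulVec, dotProduct_mulVec p A, ← mulVec_transpose, hAt]
  have e6 : p ⬝ᵥ (A * T) *ᵥ p =
      newtonSigma A (k + 1) * s - p ⬝ᵥ newtonTensor A (k + 1) *ᵥ p := by
    rw [newtonTensor_succ, sub_mulVec, smul_mulVec, one_mulVec, dotProduct_sub, dotProduct_smul,
      hps, smul_eq_mul]; ring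
  rw [e1, e2, e3, e5, e6]
  rcases m with _ | m
  · simp only [Nat.cast_zero, pow_zero]
    linear_combination e4
  · simp only [Nat.add_sub_cancel]
    push_cast
    linear_combination s ^ (m + 1) * e4

end Divergence

end Newton

/-! ### Elementary symmetric functions and the cone `Γ_k` -/

section Symmetric

open Polynomial

variable {ι : Type*}

/-- The elementary symmetric function of degree `k` of the entries of `l` with index in `s`. For
`s = univ \ {i}` it is the partial derivative of the one of degree `k + 1` of all the entries. -/
def esymmOn (s : Finset ι) (k : ℕ) (l : ι → ℝ) : ℝ :=
  ∑ t ∈ Finset.powersetCard k s, ∏ i ∈ t, l i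

@[simp] lemma esymmOn_zero (s : Finset ι) (l : ι → ℝ) : esymmOn s 0 l = 1 := by
  simp [esymmOn]

@[simp] lemma esymmOn_empty_succ (k : ℕ) (l : ι → ℝ) : esymmOn ∅ (k + 1) l = 0 := by
  have : Finset.powersetCard (k + 1) (∅ : Finset ι) = ∅ := by
    rw [Finset.powersetCard_eq_empty]; simp
  simp [esymmOn, this]

lemma continuous_esymmOn (s : Finset ι) (k : ℕ) : Continuous (esymmOn s k) := by
  unfold esymmOn; fun_prop

variable [DecidableEq ι]

lemma esymmOn_insert {s : Finset ι} {a : ι} (ha : a ∉ s) (k : ℕ) (l : ι → ℝ) :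
    esymmOn (insert a s) (k + 1) l = esymmOn s (k + 1) l + l a * esymmOn s k l := by
  have hmem : ∀ t ∈ Finset.powersetCard k s, a ∉ t := fun t ht h =>
    ha ((Finset.mem_powersetCard.1 ht).1 h)
  rw [esymmOn, Finset.powersetCard_succ_insert ha, Finset.sum_union, Finset.sum_image]
  · congr 1
    rw [esymmOn, Finset.mul_sum]
    exact Finset.sum_congr rfl fun t ht => Finset.prod_insert (hmem t ht)
  · intro t ht t' ht' h
    rw [← Finset.erase_insert (hmem t ht), ← Finset.erase_insert (hmem t' ht'), h]
  · rw [Finset.disjoint_left]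
    intro t ht ht'
    obtain ⟨t', -, rfl⟩ := Finset.mem_image.1 ht'
    exact ha ((Finset.mem_powersetCard.1 ht).1 (Finset.mem_insert_self _ _))

lemma esymmOn_eq_erase {s : Finset ι} {a : ι} (ha : a ∈ s) (k : ℕ) (l : ι → ℝ) :
    esymmOn s (k + 1) l = esymmOn (s.erase a) (k + 1) l + l a * esymmOn (s.erase a) k l := by
  conv_lhs => rw [← Finset.insert_erase ha]
  exact esymmOn_insert (Finset.notMem_erase a s) k l

/-- Euler's identity for the elementary symmetric functions. -/
lemma sum_mul_esymmOn_erase (s : Finset ι) (k : ℕ) (l : ι → ℝ) :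
    ∑ i ∈ s, l i * esymmOn (s.erase i) k l = (k + 1) * esymmOn s (k + 1) l := by
  induction s using Finset.induction_on generalizing k with
  | empty => simp
  | insert a s ha ih =>
    rw [Finset.sum_insert ha, Finset.erase_insert ha, esymmOn_insert ha]
    have h (i : ι) (hi : i ∈ s) : (insert a s).erase i = insert a (s.erase i) := by
      rw [Finset.erase_insert_of_ne]; rintro rfl; exact ha hi
    have hn (i : ι) : a ∉ s.erase i := fun h => ha (Finset.mem_of_mem_erase h)
    cases k with
    | zero =>
      have := ih 0
      simp at this ⊢
      linarith
    | succ k =>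
      have : ∑ i ∈ s, l i * esymmOn ((insert a s).erase i) (k + 1) l =
          ∑ i ∈ s, l i * esymmOn (s.erase i) (k + 1) l
            + l a * ∑ i ∈ s, l i * esymmOn (s.erase i) k l := by
        rw [Finset.mul_sum, ← Finset.sum_add_distrib]
        refine Finset.sum_congr rfl fun i hi => ?_
        rw [h i hi, esymmOn_insert (hn i)]; ring
      rw [this, ih, ih]
      push_cast; ring

lemma sum_esymmOn_erase (s : Finset ι) (k : ℕ) (l : ι → ℝ) :
    ∑ i ∈ s, esymmOn (s.erase i) k l = (s.card - k) * esymmOn s k l := by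
  cases k with
  | zero => simp
  | succ k =>
    have h1 : ∑ i ∈ s, esymmOn s (k + 1) l =
        ∑ i ∈ s, (esymmOn (s.erase i) (k + 1) l + l i * esymmOn (s.erase i) k l) :=
      Finset.sum_congr rfl fun i hi => esymmOn_eq_erase hi k l
    rw [Finset.sum_add_distrib, sum_mul_esymmOn_erase, Finset.sum_const, nsmul_eq_mul] at h1
    push_cast
    linarith

lemma coeff_prod_one_add (s : Finset ι) (l : ι → ℝ) (k : ℕ) :
    (∏ i ∈ s, (1 + C (l i) * X) : ℝ[X]).coeff k = esymmOn s k l := by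
  induction s using Finset.induction_on generalizing k with
  | empty => cases k <;> simp [coeff_one]
  | insert a s ha ih =>
    rw [Finset.prod_insert ha, add_mul, one_mul, coeff_add, mul_assoc, coeff_C_mul]
    cases k with
    | zero => simp [ih]
    | succ k => rw [coeff_X_mul, ih, ih, esymmOn_insert ha]

lemma splits_derivative {f : ℝ[X]} (hf : f.Splits) : (derivative f).Splits := by
  rw [splits_iff_card_roots] at hf ⊢
  have h1 := card_roots_le_derivative f
  have h2 := card_roots' (derivative f)
  have h3 := natDegree_derivative_le f
  omega

/-- `f f'' ≤ f'²` for a polynomial with real roots only, since `log |f|` is concave between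
zeros. -/
lemma eval_mul_eval_derivative_le {f : ℝ[X]} (hf : f.Splits) (x : ℝ) :
    f.eval x * (derivative (derivative f)).eval x ≤ (derivative f).eval x ^ 2 := by
  refine Submonoid.closure_induction
    (motive := fun f _ => f.eval x * (derivative (derivative f)).eval x
      ≤ (derivative f).eval x ^ 2) ?_ ?_ ?_ hf
  · rintro f (⟨a, rfl⟩ | ⟨a, rfl⟩) <;> simp
  · simp
  · intro f g _ _ hf hg
    simp only [derivative_mul, derivative_add, eval_add, eval_mul]
    nlinarith [mul_le_mul_of_nonneg_left hf (sq_nonneg (g.eval x)),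
      mul_le_mul_of_nonneg_left hg (sq_nonneg (f.eval x))]

/-- A weak form of Newton's inequality, for real numbers of any sign. -/
lemma esymmOn_mul_le_sq (s : Finset ι) (l : ι → ℝ) (k : ℕ) :
    esymmOn s k l * esymmOn s (k + 2) l ≤ esymmOn s (k + 1) l ^ 2 := by
  set f : ℝ[X] := ∏ i ∈ s, (1 + C (l i) * X)
  have hf : f.Splits := Splits.prod fun i _ => by
    refine Splits.of_natDegree_le_one ?_
    rw [add_comm, ← C_1]
    exact natDegree_linear_le
  have hk (k : ℕ) : (derivative^[k] f).Splits := by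
    induction k with
    | zero => exact hf
    | succ k ih => rw [Function.iterate_succ_apply']; exact splits_derivative ih
  have he (k : ℕ) : (derivative^[k] f).eval 0 = k.factorial * esymmOn s k l := by
    rw [← coeff_zero_eq_eval_zero, coeff_iterate_derivative, coeff_prod_one_add]
    simp [Nat.descFactorial_self]
  have h := eval_mul_eval_derivative_le (hk k) 0
  rw [← Function.iterate_succ_apply' derivative, ← Function.iterate_succ_apply' derivative, he, he,
    he] at h
  rcases le_or_gt (esymmOn s k l * esymmOn s (k + 2) l) 0 with h0 | h0
  · exact h0.trans (sq_nonneg _)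
  simp only [Nat.factorial_succ] at h
  push_cast at h
  have hpos : (0 : ℝ) < k.factorial := by positivity
  have h1 : ((k.factorial : ℝ) ^ 2 * (k + 1)) * ((k + 2) * (esymmOn s k l * esymmOn s (k + 2) l))
      ≤ ((k.factorial : ℝ) ^ 2 * (k + 1)) * ((k + 1) * esymmOn s (k + 1) l ^ 2) := by
    refine le_of_eq_of_le ?_ (h.trans_eq ?_) <;> ring
  have h2 := le_of_mul_le_mul_left h1 (by positivity)
  have h3 : (k + 1 : ℝ) * (esymmOn s k l * esymmOn s (k + 2) l) ≤
      (k + 1) * esymmOn s (k + 1) l ^ 2 := by nlinarith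
  exact le_of_mul_le_mul_left h3 (by positivity)

/-- In the cone `{σ_j > 0, j ≤ k}` the derivatives `∂σ_{j+1}/∂l_i`, `j < k`, are positive. -/
lemma esymmOn_erase_pos {s : Finset ι} {l : ι → ℝ} {k : ℕ} (hl : ∀ j ≤ k, 0 < esymmOn s j l)
    {i : ι} (hi : i ∈ s) {j : ℕ} (hj : j < k) : 0 < esymmOn (s.erase i) j l := by
  induction j with
  | zero => simp
  | succ j ih =>
    have h0 := ih (by omega)
    by_contra! h1
    have h2 := hl (j + 1) (by omega)
    have h3 := hl (j + 2) (by omega)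
    rw [esymmOn_eq_erase hi] at h2 h3
    -- With `σ' = esymmOn (s.erase i)`, the bounds `σ'_{j+1} ≤ 0`, `σ'_{j+1} + l_i σ'_j > 0` and
    -- `σ'_{j+2} + l_i σ'_{j+1} > 0` contradict `σ'_j σ'_{j+2} ≤ σ'_{j+1}²`.
    have h4 := esymmOn_mul_le_sq (s.erase i) l j
    simp only [show j + 1 + 1 = j + 2 from rfl] at h3
    nlinarith [mul_pos h3 h0, mul_nonneg (neg_nonneg.2 h1) h2.le]

end Symmetric

section Cone

variable {n : ℕ}

lemma sigma_eq_esymmOn (k : ℕ) (l : Fin n → ℝ) : sigma k l = esymmOn Finset.univ k l := rfl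

/-- On `Γ_k` all the elementary symmetric functions of degree at most `k` are positive: they are so
on a subset of `{σ_k > 0}` which is both open and closed there. -/
lemma Gamma_subset {k : ℕ} (hk : k ≤ n) :
    Gamma n k ⊆ {l | ∀ j ≤ k, 0 < esymmOn Finset.univ j l} := by
  have h1 : (fun _ => 1 : Fin n → ℝ) ∈ {l : Fin n → ℝ | ∀ j ≤ k, 0 < esymmOn Finset.univ j l} := by
    intro j hj
    refine Finset.sum_pos (fun s _ => by simp) (Finset.powersetCard_nonempty.2 ?_)
    simpa using hj.trans hk
  refine isPreconnected_connectedComponentIn.subset_of_closure_inter_subset ?_ ?_ ?_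
  · have : {l : Fin n → ℝ | ∀ j ≤ k, 0 < esymmOn Finset.univ j l} =
        ⋂ j ∈ Finset.range (k + 1), {l | 0 < esymmOn Finset.univ j l} := by
      ext l; simp
    rw [this]
    exact isOpen_biInter_finset fun j _ => isOpen_lt continuous_const (continuous_esymmOn _ j)
  · exact ⟨_, mem_connectedComponentIn (h1 k le_rfl), h1⟩
  · rintro l ⟨hl, hlk⟩
    have hk0 : 0 < esymmOn Finset.univ k l := by
      have : l ∈ {l | 0 < sigma k l} := connectedComponentIn_subset _ _ hlk
      exact this
    have hge (j : ℕ) (hj : j ≤ k) : 0 ≤ esymmOn Finset.univ j l :=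
      closure_minimal (t := {l | 0 ≤ esymmOn Finset.univ j l}) (fun l hl => (hl j hj).le)
        (isClosed_le continuous_const (continuous_esymmOn _ j)) hl
    have hge' (i : Fin n) (j : ℕ) (hj : j < k) : 0 ≤ esymmOn (Finset.univ.erase i) j l :=
      closure_minimal (t := {l | 0 ≤ esymmOn (Finset.univ.erase i) j l})
        (fun l hl => (esymmOn_erase_pos hl (Finset.mem_univ i) hj).le)
        (isClosed_le continuous_const (continuous_esymmOn _ j)) hl
    intro j hj
    refine (hge j hj).lt_of_ne' fun h0 => ?_
    -- A zero of `σ_j` propagates to all higher degrees up to `k`.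
    have hz (m : ℕ) (hm : j + m ≤ k) : esymmOn Finset.univ (j + m) l = 0 := by
      induction m with
      | zero => exact h0
      | succ m ih =>
        have h2 := sum_esymmOn_erase Finset.univ (j + m) l
        rw [ih (by omega), mul_zero,
          Finset.sum_eq_zero_iff_of_nonneg fun i _ => hge' i (j + m) (by omega)] at h2
        have h3 := sum_mul_esymmOn_erase Finset.univ (j + m) l
        rw [Finset.sum_eq_zero fun i hi => by rw [h2 i hi, mul_zero]] at h3
        exact (mul_eq_zero.1 h3.symm).resolve_left (by positivity)
    have := hz (k - j) (by omega)
    rw [Nat.add_sub_cancel' hj] at this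
    exact hk0.ne' this

lemma esymmOn_nonneg_of_mem_closure {k : ℕ} (hk : k ≤ n) {l : Fin n → ℝ}
    (hl : l ∈ closure (Gamma n k)) {j : ℕ} (hj : j ≤ k) : 0 ≤ esymmOn Finset.univ j l :=
  closure_minimal (t := {l | 0 ≤ esymmOn Finset.univ j l})
    (fun _ hl => (Gamma_subset hk hl j hj).le)
    (isClosed_le continuous_const (continuous_esymmOn _ j)) hl

lemma esymmOn_erase_nonneg_of_mem_closure {k : ℕ} (hk : k ≤ n) {l : Fin n → ℝ}
    (hl : l ∈ closure (Gamma n k)) (i : Fin n) {j : ℕ} (hj : j < k) :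
    0 ≤ esymmOn (Finset.univ.erase i) j l :=
  closure_minimal (t := {l | 0 ≤ esymmOn (Finset.univ.erase i) j l})
    (fun _ hl => (esymmOn_erase_pos (Gamma_subset hk hl) (Finset.mem_univ i) hj).le)
    (isClosed_le continuous_const (continuous_esymmOn _ j)) hl

end Cone

/-! ### Newton tensors of symmetric matrices in terms of eigenvalues -/

section Diagonalization

open Matrix

variable {ι : Type*} [Fintype ι] [DecidableEq ι]

lemma newtonTensor_diagonal (d : ι → ℝ) (k : ℕ) :
    newtonTensor (diagonal d) k = diagonal fun i => esymmOn (Finset.univ.erase i) k d := by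
  induction k with
  | zero => simp
  | succ k ih =>
    simp only [newtonTensor, ih, diagonal_mul_diagonal, trace_diagonal, sum_mul_esymmOn_erase]
    ext i j
    by_cases h : i = j
    · subst h
      have : ((k : ℝ) + 1)⁻¹ * ((k + 1) * esymmOn Finset.univ (k + 1) d) =
        esymmOn Finset.univ (k + 1) d := by field_simp
      simp [this]
      rw [esymmOn_eq_erase (Finset.mem_univ i)]; ring
    · simp [h]

lemma newtonTensor_conj (U V D : Matrix ι ι ℝ) (hVU : V * U = 1) (hUV : U * V = 1) (k : ℕ) :
    newtonTensor (U * D * V) k = U * newtonTensor D k * V := by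
  induction k with
  | zero => simp [hUV]
  | succ k ih =>
    have h : U * D * V * (U * newtonTensor D k * V) = U * (D * newtonTensor D k) * V := by
      calc _ = U * D * (V * U) * newtonTensor D k * V := by simp only [mul_assoc]
        _ = _ := by rw [hVU]; simp only [mul_assoc, mul_one]
    simp only [newtonTensor, ih, h, mul_sub, sub_mul]
    congr 1
    rw [Matrix.trace_mul_comm, ← mul_assoc, hVU, one_mul]
    simp [hUV]

lemma newtonTensor_isHermitian {A : Matrix ι ι ℝ} (hA : A.IsHermitian) (k : ℕ) :
    ∃ U : Matrix ι ι ℝ, U * Uᵀ = 1 ∧ A = U * diagonal hA.eigenvalues * Uᵀ ∧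
      newtonTensor A k =
        U * (diagonal fun i => esymmOn (Finset.univ.erase i) k hA.eigenvalues) * Uᵀ := by
  set U : Matrix ι ι ℝ := (hA.eigenvectorUnitary).1 with hU
  have hst : star U = Uᵀ := by
    rw [star_eq_conjTranspose, conjTranspose_eq_transpose_of_trivial]
  have h1 : U * Uᵀ = 1 := by rw [← hst]; exact Unitary.coe_mul_star_self _
  have h2 : Uᵀ * U = 1 := by rw [← hst]; exact Unitary.coe_star_mul_self _
  have h3 : A = U * diagonal hA.eigenvalues * Uᵀ := by
    have := hA.spectral_theorem
    rw [Unitary.conjStarAlgAut_apply] at this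
    rw [← hst]
    exact this
  refine ⟨U, h1, h3, ?_⟩
  rw [← newtonTensor_diagonal, ← newtonTensor_conj _ _ _ h2 h1, ← h3]

lemma newtonSigma_isHermitian {A : Matrix ι ι ℝ} (hA : A.IsHermitian) (k : ℕ) :
    newtonSigma A k = esymmOn Finset.univ k hA.eigenvalues := by
  cases k with
  | zero => simp
  | succ k =>
    obtain ⟨U, h1, h2, h3⟩ := newtonTensor_isHermitian hA k
    have h1' := mul_eq_one_comm.1 h1
    have h : A * newtonTensor A k = U * (diagonal hA.eigenvalues *
        diagonal fun i => esymmOn (Finset.univ.erase i) k hA.eigenvalues) * Uᵀ := by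
      rw [h3]
      conv_lhs => enter [1]; rw [h2]
      calc _ = U * diagonal hA.eigenvalues * (Uᵀ * U) *
            (diagonal fun i => esymmOn (Finset.univ.erase i) k hA.eigenvalues) * Uᵀ := by
              simp only [mul_assoc]
        _ = _ := by rw [h1']; simp only [mul_assoc, mul_one]
    rw [newtonSigma, h, trace_mul_comm, ← mul_assoc, h1', one_mul, diagonal_mul_diagonal,
      trace_diagonal, sum_mul_esymmOn_erase, smul_eq_mul]
    field_simp

lemma dotProduct_conj_diagonal (U : Matrix ι ι ℝ) (d x : ι → ℝ) :
    x ⬝ᵥ (U * diagonal d * Uᵀ) *ᵥ x = ∑ i, d i * (Uᵀ *ᵥ x) i ^ 2 := by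
  rw [← mulVec_mulVec, ← mulVec_mulVec, dotProduct_mulVec, ← mulVec_transpose]
  simp only [dotProduct, mulVec_diagonal]
  exact Finset.sum_congr rfl fun i _ => by ring

/-- The matrix `T_j` is positive semidefinite on the closure of `Γ_k` for `j < k`, and bounded by
its trace. -/
lemma newtonTensor_quadratic_bounds {n k : ℕ} (hk : k ≤ n) {A : Matrix (Fin n) (Fin n) ℝ}
    (hA : A.IsHermitian) (hl : hA.eigenvalues ∈ closure (Gamma n k)) {j : ℕ} (hj : j < k)
    (x : Fin n → ℝ) :
    0 ≤ x ⬝ᵥ newtonTensor A j *ᵥ x ∧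
      x ⬝ᵥ newtonTensor A j *ᵥ x ≤ (n - j) * newtonSigma A j * ∑ i, x i ^ 2 := by
  obtain ⟨U, h1, h2, h3⟩ := newtonTensor_isHermitian hA j
  have h0 (i : Fin n) : 0 ≤ esymmOn (Finset.univ.erase i) j hA.eigenvalues :=
    esymmOn_erase_nonneg_of_mem_closure hk hl i hj
  have hx : ∑ i, (Uᵀ *ᵥ x) i ^ 2 = ∑ i, x i ^ 2 := by
    have := dotProduct_conj_diagonal U (fun _ => 1) x
    simp only [diagonal_one, mul_one, h1, one_mulVec, one_mul] at this
    rw [← this]; simp [dotProduct, pow_two]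
  rw [h3, dotProduct_conj_diagonal]
  refine ⟨Finset.sum_nonneg fun i _ => mul_nonneg (h0 i) (sq_nonneg _), ?_⟩
  rw [newtonSigma_isHermitian hA, ← hx, Finset.mul_sum]
  refine Finset.sum_le_sum fun i _ => mul_le_mul_of_nonneg_right ?_ (sq_nonneg _)
  have := sum_esymmOn_erase Finset.univ j hA.eigenvalues
  rw [Finset.card_univ, Fintype.card_fin] at this
  rw [← this]
  exact Finset.single_le_sum (f := fun i => esymmOn (Finset.univ.erase i) j hA.eigenvalues)
    (fun i _ => h0 i) (Finset.mem_univ i)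

/-- Cauchy–Schwarz for the positive semidefinite form `T_j`, with a weight. -/
lemma two_mul_newtonTensor_le {n k : ℕ} (hk : k ≤ n) {A : Matrix (Fin n) (Fin n) ℝ}
    (hA : A.IsHermitian) (hl : hA.eigenvalues ∈ closure (Gamma n k)) {j : ℕ} (hj : j < k)
    (x y : Fin n → ℝ) :
    2 * |y ⬝ᵥ newtonTensor A j *ᵥ x| ≤
      (n - j) * newtonSigma A j * (∑ i, x i ^ 2 + ∑ i, y i ^ 2) := by
  have hs : (newtonTensor A j)ᵀ = newtonTensor A j :=
    newtonTensor_transpose (by rw [← conjTranspose_eq_transpose_of_trivial]; exact hA) j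
  have hxy : x ⬝ᵥ newtonTensor A j *ᵥ y = y ⬝ᵥ newtonTensor A j *ᵥ x := by
    rw [dotProduct_mulVec, ← mulVec_transpose, hs, dotProduct_comm]
  have hx := (newtonTensor_quadratic_bounds hk hA hl hj x).2
  have hy := (newtonTensor_quadratic_bounds hk hA hl hj y).2
  have h1 := (newtonTensor_quadratic_bounds hk hA hl hj (x + y)).1
  have h2 := (newtonTensor_quadratic_bounds hk hA hl hj (x - y)).1
  simp only [mulVec_add, mulVec_sub, add_dotProduct, sub_dotProduct, dotProduct_add,
    dotProduct_sub, hxy] at h1 h2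
  rw [show (2 : ℝ) * |y ⬝ᵥ newtonTensor A j *ᵥ x| = |2 * y ⬝ᵥ newtonTensor A j *ᵥ x| by
    rw [abs_mul, abs_two], abs_le]
  constructor <;> linarith

end Diagonalization

/-! ### The divergence identity for smooth functions -/

section Smooth

open Matrix
open scoped ContDiff

variable {n : ℕ}

/-- The algebra of smooth functions on `ℝⁿ`. -/
def smoothFunctions (n : ℕ) : Subalgebra ℝ (EuclideanSpace ℝ (Fin n) → ℝ) where
  carrier := {f | ContDiff ℝ ∞ f}
  mul_mem' := fun {f g} (hf : ContDiff ℝ ∞ f) (hg : ContDiff ℝ ∞ g) => hf.mul hg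
  add_mem' := fun {f g} (hf : ContDiff ℝ ∞ f) (hg : ContDiff ℝ ∞ g) => hf.add hg
  algebraMap_mem' := fun r => (contDiff_const : ContDiff ℝ ∞ fun _ => r)

lemma contDiff_coe (f : smoothFunctions n) : ContDiff ℝ ∞ f.1 := f.2

lemma contDiff_partialDeriv {f : EuclideanSpace ℝ (Fin n) → ℝ} {a b : ℕ∞ω}
    (hf : ContDiff ℝ b f) (h : a + 1 ≤ b) (i : Fin n) : ContDiff ℝ a (partialDeriv f i) :=
  (hf.fderiv_right h).clm_apply contDiff_const

lemma partialDeriv_mem_smoothFunctions (f : smoothFunctions n) (i : Fin n) :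
    partialDeriv f.1 i ∈ smoothFunctions n := by
  have : ContDiff ℝ ∞ (partialDeriv f.1 i) := contDiff_partialDeriv (contDiff_coe f) (by simp) i
  exact this

/-- The partial derivative `∂_i` as a derivation of the algebra of smooth functions. -/
def partialDerivation (i : Fin n) : Derivation ℝ (smoothFunctions n) (smoothFunctions n) :=
  Derivation.mk'
    { toFun := fun f => ⟨partialDeriv f.1 i, partialDeriv_mem_smoothFunctions f i⟩
      map_add' := fun f g => by
        ext x
        have hf := ((contDiff_coe f).differentiable (by simp)) x
        have hg := ((contDiff_coe g).differentiable (by simp)) x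
        change fderiv ℝ (f.1 + g.1) x _ = fderiv ℝ f.1 x _ + fderiv ℝ g.1 x _
        rw [fderiv_add hf hg]; rfl
      map_smul' := fun r f => by
        ext x
        have hf := ((contDiff_coe f).differentiable (by simp)) x
        change fderiv ℝ (r • f.1) x _ = r * fderiv ℝ f.1 x _
        rw [fderiv_const_smul hf]; rfl }
    (fun f g => by
      ext x
      have hf := ((contDiff_coe f).differentiable (by simp)) x
      have hg := ((contDiff_coe g).differentiable (by simp)) x
      change fderiv ℝ (f.1 * g.1) x _ = f.1 x * fderiv ℝ g.1 x _ + g.1 x * fderiv ℝ f.1 x _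
      rw [fderiv_mul hf hg]; rfl)

lemma partialDeriv_comm {f : EuclideanSpace ℝ (Fin n) → ℝ} {x : EuclideanSpace ℝ (Fin n)}
    (hf : ContDiffAt ℝ 2 f x) (i j : Fin n) :
    partialDeriv (partialDeriv f i) j x = partialDeriv (partialDeriv f j) i x := by
  have hd : DifferentiableAt ℝ (fderiv ℝ f) x :=
    (hf.fderiv_right (m := 1) (by norm_num)).differentiableAt (by simp)
  have h (i j : Fin n) : partialDeriv (partialDeriv f i) j x =
      fderiv ℝ (fderiv ℝ f) x (EuclideanSpace.single j 1) (EuclideanSpace.single i 1) := by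
    unfold partialDeriv
    rw [fderiv_clm_apply hd (differentiableAt_const _)]
    simp
  have hs : IsSymmSndFDerivAt ℝ f x := hf.isSymmSndFDerivAt (by simp)
  rw [h, h, hs.eq]

/-- The gradient of `ψ` in coordinates. -/
def grad (ψ : EuclideanSpace ℝ (Fin n) → ℝ) (x : EuclideanSpace ℝ (Fin n)) : Fin n → ℝ :=
  fun i => partialDeriv ψ i x

/-- The Hessian matrix of `ψ`. -/
def hess (ψ : EuclideanSpace ℝ (Fin n) → ℝ) (x : EuclideanSpace ℝ (Fin n)) :
    Matrix (Fin n) (Fin n) ℝ :=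
  .of fun i j => partialDeriv (partialDeriv ψ i) j x

lemma F_eq_schoutenMatrix {ψ : EuclideanSpace ℝ (Fin n) → ℝ} {x : EuclideanSpace ℝ (Fin n)}
    (hψ : ContDiffAt ℝ 2 ψ x) : F ψ x = schoutenMatrix (grad ψ x) (hess ψ x) := by
  have hd : DifferentiableAt ℝ (fderiv ℝ ψ) x :=
    (hψ.fderiv_right (m := 1) (by norm_num)).differentiableAt (by simp)
  have h (i j : Fin n) : partialDeriv (partialDeriv ψ i) j x =
      fderiv ℝ (fderiv ℝ ψ) x (EuclideanSpace.single j 1) (EuclideanSpace.single i 1) := by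
    rw [partialDeriv]
    change fderiv ℝ (fun y => fderiv ℝ ψ y (EuclideanSpace.single i 1)) x _ = _
    rw [fderiv_clm_apply hd (differentiableAt_const _)]
    simp
  ext i j
  simp only [F, schoutenMatrix, of_apply, hess, grad, smul_eq_mul]
  rw [partialDeriv_comm hψ, h]

/-- The vector field `|p|^{2m} T_k p`, a function of the gradient `p` and the Hessian `H`. -/
def fluxField (k m : ℕ) (z : (Fin n → ℝ) × Matrix (Fin n) (Fin n) ℝ) : Fin n → ℝ :=
  (∑ l, z.1 l ^ 2) ^ m • (newtonTensor (schoutenMatrix z.1 z.2) k *ᵥ z.1)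

/-- The divergence of `fluxField`, which involves no third derivatives. -/
def fluxDiv (k m : ℕ) (z : (Fin n → ℝ) × Matrix (Fin n) (Fin n) ℝ) : ℝ :=
  ((k : ℝ) + 1 + 2 * m) * newtonSigma (schoutenMatrix z.1 z.2) (k + 1) * (∑ l, z.1 l ^ 2) ^ m
    - ((n : ℝ) - k) / 2 * newtonSigma (schoutenMatrix z.1 z.2) k * (∑ l, z.1 l ^ 2) ^ (m + 1)
    + ((n : ℝ) - 2 * k - 1 - m) * (z.1 ⬝ᵥ newtonTensor (schoutenMatrix z.1 z.2) k *ᵥ z.1)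
        * (∑ l, z.1 l ^ 2) ^ m
    - 2 * m * (∑ l, z.1 l ^ 2) ^ (m - 1)
        * (z.1 ⬝ᵥ newtonTensor (schoutenMatrix z.1 z.2) (k + 1) *ᵥ z.1)

lemma sum_partialDeriv_fluxField {ψ : EuclideanSpace ℝ (Fin n) → ℝ} (hψ : ContDiff ℝ ∞ ψ)
    (k m : ℕ) :
    (∀ i, ContDiff ℝ ∞ fun x => fluxField k m (grad ψ x, hess ψ x) i) ∧
    ∀ x, ∑ i, partialDeriv (fun x => fluxField k m (grad ψ x, hess ψ x) i) i x =
      fluxDiv k m (grad ψ x, hess ψ x) := by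
  let ψ' : smoothFunctions n := ⟨ψ, hψ⟩
  let p : Fin n → smoothFunctions n := fun i => partialDerivation i ψ'
  let H : Matrix (Fin n) (Fin n) (smoothFunctions n) := .of fun i j => partialDerivation j (p i)
  let ev (x : EuclideanSpace ℝ (Fin n)) : smoothFunctions n →ₐ[ℝ] ℝ :=
    (Pi.evalAlgHom ℝ (fun _ => ℝ) x).comp (smoothFunctions n).val
  have hcomm (f : smoothFunctions n) (i j : Fin n) :
      partialDerivation i (partialDerivation j f) =
        partialDerivation j (partialDerivation i f) := by
    ext x
    exact partialDeriv_comm (contDiff_infty.1 (contDiff_coe f) 2).contDiffAt j i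
  have hsym : Hᵀ = H := by ext1 i j; exact hcomm ψ' i j
  have hcod (i j l : Fin n) :
      partialDerivation l (H i j) = partialDerivation j (H i l) := hcomm (p i) l j
  have hp (x) : (fun i => ev x (p i)) = grad ψ x := rfl
  have hpi (x) (i : Fin n) : ev x (p i) = grad ψ x i := rfl
  have hH (x) : H.map (ev x) = hess ψ x := rfl
  have hA (x) : (schoutenMatrix p H).map (ev x) = schoutenMatrix (grad ψ x) (hess ψ x) := by
    ext i j
    simp only [schoutenMatrix, Matrix.map_apply, of_apply, map_sub, map_add, map_mul, hpi,
      apply_ite (ev x), map_zero, map_smul, map_sum, map_pow]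
    rfl
  have hs (x) : ev x (∑ l, p l ^ 2) = ∑ l, grad ψ x l ^ 2 := by
    simp only [map_sum, map_pow, hpi]
  have hT (x) (k : ℕ) (i : Fin n) : ev x ((newtonTensor (schoutenMatrix p H) k *ᵥ p) i) =
      (newtonTensor (schoutenMatrix (grad ψ x) (hess ψ x)) k *ᵥ grad ψ x) i := by
    rw [← hA, ← newtonTensor_map]
    simp only [mulVec, dotProduct, map_sum, map_mul, hpi, Matrix.map_apply]
  have hpT (x) (k : ℕ) : ev x (p ⬝ᵥ newtonTensor (schoutenMatrix p H) k *ᵥ p) =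
      grad ψ x ⬝ᵥ newtonTensor (schoutenMatrix (grad ψ x) (hess ψ x)) k *ᵥ grad ψ x := by
    simp only [dotProduct, map_sum, map_mul, hpi, hT]
  have hS (x) (k : ℕ) : ev x (newtonSigma (schoutenMatrix p H) k) =
      newtonSigma (schoutenMatrix (grad ψ x) (hess ψ x)) k := by
    rw [newtonSigma_map, hA]
  let V (i : Fin n) : smoothFunctions n :=
    (∑ l, p l ^ 2) ^ m * (newtonTensor (schoutenMatrix p H) k *ᵥ p) i
  have hV (i : Fin n) : (V i).1 = fun x => fluxField k m (grad ψ x, hess ψ x) i := by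
    ext x
    change ev x (V i) = _
    simp only [V, map_mul, map_pow, hs, hT, fluxField, Pi.smul_apply, smul_eq_mul]
  refine ⟨fun i => ?_, fun x => ?_⟩
  · rw [← hV]; exact (V i).2
  · simp_rw [← hV]
    have h := congrArg (ev x) (div_pow_mul_newtonTensor_mulVec
      (D := fun i => partialDerivation i) (p := p) (H := H) (fun _ _ => rfl) hsym hcod k m)
    simp only [map_mul, map_sum, map_sub, map_add, map_pow, map_one, map_natCast, map_ofNat, hS,
      hpT, hpi, Fintype.card_fin] at h
    change 2 * ∑ i, partialDeriv (V i).1 i x = _ at h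
    rw [fluxDiv]
    linear_combination (1 / 2 : ℝ) * h

lemma continuous_schoutenMatrix : Continuous fun z : (Fin n → ℝ) × Matrix (Fin n) (Fin n) ℝ =>
    schoutenMatrix z.1 z.2 := by
  refine continuous_matrix fun i j => ?_
  simp only [schoutenMatrix, of_apply]
  have : Continuous fun z : (Fin n → ℝ) × Matrix (Fin n) (Fin n) ℝ => z.2 i j :=
    continuous_snd.matrix_elem i j
  split_ifs <;> fun_prop

lemma continuous_newtonTensor (k : ℕ) :
    Continuous fun A : Matrix (Fin n) (Fin n) ℝ => newtonTensor A k := by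
  induction k with
  | zero => exact continuous_const
  | succ k ih =>
    have h : Continuous fun A : Matrix (Fin n) (Fin n) ℝ => A * newtonTensor A k :=
      continuous_id.matrix_mul ih
    have h' := h.matrix_trace
    simp only [newtonTensor]
    fun_prop

lemma continuous_newtonSigma (k : ℕ) :
    Continuous fun A : Matrix (Fin n) (Fin n) ℝ => newtonSigma A k := by
  cases k with
  | zero => exact continuous_const
  | succ k =>
    have h : Continuous fun A : Matrix (Fin n) (Fin n) ℝ => (A * newtonTensor A k).trace :=
      (continuous_id.matrix_mul (continuous_newtonTensor k)).matrix_trace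
    simp only [newtonSigma]
    fun_prop

lemma continuous_fluxField (k m : ℕ) : Continuous (fluxField (n := n) k m) := by
  have h1 := (continuous_newtonTensor (n := n) k).comp continuous_schoutenMatrix
  have h2 : Continuous fun z : (Fin n → ℝ) × Matrix (Fin n) (Fin n) ℝ =>
      newtonTensor (schoutenMatrix z.1 z.2) k *ᵥ z.1 := h1.matrix_mulVec continuous_fst
  unfold fluxField
  fun_prop

lemma continuous_fluxDiv (k m : ℕ) : Continuous (fluxDiv (n := n) k m) := by
  have hq (k : ℕ) : Continuous fun z : (Fin n → ℝ) × Matrix (Fin n) (Fin n) ℝ =>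
      z.1 ⬝ᵥ newtonTensor (schoutenMatrix z.1 z.2) k *ᵥ z.1 :=
    continuous_fst.dotProduct (((continuous_newtonTensor (n := n) k).comp
      continuous_schoutenMatrix).matrix_mulVec continuous_fst)
  have hS (k : ℕ) : Continuous fun z : (Fin n → ℝ) × Matrix (Fin n) (Fin n) ℝ =>
      newtonSigma (schoutenMatrix z.1 z.2) k :=
    (continuous_newtonSigma k).comp continuous_schoutenMatrix
  have := hq k
  have := hq (k + 1)
  have := hS k
  have := hS (k + 1)
  unfold fluxDiv
  fun_prop

lemma hasCompactSupport_partialDeriv {f : EuclideanSpace ℝ (Fin n) → ℝ}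
    (hf : HasCompactSupport f) (i : Fin n) : HasCompactSupport (partialDeriv f i) :=
  hf.fderiv_apply ℝ _

lemma integral_fluxDiv_mul_of_smooth {ψ χ : EuclideanSpace ℝ (Fin n) → ℝ} (hψ : ContDiff ℝ ∞ ψ)
    (hχ : ContDiff ℝ 1 χ) (hχc : HasCompactSupport χ) (k m : ℕ) :
    ∫ x, fluxDiv k m (grad ψ x, hess ψ x) * χ x =
      -∫ x, ∑ i, fluxField k m (grad ψ x, hess ψ x) i * partialDeriv χ i x := by
  obtain ⟨hV, hdiv⟩ := sum_partialDeriv_fluxField hψ k m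
  set V : Fin n → EuclideanSpace ℝ (Fin n) → ℝ :=
    fun i x => fluxField k m (grad ψ x, hess ψ x) i with hVdef
  have hV' (i : Fin n) : Continuous (partialDeriv (V i) i) :=
    (contDiff_partialDeriv (hV i) (a := 0) (by simp) i).continuous
  have hχ' (i : Fin n) : Continuous (partialDeriv χ i) :=
    (contDiff_partialDeriv hχ (a := 0) (by simp) i).continuous
  have i1 (i : Fin n) : Integrable fun x => partialDeriv (V i) i x * χ x :=
    ((hV' i).mul hχ.continuous).integrable_of_hasCompactSupport hχc.mul_left
  have i2 (i : Fin n) : Integrable fun x => V i x * partialDeriv χ i x :=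
    ((hV i).continuous.mul (hχ' i)).integrable_of_hasCompactSupport
      (hasCompactSupport_partialDeriv hχc i).mul_left
  have i3 (i : Fin n) : Integrable fun x => V i x * χ x :=
    ((hV i).continuous.mul hχ.continuous).integrable_of_hasCompactSupport hχc.mul_left
  simp_rw [← hdiv, Finset.sum_mul]
  rw [integral_finsetSum _ fun i _ => i1 i, integral_finsetSum _ fun i _ => i2 i,
    ← Finset.sum_neg_distrib]
  refine Finset.sum_congr rfl fun i _ => ?_
  have := integral_mul_fderiv_eq_neg_fderiv_mul_of_integrable (μ := volume)
    (v := EuclideanSpace.single i (1 : ℝ)) (i1 i) (i2 i) (i3 i)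
    (fun x _ => (hV i).differentiable (by simp) x) (fun x _ => hχ.differentiable (by simp) x)
  exact (neg_eq_iff_eq_neg.2 this).symm

end Smooth

/-! ### Mollification -/

section Mollify

open Matrix Filter Topology
open scoped ContDiff Convolution

variable {n : ℕ}

lemma partialDeriv_convolution {φ g : EuclideanSpace ℝ (Fin n) → ℝ} (hφ : LocallyIntegrable φ)
    (hg : ContDiff ℝ 1 g) (hgc : HasCompactSupport g) (i : Fin n) :
    partialDeriv (φ ⋆[ContinuousLinearMap.lsmul ℝ ℝ, volume] g) i =
      φ ⋆[ContinuousLinearMap.lsmul ℝ ℝ, volume] partialDeriv g i := by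
  ext x
  have := hgc.hasFDerivAt_convolution_right (ContinuousLinearMap.lsmul ℝ ℝ) hφ hg x
  rw [partialDeriv, this.fderiv, convolution_precompR_apply _ hφ (hgc.fderiv ℝ)
    (hg.continuous_fderiv (by simp))]
  rfl

/-- A sequence of bump functions shrinking to the origin. -/
def mollifierSeq (n N : ℕ) : ContDiffBump (0 : EuclideanSpace ℝ (Fin n)) where
  rIn := 1 / ((N : ℝ) + 1)
  rOut := 2 / ((N : ℝ) + 1)
  rIn_pos := by positivity
  rIn_lt_rOut := by gcongr; norm_num

lemma tendsto_mollifierSeq_rOut : Tendsto (fun N => (mollifierSeq n N).rOut) atTop (𝓝 0) := by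
  have := (tendsto_one_div_add_atTop_nhds_zero_nat (𝕜 := ℝ)).const_mul 2
  simpa [mollifierSeq, mul_one_div, div_eq_mul_inv] using this

/-- The mollification of `g` by the `N`-th element of `mollifierSeq`. -/
def mollify (N : ℕ) (g : EuclideanSpace ℝ (Fin n) → ℝ) : EuclideanSpace ℝ (Fin n) → ℝ :=
  (mollifierSeq n N).normed volume ⋆[ContinuousLinearMap.lsmul ℝ ℝ, volume] g

lemma partialDeriv_mollify {g : EuclideanSpace ℝ (Fin n) → ℝ} (hg : ContDiff ℝ 1 g)
    (hgc : HasCompactSupport g) (N : ℕ) (i : Fin n) :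
    partialDeriv (mollify N g) i = mollify N (partialDeriv g i) :=
  partialDeriv_convolution (mollifierSeq n N).continuous_normed.locallyIntegrable hg hgc i

lemma contDiff_mollify {g : EuclideanSpace ℝ (Fin n) → ℝ} (hg : Continuous g) (N : ℕ) :
    ContDiff ℝ ∞ (mollify N g) :=
  (mollifierSeq n N).hasCompactSupport_normed.contDiff_convolution_left _
    (mollifierSeq n N).contDiff_normed hg.locallyIntegrable

lemma tendsto_mollify {g : EuclideanSpace ℝ (Fin n) → ℝ} (hg : Continuous g)
    (x : EuclideanSpace ℝ (Fin n)) : Tendsto (fun N => mollify N g x) atTop (𝓝 (g x)) :=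
  ContDiffBump.convolution_tendsto_right_of_continuous tendsto_mollifierSeq_rOut hg x

lemma abs_mollify_le {g : EuclideanSpace ℝ (Fin n) → ℝ} (hg : Continuous g) {M : ℝ}
    (hM : ∀ x, |g x| ≤ M) (N : ℕ) (x : EuclideanSpace ℝ (Fin n)) : |mollify N g x| ≤ 3 * M := by
  have h : dist (mollify N g x) (g x) ≤ 2 * M :=
    (mollifierSeq n N).dist_normed_convolution_le hg.aestronglyMeasurable fun y _ => by
      rw [Real.dist_eq]
      have := abs_sub (g y) (g x)
      linarith [hM x, hM y]
  rw [Real.dist_eq] at h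
  have := abs_sub_abs_le_abs_sub (mollify N g x) (g x)
  linarith [hM x]

/-- Integrals of functions of the first and second derivatives of `ψ` are limits of those of its
mollifications, by dominated convergence. -/
lemma tendsto_integral_mollify {ψ χ : EuclideanSpace ℝ (Fin n) → ℝ} (hψ : ContDiff ℝ 2 ψ)
    (hψc : HasCompactSupport ψ) (hχ : Continuous χ) (hχc : HasCompactSupport χ)
    {G : (Fin n → ℝ) × Matrix (Fin n) (Fin n) ℝ → ℝ} (hG : Continuous G) :
    Tendsto (fun N => ∫ x, G (grad (mollify N ψ) x, hess (mollify N ψ) x) * χ x) atTop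
      (𝓝 (∫ x, G (grad ψ x, hess ψ x) * χ x)) := by
  have hp1 (i : Fin n) : ContDiff ℝ 1 (partialDeriv ψ i) :=
    contDiff_partialDeriv hψ (by norm_num) i
  have hpc (i : Fin n) := hasCompactSupport_partialDeriv hψc i
  have hH1 (i j : Fin n) : Continuous (partialDeriv (partialDeriv ψ i) j) :=
    (contDiff_partialDeriv (hp1 i) (a := 0) (by simp) j).continuous
  have hHc (i j : Fin n) := hasCompactSupport_partialDeriv (hpc i) j
  have hgrad (N : ℕ) (x) : grad (mollify N ψ) x = fun i => mollify N (partialDeriv ψ i) x := by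
    ext i
    rw [grad, partialDeriv_mollify (hψ.of_le (by norm_num)) hψc]
  have hhess (N : ℕ) (x) : hess (mollify N ψ) x =
      .of fun i j => mollify N (partialDeriv (partialDeriv ψ i) j) x := by
    ext i j
    rw [hess, of_apply, of_apply, partialDeriv_mollify (hψ.of_le (by norm_num)) hψc,
      partialDeriv_mollify (hp1 i) (hpc i)]
  obtain ⟨M₁, hM₁⟩ : ∃ M, ∀ i x, |partialDeriv ψ i x| ≤ M := by
    choose M hM using fun i => (hp1 i).continuous.bounded_above_of_compact_support (hpc i)
    exact ⟨∑ i, |M i|, fun i x => ((hM i x).trans (le_abs_self _)).trans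
      (Finset.single_le_sum (f := fun i => |M i|) (fun i _ => abs_nonneg _) (Finset.mem_univ i))⟩
  obtain ⟨M₂, hM₂⟩ : ∃ M, ∀ i j x, |partialDeriv (partialDeriv ψ i) j x| ≤ M := by
    choose M hM using fun q : Fin n × Fin n =>
      (hH1 q.1 q.2).bounded_above_of_compact_support (hHc q.1 q.2)
    exact ⟨∑ q, |M q|, fun i j x => ((hM (i, j) x).trans (le_abs_self _)).trans
      (Finset.single_le_sum (f := fun q => |M q|) (fun i _ => abs_nonneg _)
        (Finset.mem_univ (i, j)))⟩
  let K : Set ((Fin n → ℝ) × Matrix (Fin n) (Fin n) ℝ) :=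
    (Set.univ.pi fun _ => Set.Icc (-(3 * M₁)) (3 * M₁)) ×ˢ
      (Set.univ.pi fun _ => Set.univ.pi fun _ => Set.Icc (-(3 * M₂)) (3 * M₂))
  have hK : IsCompact K := (isCompact_univ_pi fun _ => isCompact_Icc).prod
    (isCompact_univ_pi fun _ => isCompact_univ_pi fun _ => isCompact_Icc)
  obtain ⟨C, hC⟩ := hK.exists_bound_of_continuousOn hG.continuousOn
  have hmem (N : ℕ) (x) : (grad (mollify N ψ) x, hess (mollify N ψ) x) ∈ K := by
    rw [hgrad, hhess]
    refine ⟨fun i _ => ?_, fun i _ j _ => ?_⟩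
    · exact abs_le.1 (abs_mollify_le (hp1 i).continuous (hM₁ i) N x)
    · exact abs_le.1 (abs_mollify_le (hH1 i j) (hM₂ i j) N x)
  have hGc (N : ℕ) : Continuous fun x => G (grad (mollify N ψ) x, hess (mollify N ψ) x) := by
    have h1 : Continuous fun x => grad (mollify N ψ) x := by
      simp_rw [hgrad]
      exact continuous_pi fun i => (contDiff_mollify (hp1 i).continuous N).continuous
    have h2 : Continuous fun x => hess (mollify N ψ) x := by
      simp_rw [hhess]
      exact continuous_matrix fun i j => (contDiff_mollify (hH1 i j) N).continuous
    exact hG.comp (h1.prodMk h2)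
  refine tendsto_integral_of_dominated_convergence (fun x => C * |χ x|)
    (fun N => ((hGc N).mul hχ).aestronglyMeasurable) ?_ ?_ ?_
  · exact ((hχ.abs.integrable_of_hasCompactSupport hχc.norm)).const_mul C
  · intro N
    filter_upwards with x
    rw [norm_mul, Real.norm_eq_abs (χ x)]
    exact mul_le_mul_of_nonneg_right (hC _ (hmem N x)) (abs_nonneg _)
  · filter_upwards with x
    have h1 : Tendsto (fun N => grad (mollify N ψ) x) atTop (𝓝 (grad ψ x)) := by
      simp_rw [hgrad]
      exact tendsto_pi_nhds.2 fun i => tendsto_mollify (hp1 i).continuous x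
    have h2 : Tendsto (fun N => hess (mollify N ψ) x) atTop (𝓝 (hess ψ x)) := by
      simp_rw [hhess]
      exact tendsto_pi_nhds.2 fun i => tendsto_pi_nhds.2 fun j => tendsto_mollify (hH1 i j) x
    exact Tendsto.mul_const _ ((hG.tendsto _).comp (h1.prodMk_nhds h2))

/-- The divergence identity in weak form. It is meaningful for `ψ` of class `C²`, although the
components of the vector field are only continuous. -/
lemma integral_fluxDiv_mul {ψ χ : EuclideanSpace ℝ (Fin n) → ℝ} (hψ : ContDiff ℝ 2 ψ)
    (hψc : HasCompactSupport ψ) (hχ : ContDiff ℝ 1 χ) (hχc : HasCompactSupport χ) (k m : ℕ) :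
    ∫ x, fluxDiv k m (grad ψ x, hess ψ x) * χ x =
      -∫ x, ∑ i, fluxField k m (grad ψ x, hess ψ x) i * partialDeriv χ i x := by
  have hχ' (i : Fin n) : Continuous (partialDeriv χ i) :=
    (contDiff_partialDeriv hχ (a := 0) (by simp) i).continuous
  have hχc' (i : Fin n) := hasCompactSupport_partialDeriv hχc i
  have hV (i : Fin n) : Continuous fun z => fluxField (n := n) k m z i :=
    (continuous_apply i).comp (continuous_fluxField k m)
  have hsum {ψ : EuclideanSpace ℝ (Fin n) → ℝ} (hψ : ContDiff ℝ 2 ψ) :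
      ∫ x, ∑ i, fluxField k m (grad ψ x, hess ψ x) i * partialDeriv χ i x =
        ∑ i, ∫ x, fluxField k m (grad ψ x, hess ψ x) i * partialDeriv χ i x := by
    have hp (i : Fin n) : ContDiff ℝ 1 (partialDeriv ψ i) :=
      contDiff_partialDeriv hψ (by norm_num) i
    have hc : Continuous fun x => (grad ψ x, hess ψ x) :=
      (continuous_pi fun i => (hp i).continuous).prodMk (continuous_matrix fun i j =>
        (contDiff_partialDeriv (hp i) (a := 0) (by simp) j).continuous)
    exact integral_finsetSum _ fun i _ => (((hV i).comp hc).mul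
      (hχ' i)).integrable_of_hasCompactSupport (hχc' i).mul_left
  have h1 := tendsto_integral_mollify hψ hψc hχ.continuous hχc (continuous_fluxDiv k m)
  have h2 := tendsto_finsetSum Finset.univ fun i _ =>
    tendsto_integral_mollify hψ hψc (hχ' i) (hχc' i) (hV i)
  rw [hsum hψ]
  refine tendsto_nhds_unique h1 (h2.neg.congr fun N => ?_)
  have hs := contDiff_mollify hψ.continuous N
  rw [integral_fluxDiv_mul_of_smooth hs hχ hχc, hsum (contDiff_infty.1 hs 2)]

end Mollify

/-! ### The energy estimate -/

section Absorption

/-- If `J_j` is controlled by `J_{j+1}` and `R_j`, and `R_{j+1}` by `J_j` with an arbitrarily small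
constant up to a multiple of `R_j`, then `R_j` is controlled by `J_j` with an arbitrarily small
constant up to a multiple of `R_0`, which is polynomial in `a`. -/
lemma exists_remainder_le (k : ℕ) {C K : ℝ} (hC : 1 ≤ C) (hK : 1 ≤ K) (j : ℕ) :
    ∃ D : ℝ, 1 ≤ D ∧ ∃ N : ℕ, ∀ (a : ℝ) (J R : ℕ → ℝ), 1 ≤ a → (∀ i, 0 ≤ J i) → (∀ i, 0 ≤ R i) →
      (∀ i < k, J i ≤ C * (J (i + 1) + R i)) →
      (∀ i, i + 1 < k → ∀ θ : ℝ, 0 < θ → θ ≤ 1 →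
        R (i + 1) ≤ K * a * (θ * J i + 2 / θ * R i)) →
      j < k → ∀ ε : ℝ, 0 < ε → ε ≤ 1 → R j ≤ ε * J j + D * (a / ε) ^ N * R 0 := by
  induction j with
  | zero =>
    refine ⟨1, le_rfl, 0, fun a J R _ hJ _ _ _ _ ε hε _ => ?_⟩
    have := mul_nonneg hε.le (hJ 0)
    simpa using this
  | succ j ih =>
    obtain ⟨D, hD, N, h⟩ := ih
    refine ⟨D * ((2 * C) ^ N + 12 * K ^ 2 * C * (36 * K ^ 2 * C ^ 2) ^ N), ?_, 5 * N + 3, ?_⟩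
    · have h1 : (1 : ℝ) ≤ (2 * C) ^ N := one_le_pow₀ (by linarith)
      have h2 : 0 ≤ 12 * K ^ 2 * C * (36 * K ^ 2 * C ^ 2) ^ N := by positivity
      nlinarith
    intro a J R ha hJ hR h1 h2 hj ε hε hε1
    have h := h a J R ha hJ hR h1 h2 (by omega)
    set b := a / ε with hb
    have hba : a ≤ b := by rw [hb, le_div_iff₀ hε]; nlinarith
    have hbε : 1 / ε ≤ b := by rw [hb]; gcongr
    have hb1 : 1 ≤ b := ha.trans hba
    have hKC : 1 ≤ K * C := one_le_mul_of_one_le_of_one_le hK hC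
    have hKCa : 1 ≤ K * C * a := one_le_mul_of_one_le_of_one_le hKC ha
    -- This `θ` makes the coefficient of `J_{j+1}` equal to `ε`.
    set θ := ε / (6 * (K * C * a)) with hθ
    have hθ0 : 0 < θ := by positivity
    have hθ1 : θ ≤ 1 := by rw [hθ, div_le_one (by positivity)]; linarith
    have e1 : J j ≤ 2 * C * J (j + 1) + 2 * C * (D * (2 * C * a) ^ N * R 0) := by
      have := h (1 / (2 * C)) (by positivity) (by rw [div_le_one (by positivity)]; linarith)
      have h3 := h1 j (by omega)
      have h4 : a / (1 / (2 * C)) = 2 * C * a := by field_simp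
      rw [h4] at this
      have h5 := mul_le_mul_of_nonneg_left this (show (0 : ℝ) ≤ C by linarith)
      have h6 : C * (1 / (2 * C) * J j + D * (2 * C * a) ^ N * R 0) =
        J j / 2 + C * (D * (2 * C * a) ^ N * R 0) := by field_simp
      linarith
    have e2 := h2 j hj θ hθ0 hθ1
    have e3 := h (θ ^ 2) (by positivity) (by nlinarith)
    have e4 : 2 / θ * R j ≤ 2 * θ * J j + 2 / θ * (D * (a / θ ^ 2) ^ N * R 0) := by
      have := mul_le_mul_of_nonneg_left e3 (show 0 ≤ 2 / θ by positivity)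
      refine this.trans_eq ?_
      field_simp
    have e5 : R (j + 1) ≤
        K * a * (3 * θ) * J j + K * a * (2 / θ * (D * (a / θ ^ 2) ^ N * R 0)) := by
      have := mul_le_mul_of_nonneg_left e4 (show 0 ≤ K * a by positivity)
      linarith
    have e6 : K * a * (3 * θ) * J j ≤ ε * J (j + 1) + ε * (D * (2 * C * a) ^ N * R 0) := by
      have h7 : K * a * (3 * θ) * (2 * C) = ε := by rw [hθ]; field_simp; norm_num
      have := mul_le_mul_of_nonneg_left e1 (show 0 ≤ K * a * (3 * θ) by positivity)
      refine this.trans_eq ?_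
      rw [← h7]; ring
    have hR0 := hR 0
    have hbN : b ^ N ≤ b ^ (5 * N + 3) := pow_le_pow_right₀ hb1 (by omega)
    have e7 : ε * (D * (2 * C * a) ^ N * R 0) ≤ D * (2 * C) ^ N * b ^ (5 * N + 3) * R 0 := by
      have h8 : (2 * C * a) ^ N ≤ (2 * C) ^ N * b ^ (5 * N + 3) := by
        rw [mul_pow]
        exact mul_le_mul_of_nonneg_left ((pow_le_pow_left₀ (by linarith) hba N).trans hbN)
          (by positivity)
      have h9 : ε * (D * (2 * C * a) ^ N * R 0) ≤ D * (2 * C * a) ^ N * R 0 :=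
        mul_le_of_le_one_left (by positivity) hε1
      refine h9.trans (mul_le_mul_of_nonneg_right ?_ hR0)
      have := mul_le_mul_of_nonneg_left h8 (zero_le_one.trans hD)
      linarith
    have e8 : K * a * (2 / θ * (D * (a / θ ^ 2) ^ N * R 0)) ≤
        D * (12 * K ^ 2 * C * (36 * K ^ 2 * C ^ 2) ^ N) * b ^ (5 * N + 3) * R 0 := by
      have h8 : K * a * (2 / θ) = 12 * K ^ 2 * C * (a ^ 2 * (1 / ε)) := by
        rw [hθ]; field_simp; norm_num
      have h9 : a / θ ^ 2 = 36 * K ^ 2 * C ^ 2 * (a ^ 3 * (1 / ε) ^ 2) := by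
        rw [hθ]; field_simp; norm_num
      have h10 : a ^ 2 * (1 / ε) ≤ b ^ 3 := by
        calc a ^ 2 * (1 / ε) ≤ b ^ 2 * b := by gcongr
          _ = b ^ 3 := by ring
      have h11 : a ^ 3 * (1 / ε) ^ 2 ≤ b ^ 5 := by
        calc a ^ 3 * (1 / ε) ^ 2 ≤ b ^ 3 * b ^ 2 := by gcongr
          _ = b ^ 5 := by ring
      calc K * a * (2 / θ * (D * (a / θ ^ 2) ^ N * R 0))
          = (K * a * (2 / θ)) * (D * (a / θ ^ 2) ^ N * R 0) := by ring
        _ ≤ (12 * K ^ 2 * C * b ^ 3) * (D * (36 * K ^ 2 * C ^ 2 * b ^ 5) ^ N * R 0) := by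
            rw [h8, h9]; gcongr
        _ = _ := by rw [mul_pow, ← pow_mul, pow_add]; ring
    calc R (j + 1) ≤ _ := e5
      _ ≤ ε * J (j + 1) + D * (2 * C) ^ N * b ^ (5 * N + 3) * R 0 +
          D * (12 * K ^ 2 * C * (36 * K ^ 2 * C ^ 2) ^ N) * b ^ (5 * N + 3) * R 0 := by linarith
      _ = _ := by ring

/-- Under the hypotheses of `exists_remainder_le`, `J_0` is controlled by `J_j` and `R_0` for all
`j ≤ k`, with a constant polynomial in `a`. -/
lemma exists_energy_chain (k : ℕ) {C K : ℝ} (hC : 1 ≤ C) (hK : 1 ≤ K) (j : ℕ) :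
    ∃ D : ℝ, 1 ≤ D ∧ ∃ N : ℕ, ∀ (a : ℝ) (J R : ℕ → ℝ), 1 ≤ a → (∀ i, 0 ≤ J i) → (∀ i, 0 ≤ R i) →
      (∀ i < k, J i ≤ C * (J (i + 1) + R i)) →
      (∀ i, i + 1 < k → ∀ θ : ℝ, 0 < θ → θ ≤ 1 →
        R (i + 1) ≤ K * a * (θ * J i + 2 / θ * R i)) →
      j ≤ k → J 0 ≤ D * a ^ N * (J j + R 0) := by
  induction j with
  | zero =>
    refine ⟨1, le_rfl, 0, fun a J R _ _ hR _ _ _ => ?_⟩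
    have := hR 0
    simpa using this
  | succ j ih =>
    obtain ⟨D, hD, N, h⟩ := ih
    obtain ⟨D', hD', N', h'⟩ := exists_remainder_le k hC hK j
    refine ⟨D * (2 * C + 2 * C * (D' * (2 * C) ^ N') + 1), ?_, N + N', ?_⟩
    · have : 0 ≤ 2 * C + 2 * C * (D' * (2 * C) ^ N') := by positivity
      nlinarith
    intro a J R ha hJ hR h1 h2 hj
    have h := h a J R ha hJ hR h1 h2 (by omega)
    -- The choice `ε = 1 / (2C)` absorbs the remainder `C R_j` into half of `J_j`.
    have e1 : J j ≤ 2 * C * J (j + 1) + 2 * C * (D' * (2 * C * a) ^ N' * R 0) := by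
      have := h' a J R ha hJ hR h1 h2 (by omega) (1 / (2 * C)) (by positivity)
        (by rw [div_le_one (by positivity)]; linarith)
      have h3 := h1 j (by omega)
      have h4 : a / (1 / (2 * C)) = 2 * C * a := by field_simp
      rw [h4] at this
      have h5 := mul_le_mul_of_nonneg_left this (show (0 : ℝ) ≤ C by linarith)
      have h6 : C * (1 / (2 * C) * J j + D' * (2 * C * a) ^ N' * R 0) =
        J j / 2 + C * (D' * (2 * C * a) ^ N' * R 0) := by field_simp
      linarith
    have haN : 1 ≤ a ^ N' := one_le_pow₀ ha
    have hR0 := hR 0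
    have hJ1 := hJ (j + 1)
    refine h.trans ?_
    rw [pow_add]
    have e2 : J j + R 0 ≤
        (2 * C + 2 * C * (D' * (2 * C) ^ N') + 1) * a ^ N' * (J (j + 1) + R 0) := by
      rw [mul_pow] at e1
      have t1 : 2 * C * J (j + 1) ≤ 2 * C * J (j + 1) * a ^ N' :=
        le_mul_of_one_le_right (by positivity) haN
      have t2 : R 0 ≤ R 0 * a ^ N' := le_mul_of_one_le_right (by positivity) haN
      have t3 : 0 ≤ 2 * C * R 0 * a ^ N' := by positivity
      have t4 : 0 ≤ 2 * C * (D' * (2 * C) ^ N') * a ^ N' * J (j + 1) := by positivity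
      have t5 : 0 ≤ a ^ N' * J (j + 1) := by positivity
      linarith
    calc D * a ^ N * (J j + R 0) ≤ D * a ^ N * ((2 * C + 2 * C * (D' * (2 * C) ^ N') + 1) * a ^ N'
          * (J (j + 1) + R 0)) := mul_le_mul_of_nonneg_left e2 (by positivity)
      _ = _ := by ring

end Absorption

section Young

lemma pow_mul_le_young {y r θ : ℝ} (hy : 0 ≤ y) (hr : 0 ≤ r) (hθ : 0 < θ) (m : ℕ) :
    y ^ m * r ≤ θ * y ^ (m + 1) + (θ⁻¹) ^ m * r ^ (m + 1) := by
  rcases le_total r (θ * y) with h | h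
  · have h1 : y ^ m * r ≤ y ^ m * (θ * y) := by gcongr
    have h2 : 0 ≤ (θ⁻¹) ^ m * r ^ (m + 1) := by positivity
    calc _ ≤ y ^ m * (θ * y) := h1
      _ = θ * y ^ (m + 1) := by ring
      _ ≤ _ := by linarith
  · have h1 : y ≤ θ⁻¹ * r := by rw [inv_mul_eq_div, le_div_iff₀ hθ]; linarith
    have h2 : 0 ≤ θ * y ^ (m + 1) := by positivity
    calc _ ≤ (θ⁻¹ * r) ^ m * r := by gcongr
      _ = (θ⁻¹) ^ m * r ^ (m + 1) := by rw [mul_pow]; ring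
      _ ≤ _ := by linarith

lemma mul_pow_le_young {y r θ : ℝ} (hy : 0 ≤ y) (hr : 0 ≤ r) (hθ : 0 < θ) (hθ1 : θ ≤ 1) (m : ℕ) :
    y * r ^ (m + 1) ≤ θ * y ^ (m + 2) + θ⁻¹ * r ^ (m + 2) := by
  rcases le_total r (θ * y) with h | h
  · have h1 : y * r ^ (m + 1) ≤ y * (θ * y) ^ (m + 1) := by gcongr
    have h2 : 0 ≤ θ⁻¹ * r ^ (m + 2) := by positivity
    have h3 : θ ^ (m + 1) ≤ θ := pow_le_of_le_one hθ.le hθ1 (by omega)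
    calc _ ≤ y * (θ * y) ^ (m + 1) := h1
      _ = θ ^ (m + 1) * y ^ (m + 2) := by ring
      _ ≤ θ * y ^ (m + 2) := by gcongr
      _ ≤ _ := by linarith
  · have h1 : y ≤ θ⁻¹ * r := by rw [inv_mul_eq_div, le_div_iff₀ hθ]; linarith
    have h2 : 0 ≤ θ * y ^ (m + 2) := by positivity
    calc _ ≤ (θ⁻¹ * r) * r ^ (m + 1) := by gcongr
      _ = θ⁻¹ * r ^ (m + 2) := by ring
      _ ≤ _ := by linarith

end Young

section Energy

open Matrix

variable {n : ℕ}

lemma continuous_grad {ψ : EuclideanSpace ℝ (Fin n) → ℝ} (hψ : ContDiff ℝ 1 ψ) :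
    Continuous (grad ψ) :=
  continuous_pi fun i => (contDiff_partialDeriv hψ (a := 0) (by simp) i).continuous

lemma continuous_hess {ψ : EuclideanSpace ℝ (Fin n) → ℝ} (hψ : ContDiff ℝ 2 ψ) :
    Continuous (hess ψ) :=
  continuous_matrix fun i j => (contDiff_partialDeriv
    (contDiff_partialDeriv hψ (a := 1) (by norm_num) i) (a := 0) (by simp) j).continuous

lemma F_eq {ψ : EuclideanSpace ℝ (Fin n) → ℝ} (hψ : ContDiff ℝ 2 ψ) :
    F ψ = fun x => schoutenMatrix (grad ψ x) (hess ψ x) :=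
  funext fun _ => F_eq_schoutenMatrix hψ.contDiffAt

lemma continuous_F {ψ : EuclideanSpace ℝ (Fin n) → ℝ} (hψ : ContDiff ℝ 2 ψ) :
    Continuous (F ψ) := by
  rw [F_eq hψ]
  exact continuous_schoutenMatrix.comp
    ((continuous_grad (hψ.of_le (by norm_num))).prodMk (continuous_hess hψ))

lemma integrableOn_ball_of_continuous {f : EuclideanSpace ℝ (Fin n) → ℝ} (hf : Continuous f)
    (x : EuclideanSpace ℝ (Fin n)) (ρ : ℝ) : IntegrableOn f (ball x ρ) :=
  (hf.continuousOn.integrableOn_compact (isCompact_closedBall x ρ)).mono_set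
    ball_subset_closedBall

/-- The divergence identity tested with `η^{M+2} e^{-aψ}`. -/
lemma setIntegral_energy_identity {ψ η : EuclideanSpace ℝ (Fin n) → ℝ} (hψ : ContDiff ℝ 2 ψ)
    (hψc : HasCompactSupport ψ) (hη : ContDiff ℝ 1 η) (hηc : HasCompactSupport η) {ρ : ℝ}
    (hη0 : ∀ x ∉ ball (0 : EuclideanSpace ℝ (Fin n)) ρ, η x = 0) (a : ℝ) (k m M : ℕ) :
    ∫ x in ball 0 ρ, (fluxDiv k m (grad ψ x, hess ψ x) * η x ^ (M + 2)
      + (∑ l, grad ψ x l ^ 2) ^ m *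
        ((M + 2 : ℕ) * η x ^ (M + 1) * (grad η x ⬝ᵥ newtonTensor (F ψ x) k *ᵥ grad ψ x)
          - a * η x ^ (M + 2) * (grad ψ x ⬝ᵥ newtonTensor (F ψ x) k *ᵥ grad ψ x)))
      * Real.exp (-a * ψ x) = 0 := by
  rw [setIntegral_eq_integral_of_forall_compl_eq_zero]
  swap
  · intro x hx
    simp [hη0 x hx]
  set χ : EuclideanSpace ℝ (Fin n) → ℝ := fun x => η x ^ (M + 2) * Real.exp (-a * ψ x) with hχdef
  have hψ1 : ContDiff ℝ 1 ψ := hψ.of_le (by norm_num)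
  have hχ : ContDiff ℝ 1 χ := (hη.pow _).mul (Real.contDiff_exp.comp (contDiff_const.mul hψ1))
  have hχc : HasCompactSupport χ := by
    refine HasCompactSupport.mul_right (hηc.mono fun x hx => ?_)
    rw [Function.mem_support] at hx ⊢
    exact fun h => hx (by simp [h])
  have hd (x) (i : Fin n) : partialDeriv χ i x = ((M + 2 : ℕ) * η x ^ (M + 1) * grad η x i
      - a * η x ^ (M + 2) * grad ψ x i) * Real.exp (-a * ψ x) := by
    have h1 := (hη.differentiable (by simp) x).hasFDerivAt
    have h2 := (hψ1.differentiable (by simp) x).hasFDerivAt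
    have h3 := (h1.pow (M + 2)).mul (h2.const_mul (-a)).exp
    have h4 : fderiv ℝ χ x = _ := h3.fderiv
    rw [partialDeriv, h4]
    simp only [grad, partialDeriv, show M + 2 - 1 = M + 1 from rfl]
    simp
    ring
  have key := integral_fluxDiv_mul hψ hψc hχ hχc k m
  have hcz : Continuous fun x => (grad ψ x, hess ψ x) :=
    (continuous_grad hψ1).prodMk (continuous_hess hψ)
  have i1 : Integrable fun x => fluxDiv k m (grad ψ x, hess ψ x) * χ x :=
    (((continuous_fluxDiv k m).comp hcz).mul hχ.continuous).integrable_of_hasCompactSupport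
      hχc.mul_left
  have i2 : Integrable fun x => ∑ i, fluxField k m (grad ψ x, hess ψ x) i * partialDeriv χ i x := by
    refine integrable_finsetSum _ fun i _ => ?_
    refine Continuous.integrable_of_hasCompactSupport ?_
      (hasCompactSupport_partialDeriv hχc i).mul_left
    exact (((continuous_apply i).comp (continuous_fluxField k m)).comp hcz).mul
      (contDiff_partialDeriv hχ (a := 0) (by simp) i).continuous
  rw [← add_eq_zero_iff_eq_neg, ← integral_add i1 i2] at key
  rw [← key]
  refine integral_congr_ae (Filter.Eventually.of_forall fun x => ?_)
  simp only [hd]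
  simp only [fluxField, hχdef, F_eq hψ, Pi.smul_apply, smul_eq_mul, dotProduct]
  rw [add_mul, mul_assoc (fluxDiv k m _)]
  congr 1
  rw [Finset.mul_sum, Finset.mul_sum, ← Finset.sum_sub_distrib, Finset.mul_sum, Finset.sum_mul]
  exact Finset.sum_congr rfl fun i _ => by ring

variable {k : ℕ} {ψ η : EuclideanSpace ℝ (Fin n) → ℝ} {ρ r a : ℝ}

/-- The quantities `∫ σ_j |∇ψ|^{2m} η^{2(m+j)} e^{-aψ}` of the energy estimate. -/
def energyTerm (ψ η : EuclideanSpace ℝ (Fin n) → ℝ) (ρ a : ℝ) (j m : ℕ) : ℝ :=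
  ∫ x in ball 0 ρ, newtonSigma (F ψ x) j * ((∑ l, grad ψ x l ^ 2) * η x ^ 2) ^ m * η x ^ (2 * j)
    * Real.exp (-a * ψ x)

lemma continuous_energyTerm_integrand (hψ : ContDiff ℝ 2 ψ) (hη : ContDiff ℝ 1 η) (j m : ℕ) :
    Continuous fun x => newtonSigma (F ψ x) j * ((∑ l, grad ψ x l ^ 2) * η x ^ 2) ^ m
      * η x ^ (2 * j) * Real.exp (-a * ψ x) := by
  have h1 := (continuous_newtonSigma j).comp (continuous_F hψ)
  have h2 : ∀ l, Continuous fun x => grad ψ x l := fun l =>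
    (continuous_apply l).comp (continuous_grad (hψ.of_le (by norm_num)))
  have h3 := hψ.continuous
  have h4 := hη.continuous
  simp only [Function.comp_def] at h1
  fun_prop

lemma continuous_energy_identity_integrand (hψ : ContDiff ℝ 2 ψ) (hη : ContDiff ℝ 1 η) (a : ℝ)
    (k m M : ℕ) : Continuous fun x => (fluxDiv k m (grad ψ x, hess ψ x) * η x ^ (M + 2)
      + (∑ l, grad ψ x l ^ 2) ^ m *
        ((M + 2 : ℕ) * η x ^ (M + 1) * (grad η x ⬝ᵥ newtonTensor (F ψ x) k *ᵥ grad ψ x)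
          - a * η x ^ (M + 2) * (grad ψ x ⬝ᵥ newtonTensor (F ψ x) k *ᵥ grad ψ x)))
      * Real.exp (-a * ψ x) := by
  have hg := continuous_grad (hψ.of_le (by norm_num))
  have h1 := (continuous_fluxDiv k m).comp (hg.prodMk (continuous_hess hψ))
  have h2 : ∀ l, Continuous fun x => grad ψ x l := fun l => (continuous_apply l).comp hg
  have h3 : Continuous fun x => newtonTensor (F ψ x) k *ᵥ grad ψ x :=
    ((continuous_newtonTensor k).comp (continuous_F hψ)).matrix_mulVec hg
  have h4 := (continuous_grad hη).dotProduct h3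
  have h5 := hg.dotProduct h3
  have h6 := hη.continuous
  have h7 := hψ.continuous
  have h8 : Continuous fun x => (∑ l, grad ψ x l ^ 2) ^ m := by fun_prop
  exact ((h1.mul (h6.pow _)).add (h8.mul (((continuous_const.mul (h6.pow _)).mul h4).sub
    ((continuous_const.mul (h6.pow _)).mul h5)))).mul
      (Real.continuous_exp.comp (continuous_const.mul h7))

lemma setIntegral_le_of_le {f g₁ g₂ g₃ : EuclideanSpace ℝ (Fin n) → ℝ} (hf : Continuous f)
    (hg₁ : Continuous g₁) (hg₂ : Continuous g₂) (hg₃ : Continuous g₃) (c₁ c₂ c₃ : ℝ)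
    (h : ∀ x ∈ ball (0 : EuclideanSpace ℝ (Fin n)) ρ,
      f x ≤ c₁ * g₁ x + c₂ * g₂ x + c₃ * g₃ x) :
    ∫ x in ball 0 ρ, f x ≤ c₁ * (∫ x in ball 0 ρ, g₁ x) + c₂ * (∫ x in ball 0 ρ, g₂ x)
      + c₃ * (∫ x in ball 0 ρ, g₃ x) := by
  have i1 := (integrableOn_ball_of_continuous hg₁ 0 ρ).const_mul c₁
  have i2 := (integrableOn_ball_of_continuous hg₂ 0 ρ).const_mul c₂
  have i3 := (integrableOn_ball_of_continuous hg₃ 0 ρ).const_mul c₃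
  refine (setIntegral_mono_on (integrableOn_ball_of_continuous hf 0 ρ) ((i1.add i2).add i3)
    measurableSet_ball h).trans_eq ?_
  have e1 := integral_add i1 i2
  have e2 := integral_add (i1.add i2) i3
  simp only [Pi.add_apply] at e1 e2 ⊢
  rw [e2, e1, integral_const_mul, integral_const_mul, integral_const_mul]

lemma exists_isHermitian_of_mem (hψ : ContDiff ℝ 2 ψ) {x : EuclideanSpace ℝ (Fin n)}
    (hx : eigenvalues (F ψ x) ∈ closure (Gamma n k)) :
    ∃ hA : (F ψ x).IsHermitian, hA.eigenvalues ∈ closure (Gamma n k) := by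
  have hA : (F ψ x).IsHermitian := F_isHermitian isOpen_univ hψ.contDiffOn (Set.mem_univ x)
  rw [eigenvalues, dif_pos hA] at hx
  exact ⟨hA, hx⟩

section Pointwise

variable {A : Matrix (Fin n) (Fin n) ℝ}

lemma newtonSigma_nonneg (hk : k ≤ n) (hA : A.IsHermitian)
    (hl : hA.eigenvalues ∈ closure (Gamma n k)) {j : ℕ} (hj : j ≤ k) : 0 ≤ newtonSigma A j := by
  rw [newtonSigma_isHermitian hA]
  exact esymmOn_nonneg_of_mem_closure hk hl hj

/-- The cross term of the energy estimate, where `p = ∇ψ` and `v = ∇η`. -/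
lemma mul_newtonTensor_le (hk : k ≤ n) (hA : A.IsHermitian)
    (hl : hA.eigenvalues ∈ closure (Gamma n k)) {j : ℕ} (hj : j < k) (p v : Fin n → ℝ)
    {t η r : ℝ} (ht : 0 < t) (hv : ∑ i, v i ^ 2 ≤ r) :
    2 * |η * (v ⬝ᵥ newtonTensor A j *ᵥ p)| ≤
      (n - j) * newtonSigma A j * (t * ((∑ i, p i ^ 2) * η ^ 2) + r / t) := by
  have h := two_mul_newtonTensor_le hk hA hl hj ((t * η) • p) v
  have hS := newtonSigma_nonneg hk hA hl hj.le
  have hjn : (j : ℝ) ≤ n := by exact_mod_cast hj.le.trans hk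
  rw [mulVec_smul, dotProduct_smul, smul_eq_mul, mul_assoc, abs_mul, abs_of_pos ht] at h
  have h1 : ∑ i, ((t * η) • p) i ^ 2 = t ^ 2 * ((∑ i, p i ^ 2) * η ^ 2) := by
    rw [Finset.sum_mul, Finset.mul_sum]
    exact Finset.sum_congr rfl fun i _ => by simp; ring
  rw [h1] at h
  have h2 : (n - j) * newtonSigma A j * (t ^ 2 * ((∑ i, p i ^ 2) * η ^ 2) + ∑ i, v i ^ 2) ≤
      (n - j) * newtonSigma A j * (t ^ 2 * ((∑ i, p i ^ 2) * η ^ 2) + r) :=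
    mul_le_mul_of_nonneg_left (by linarith) (mul_nonneg (by linarith) hS)
  have h3 : (n - j) * newtonSigma A j * (t ^ 2 * ((∑ i, p i ^ 2) * η ^ 2) + r) =
      t * ((n - j) * newtonSigma A j * (t * ((∑ i, p i ^ 2) * η ^ 2) + r / t)) := by
    field_simp
  have h4 : t * (2 * |η * (v ⬝ᵥ newtonTensor A j *ᵥ p)|) ≤
      t * ((n - j) * newtonSigma A j * (t * ((∑ i, p i ^ 2) * η ^ 2) + r / t)) := by linarith
  exact le_of_mul_le_mul_left h4 ht

end Pointwise

lemma energyTerm_nonneg (hkn : k ≤ n) (hψ : ContDiff ℝ 2 ψ)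
    (hcone : ∀ x ∈ ball (0 : EuclideanSpace ℝ (Fin n)) ρ,
      eigenvalues (F ψ x) ∈ closure (Gamma n k)) {j : ℕ} (hj : j ≤ k) (m : ℕ) :
    0 ≤ energyTerm ψ η ρ a j m := by
  refine setIntegral_nonneg measurableSet_ball fun x hx => ?_
  obtain ⟨hA, hl⟩ := exists_isHermitian_of_mem hψ (hcone x hx)
  have := newtonSigma_nonneg hkn hA hl hj
  have : 0 ≤ ∑ l, grad ψ x l ^ 2 := Finset.sum_nonneg fun i _ => sq_nonneg _
  rw [pow_mul]
  positivity

/-- The constant in the passage from `σ_j` to `σ_{j+1}`, see `energyTerm_le`. -/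
def descentConst (k : ℕ) : ℝ := 32 * (k : ℝ) ^ 2 * (32 * (k : ℝ) ^ 2) ^ k

lemma sixteen_mul_le_descentConst (hk : 1 ≤ k) : 16 * (k : ℝ) ≤ descentConst k := by
  have hk' : (1 : ℝ) ≤ k := by exact_mod_cast hk
  have : (1 : ℝ) ≤ (32 * (k : ℝ) ^ 2) ^ k := one_le_pow₀ (by nlinarith)
  unfold descentConst
  nlinarith

set_option maxHeartbeats 1000000 in
/-- Testing with `η^{2k} e^{-aψ}` bounds `∫ σ_j |∇ψ|^{2(k-j)} η^{2k} e^{-aψ}` by the same quantity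
for `j + 1`. The term `T_j(∇ψ, ∇ψ)` has a favourable sign because `a ≥ n`. -/
lemma energyTerm_le (hk : 1 ≤ k) (hkn : 2 * k ≤ n) (hψ : ContDiff ℝ 2 ψ)
    (hψc : HasCompactSupport ψ) (hη : ContDiff ℝ 1 η) (hηc : HasCompactSupport η)
    (hη0 : ∀ x ∉ ball (0 : EuclideanSpace ℝ (Fin n)) ρ, η x = 0)
    (hr : ∀ x, ∑ i, grad η x i ^ 2 ≤ r)
    (hcone : ∀ x ∈ ball (0 : EuclideanSpace ℝ (Fin n)) ρ,
      eigenvalues (F ψ x) ∈ closure (Gamma n k))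
    (ha : (n : ℝ) ≤ a) {j : ℕ} (hj : j < k) :
    energyTerm ψ η ρ a j (k - j) ≤ descentConst k *
      (energyTerm ψ η ρ a (j + 1) (k - (j + 1)) + r ^ (k - j) * energyTerm ψ η ρ a j 0) := by
  obtain ⟨m, hm⟩ : ∃ m, k = j + 1 + m := ⟨k - (j + 1), by omega⟩
  have hm1 : k - j = m + 1 := by omega
  have hm2 : k - (j + 1) = m := by omega
  rw [hm1, hm2]
  have hk' : (1 : ℝ) ≤ k := by exact_mod_cast hk
  have hjk : (j : ℝ) + 1 + m = k := by rw [hm]; push_cast; ring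
  have hnk : 2 * (k : ℝ) ≤ n := by exact_mod_cast hkn
  have hjn : 1 ≤ (n : ℝ) - j := by
    have : (j : ℝ) + 1 ≤ k := by exact_mod_cast hj
    linarith
  have hr0 : 0 ≤ r := (Finset.sum_nonneg fun i _ => sq_nonneg _).trans (hr 0)
  have h32 : (1 : ℝ) ≤ 32 * (k : ℝ) ^ 2 := by nlinarith
  have key := setIntegral_energy_identity hψ hψc hη hηc hη0 a j m (2 * (j + m))
  have hMk : 2 * (j + m) + 2 = 2 * k := by omega
  have hpt : ∀ x ∈ ball (0 : EuclideanSpace ℝ (Fin n)) ρ,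
      (fluxDiv j m (grad ψ x, hess ψ x) * η x ^ (2 * (j + m) + 2)
      + (∑ l, grad ψ x l ^ 2) ^ m *
        ((2 * (j + m) + 2 : ℕ) * η x ^ (2 * (j + m) + 1)
            * (grad η x ⬝ᵥ newtonTensor (F ψ x) j *ᵥ grad ψ x)
          - a * η x ^ (2 * (j + m) + 2) * (grad ψ x ⬝ᵥ newtonTensor (F ψ x) j *ᵥ grad ψ x)))
      * Real.exp (-a * ψ x) ≤
      2 * k * (newtonSigma (F ψ x) (j + 1) * ((∑ l, grad ψ x l ^ 2) * η x ^ 2) ^ m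
        * η x ^ (2 * (j + 1)) * Real.exp (-a * ψ x))
      + -(((n : ℝ) - j) / 8) * (newtonSigma (F ψ x) j * ((∑ l, grad ψ x l ^ 2) * η x ^ 2) ^ (m + 1)
        * η x ^ (2 * j) * Real.exp (-a * ψ x))
      + ((n : ℝ) - j) * (4 * k ^ 2 * (32 * k ^ 2) ^ m * r ^ (m + 1)) *
        (newtonSigma (F ψ x) j * ((∑ l, grad ψ x l ^ 2) * η x ^ 2) ^ 0
        * η x ^ (2 * j) * Real.exp (-a * ψ x)) := by
    intro x hx
    obtain ⟨hA, hl⟩ := exists_isHermitian_of_mem hψ (hcone x hx)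
    have hkn' : k ≤ n := by omega
    have hS0 := newtonSigma_nonneg hkn' hA hl hj.le
    have hS1 := newtonSigma_nonneg hkn' hA hl (show j + 1 ≤ k from hj)
    have hq := (newtonTensor_quadratic_bounds hkn' hA hl hj (grad ψ x)).1
    have hc := mul_newtonTensor_le hkn' hA hl hj (grad ψ x) (grad η x) (η := η x)
      (t := 1 / (4 * k)) (by positivity) (hr x)
    have hq' : 0 ≤ 2 * (m : ℝ) * (∑ l, grad ψ x l ^ 2) ^ (m - 1) *
        (grad ψ x ⬝ᵥ newtonTensor (F ψ x) (j + 1) *ᵥ grad ψ x) := by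
      rcases Nat.eq_zero_or_pos m with h0 | h0
      · simp [h0]
      · have := (newtonTensor_quadratic_bounds hkn' hA hl (show j + 1 < k by omega) (grad ψ x)).1
        positivity
    simp only [fluxDiv]
    simp only [F_eq_schoutenMatrix hψ.contDiffAt (x := x)] at *
    set A := schoutenMatrix (grad ψ x) (hess ψ x)
    set s := ∑ l, grad ψ x l ^ 2 with hs
    have hs0 : 0 ≤ s := Finset.sum_nonneg fun i _ => sq_nonneg _
    set c := grad η x ⬝ᵥ newtonTensor A j *ᵥ grad ψ x
    set q := grad ψ x ⬝ᵥ newtonTensor A j *ᵥ grad ψ x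
    set q' := grad ψ x ⬝ᵥ newtonTensor A (j + 1) *ᵥ grad ψ x
    set S := newtonSigma A j
    set S' := newtonSigma A (j + 1)
    set h := η x
    set y := s * h ^ 2 with hy
    have hy0 : 0 ≤ y := by positivity
    have hE := Real.exp_pos (-a * ψ x)
    set E := Real.exp (-a * ψ x)
    have hh : 0 ≤ h ^ (2 * j) := by rw [pow_mul]; positivity
    have hh2 : 0 ≤ h ^ (2 * (j + m) + 2) := by
      rw [show 2 * (j + m) + 2 = 2 * (j + m + 1) by ring, pow_mul]; positivity
    -- The weights in the cross term and in Young's inequality leave `1/2 - 1/4 - 1/8 = 1/8` of the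
    -- good term `(n - j) σ_j y^{m+1}`.
    have hyoung := pow_mul_le_young hy0 hr0 (show 0 < (32 * (k : ℝ) ^ 2)⁻¹ by positivity) m
    rw [inv_inv] at hyoung
    have e1 : ((j : ℝ) + 1 + 2 * m) * S' * s ^ m * h ^ (2 * (j + m) + 2) ≤
        2 * k * (S' * y ^ m * h ^ (2 * (j + 1))) := by
      have h1 : ((j : ℝ) + 1 + 2 * m) ≤ 2 * k := by
        have : (0 : ℝ) ≤ j := Nat.cast_nonneg j
        linarith
      have h2 : 0 ≤ S' * y ^ m * h ^ (2 * (j + 1)) := by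
        rw [pow_mul h 2]; positivity
      calc _ = ((j : ℝ) + 1 + 2 * m) * (S' * y ^ m * h ^ (2 * (j + 1))) := by rw [hy]; ring
        _ ≤ _ := mul_le_mul_of_nonneg_right h1 h2
    have e2 : ((n : ℝ) - 2 * j - 1 - m) * q * s ^ m * h ^ (2 * (j + m) + 2)
        - s ^ m * (a * h ^ (2 * (j + m) + 2) * q) ≤ 0 := by
      have h1 : 0 ≤ q * s ^ m * h ^ (2 * (j + m) + 2) := by positivity
      have h2 : (n : ℝ) - 2 * j - 1 - m - a ≤ 0 := by
        have : (0 : ℝ) ≤ j := Nat.cast_nonneg j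
        have : (0 : ℝ) ≤ m := Nat.cast_nonneg m
        linarith
      have := mul_nonpos_of_nonpos_of_nonneg h2 h1
      linarith
    have e3 : s ^ m * ((2 * (j + m) + 2 : ℕ) * h ^ (2 * (j + m) + 1) * c) ≤
        ((n : ℝ) - j) * S * h ^ (2 * j) * (1 / 4 * y ^ (m + 1) + 4 * k ^ 2 * (y ^ m * r)) := by
      have h1 : 2 * (h * c) ≤ ((n : ℝ) - j) * S * (1 / (4 * k) * y + r / (1 / (4 * k))) :=
        le_trans (by have := le_abs_self (h * c); linarith) hc
      have h2 : 0 ≤ k * (y ^ m * h ^ (2 * j)) := by positivity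
      rw [hMk]
      calc _ = k * (y ^ m * h ^ (2 * j)) * (2 * (h * c)) := by rw [hy]; push_cast; ring
        _ ≤ k * (y ^ m * h ^ (2 * j)) *
            (((n : ℝ) - j) * S * (1 / (4 * k) * y + r / (1 / (4 * k)))) :=
          mul_le_mul_of_nonneg_left h1 h2
        _ = _ := by field_simp; ring
    have e4 : ((n : ℝ) - j) * S * h ^ (2 * j) * (4 * k ^ 2 * (y ^ m * r)) ≤
        ((n : ℝ) - j) * S * h ^ (2 * j) *
          (1 / 8 * y ^ (m + 1) + 4 * k ^ 2 * (32 * k ^ 2) ^ m * r ^ (m + 1)) := by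
      refine mul_le_mul_of_nonneg_left ?_ (by positivity)
      have := mul_le_mul_of_nonneg_left hyoung (show (0 : ℝ) ≤ 4 * k ^ 2 by positivity)
      refine this.trans_eq ?_
      field_simp
      ring
    have e5 : ((n : ℝ) - j) / 2 * S * s ^ (m + 1) * h ^ (2 * (j + m) + 2) =
        ((n : ℝ) - j) * S * h ^ (2 * j) * (1 / 2 * y ^ (m + 1)) := by rw [hy]; ring
    have e6 : 0 ≤ 2 * (m : ℝ) * s ^ (m - 1) * q' * h ^ (2 * (j + m) + 2) := mul_nonneg hq' hh2
    calc _ ≤ (2 * k * (S' * y ^ m * h ^ (2 * (j + 1)))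
          - ((n : ℝ) - j) / 8 * (S * y ^ (m + 1) * h ^ (2 * j))
          + ((n : ℝ) - j) * (4 * k ^ 2 * (32 * k ^ 2) ^ m * r ^ (m + 1)) * (S * y ^ 0
            * h ^ (2 * j))) * E := by
          refine mul_le_mul_of_nonneg_right ?_ hE.le
          linarith
      _ = _ := by ring
  have hmono := setIntegral_le_of_le (continuous_energy_identity_integrand hψ hη a j m _)
    (continuous_energyTerm_integrand (a := a) hψ hη (j + 1) m)
    (continuous_energyTerm_integrand (a := a) hψ hη j (m + 1))
    (continuous_energyTerm_integrand (a := a) hψ hη j 0) _ _ _ hpt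
  rw [key] at hmono
  change 0 ≤ 2 * k * energyTerm ψ η ρ a (j + 1) m + -(((n : ℝ) - j) / 8) *
    energyTerm ψ η ρ a j (m + 1) + _ * energyTerm ψ η ρ a j 0 at hmono
  have n1 := energyTerm_nonneg (η := η) (a := a) (by omega) hψ hcone (show j + 1 ≤ k from hj) m
  have n2 := energyTerm_nonneg (η := η) (a := a) (by omega) hψ hcone hj.le 0
  set X := energyTerm ψ η ρ a (j + 1) m
  set Y := energyTerm ψ η ρ a j (m + 1)
  set Z := energyTerm ψ η ρ a j 0
  have f1 : ((n : ℝ) - j) * Y ≤ ((n : ℝ) - j) *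
      (16 * k * X + 32 * k ^ 2 * (32 * k ^ 2) ^ m * r ^ (m + 1) * Z) := by
    have : 16 * k * X ≤ ((n : ℝ) - j) * (16 * k * X) := le_mul_of_one_le_left (by positivity) hjn
    linarith
  have f2 := le_of_mul_le_mul_left f1 (by linarith)
  have f3 : 16 * (k : ℝ) * X ≤ descentConst k * X :=
    mul_le_mul_of_nonneg_right (sixteen_mul_le_descentConst hk) n1
  have f4 : 32 * (k : ℝ) ^ 2 * (32 * k ^ 2) ^ m * r ^ (m + 1) * Z ≤
      descentConst k * (r ^ (m + 1) * Z) := by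
    rw [mul_assoc]
    refine mul_le_mul_of_nonneg_right ?_ (by positivity)
    exact mul_le_mul_of_nonneg_left (pow_le_pow_right₀ h32 (by omega)) (by positivity)
  linarith

set_option maxHeartbeats 1000000 in
/-- Testing with `η^{2j+2} e^{-aψ}` bounds the integral of `σ_{j+1}` by integrals of `σ_j`. -/
lemma energyTerm_succ_zero_le (hkn : 2 * k ≤ n) (hψ : ContDiff ℝ 2 ψ)
    (hψc : HasCompactSupport ψ) (hη : ContDiff ℝ 1 η) (hηc : HasCompactSupport η)
    (hη0 : ∀ x ∉ ball (0 : EuclideanSpace ℝ (Fin n)) ρ, η x = 0)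
    (hr : ∀ x, ∑ i, grad η x i ^ 2 ≤ r)
    (hcone : ∀ x ∈ ball (0 : EuclideanSpace ℝ (Fin n)) ρ,
      eigenvalues (F ψ x) ∈ closure (Gamma n k))
    (ha : (n : ℝ) ≤ a) {j : ℕ} (hj : j + 1 < k) :
    energyTerm ψ η ρ a (j + 1) 0 ≤
      4 * (n : ℝ) ^ 2 * a * (energyTerm ψ η ρ a j 1 + r * energyTerm ψ η ρ a j 0) := by
  have hk' : (j : ℝ) + 1 ≤ k := by exact_mod_cast hj.le
  have hj0 : (0 : ℝ) ≤ j := Nat.cast_nonneg j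
  have hnk : 2 * (k : ℝ) ≤ n := by exact_mod_cast hkn
  have hr0 : 0 ≤ r := (Finset.sum_nonneg fun i _ => sq_nonneg _).trans (hr 0)
  have key := setIntegral_energy_identity hψ hψc hη hηc hη0 a j 0 (2 * j)
  have hpt : ∀ x ∈ ball (0 : EuclideanSpace ℝ (Fin n)) ρ,
      newtonSigma (F ψ x) (j + 1) * ((∑ l, grad ψ x l ^ 2) * η x ^ 2) ^ 0
        * η x ^ (2 * (j + 1)) * Real.exp (-a * ψ x) ≤
      1 * ((fluxDiv j 0 (grad ψ x, hess ψ x) * η x ^ (2 * j + 2)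
      + (∑ l, grad ψ x l ^ 2) ^ 0 *
        ((2 * j + 2 : ℕ) * η x ^ (2 * j + 1)
            * (grad η x ⬝ᵥ newtonTensor (F ψ x) j *ᵥ grad ψ x)
          - a * η x ^ (2 * j + 2) * (grad ψ x ⬝ᵥ newtonTensor (F ψ x) j *ᵥ grad ψ x)))
      * Real.exp (-a * ψ x))
      + 4 * (n : ℝ) ^ 2 * a * (newtonSigma (F ψ x) j * ((∑ l, grad ψ x l ^ 2) * η x ^ 2) ^ 1
        * η x ^ (2 * j) * Real.exp (-a * ψ x))
      + 4 * (n : ℝ) ^ 2 * a * r * (newtonSigma (F ψ x) j *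
        ((∑ l, grad ψ x l ^ 2) * η x ^ 2) ^ 0 * η x ^ (2 * j) * Real.exp (-a * ψ x)) := by
    intro x hx
    obtain ⟨hA, hl⟩ := exists_isHermitian_of_mem hψ (hcone x hx)
    have hkn' : k ≤ n := by omega
    have hjk : j < k := by omega
    have hS0 := newtonSigma_nonneg hkn' hA hl hjk.le
    have hS1 := newtonSigma_nonneg hkn' hA hl hj.le
    have hq := newtonTensor_quadratic_bounds hkn' hA hl hjk (grad ψ x)
    have hc := mul_newtonTensor_le hkn' hA hl hjk (grad ψ x) (grad η x) (η := η x)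
      (t := 1) one_pos (hr x)
    simp only [fluxDiv]
    simp only [F_eq_schoutenMatrix hψ.contDiffAt (x := x)] at *
    set A := schoutenMatrix (grad ψ x) (hess ψ x)
    set s := ∑ l, grad ψ x l ^ 2 with hs
    have hs0 : 0 ≤ s := Finset.sum_nonneg fun i _ => sq_nonneg _
    set c := grad η x ⬝ᵥ newtonTensor A j *ᵥ grad ψ x
    set q := grad ψ x ⬝ᵥ newtonTensor A j *ᵥ grad ψ x
    set q' := grad ψ x ⬝ᵥ newtonTensor A (j + 1) *ᵥ grad ψ x
    set S := newtonSigma A j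
    set S' := newtonSigma A (j + 1)
    set h := η x
    have hE := Real.exp_pos (-a * ψ x)
    set E := Real.exp (-a * ψ x)
    have hh : 0 ≤ h ^ (2 * j) := by rw [pow_mul]; positivity
    have hh2 : 0 ≤ h ^ (2 * (j + 1)) := by rw [pow_mul]; positivity
    have hjn : (j : ℝ) ≤ n := by linarith
    have hSy : 0 ≤ S * (s * h ^ 2) * h ^ (2 * j) := by positivity
    have hSr : 0 ≤ S * r * h ^ (2 * j) := by positivity
    have e1 : S' * h ^ (2 * (j + 1)) ≤ ((j : ℝ) + 1) * S' * h ^ (2 * (j + 1)) := by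
      have : 0 ≤ S' * h ^ (2 * (j + 1)) := by positivity
      nlinarith
    have e2 : (a - (n - 2 * j - 1)) * q * h ^ (2 * (j + 1)) ≤
        2 * a * n * (S * (s * h ^ 2) * h ^ (2 * j)) := by
      have h1 : q ≤ n * S * s := hq.2.trans (by gcongr; linarith)
      have h2 : a - (n - 2 * j - 1) ≤ 2 * a := by linarith
      have h3 : 0 ≤ a - (n - 2 * j - 1) := by linarith
      calc _ ≤ 2 * a * (n * S * s) * h ^ (2 * (j + 1)) := by
            refine mul_le_mul_of_nonneg_right ?_ hh2
            exact mul_le_mul h2 h1 hq.1 (by linarith)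
        _ = _ := by ring
    have e3 : -((2 * j + 2 : ℕ) * h ^ (2 * j + 1) * c) ≤
        n * n * (S * (s * h ^ 2) * h ^ (2 * j) + S * r * h ^ (2 * j)) := by
      have h1 : -(2 * (h * c)) ≤ n * S * (s * h ^ 2 + r) := by
        have h2 : -(2 * (h * c)) ≤ 2 * |h * c| := by have := neg_abs_le (h * c); linarith
        refine h2.trans (hc.trans ?_)
        rw [one_mul, div_one]
        gcongr
        linarith
      have h2 : (j : ℝ) + 1 ≤ n := by linarith
      calc _ = ((j : ℝ) + 1) * h ^ (2 * j) * (-(2 * (h * c))) := by push_cast; ring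
        _ ≤ ((j : ℝ) + 1) * h ^ (2 * j) * (n * S * (s * h ^ 2 + r)) :=
          mul_le_mul_of_nonneg_left h1 (by positivity)
        _ ≤ n * h ^ (2 * j) * (n * S * (s * h ^ 2 + r)) := by gcongr
        _ = _ := by ring
    have e4 : ((n : ℝ) - j) / 2 * S * s * h ^ (2 * (j + 1)) ≤
        n / 2 * (S * (s * h ^ 2) * h ^ (2 * j)) := by
      calc _ = ((n : ℝ) - j) / 2 * (S * (s * h ^ 2) * h ^ (2 * j)) := by ring
        _ ≤ _ := by gcongr; linarith
    have hn1 : (1 : ℝ) ≤ n := by linarith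
    have ha1 : 1 ≤ a := hn1.trans ha
    have hn2 : (n : ℝ) ≤ n ^ 2 := by nlinarith
    have hn3 : (n : ℝ) ^ 2 ≤ n ^ 2 * a := le_mul_of_one_le_right (by positivity) ha1
    have hn4 : (n : ℝ) * a ≤ n ^ 2 * a := by gcongr
    have e5 : (2 * a * n + n * n + n / 2) * (S * (s * h ^ 2) * h ^ (2 * j)) ≤
        4 * n ^ 2 * a * (S * (s * h ^ 2) * h ^ (2 * j)) :=
      mul_le_mul_of_nonneg_right (by nlinarith) hSy
    have e6 : n * n * (S * r * h ^ (2 * j)) ≤ 4 * n ^ 2 * a * (S * r * h ^ (2 * j)) :=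
      mul_le_mul_of_nonneg_right (by nlinarith) hSr
    calc _ = S' * h ^ (2 * (j + 1)) * E := by ring
      _ ≤ ((((j : ℝ) + 1) * S' * h ^ (2 * (j + 1)) - ((n : ℝ) - j) / 2 * S * s * h ^ (2 * (j + 1))
          - (a - (n - 2 * j - 1)) * q * h ^ (2 * (j + 1))
          + (2 * j + 2 : ℕ) * h ^ (2 * j + 1) * c)
          + 4 * n ^ 2 * a * (S * (s * h ^ 2) * h ^ (2 * j))
          + 4 * n ^ 2 * a * (S * r * h ^ (2 * j))) * E := by
          refine mul_le_mul_of_nonneg_right ?_ hE.le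
          linarith
      _ = _ := by push_cast; ring
  have hmono := setIntegral_le_of_le (continuous_energyTerm_integrand (a := a) hψ hη (j + 1) 0)
    (continuous_energy_identity_integrand hψ hη a j 0 (2 * j))
    (continuous_energyTerm_integrand (a := a) hψ hη j 1)
    (continuous_energyTerm_integrand (a := a) hψ hη j 0) _ _ _ hpt
  rw [key] at hmono
  change energyTerm ψ η ρ a (j + 1) 0 ≤ 1 * 0 + 4 * (n : ℝ) ^ 2 * a * energyTerm ψ η ρ a j 1
    + 4 * (n : ℝ) ^ 2 * a * r * energyTerm ψ η ρ a j 0 at hmono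
  linarith

/-- Young's inequality under the integral sign, used to interpolate the integral
`∫ σ_j |∇ψ|² η^{2j+2} e^{-aψ}`. -/
lemma mul_energyTerm_one_le (hkn : k ≤ n) (hψ : ContDiff ℝ 2 ψ) (hη : ContDiff ℝ 1 η)
    (hr : 0 ≤ r) (hcone : ∀ x ∈ ball (0 : EuclideanSpace ℝ (Fin n)) ρ,
      eigenvalues (F ψ x) ∈ closure (Gamma n k))
    {j : ℕ} (hj : j ≤ k) (m : ℕ) {θ : ℝ} (hθ : 0 < θ) (hθ1 : θ ≤ 1) :
    r ^ (m + 1) * energyTerm ψ η ρ a j 1 ≤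
      θ * energyTerm ψ η ρ a j (m + 2) + θ⁻¹ * (r ^ (m + 2) * energyTerm ψ η ρ a j 0) := by
  have c1 := continuous_energyTerm_integrand (a := a) hψ hη j 1
  have c2 := continuous_energyTerm_integrand (a := a) hψ hη j (m + 2)
  have c3 := continuous_energyTerm_integrand (a := a) hψ hη j 0
  have := setIntegral_le_of_le (ρ := ρ) (c1.const_mul (r ^ (m + 1))) c2 c3 c3 θ
    (θ⁻¹ * r ^ (m + 2)) 0 fun x hx => by
      obtain ⟨hA, hl⟩ := exists_isHermitian_of_mem hψ (hcone x hx)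
      have hS := newtonSigma_nonneg hkn hA hl hj
      have hs : 0 ≤ ∑ l, grad ψ x l ^ 2 := Finset.sum_nonneg fun i _ => sq_nonneg _
      have hh : 0 ≤ η x ^ (2 * j) := by rw [pow_mul]; positivity
      have hy := mul_pow_le_young (y := (∑ l, grad ψ x l ^ 2) * η x ^ 2) (by positivity) hr hθ hθ1 m
      have := mul_le_mul_of_nonneg_left hy
        (show 0 ≤ newtonSigma (F ψ x) j * η x ^ (2 * j) * Real.exp (-a * ψ x) by positivity)
      linarith
  rw [integral_const_mul] at this
  change r ^ (m + 1) * energyTerm ψ η ρ a j 1 ≤ θ * energyTerm ψ η ρ a j (m + 2)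
    + _ * energyTerm ψ η ρ a j 0 + 0 * _ at this
  linarith

/-- The energy estimate `∫ |∇ψ|^{2k} η^{2k} e^{-aψ} ≲ ∫ σ_k η^{2k} e^{-aψ} + r^k ∫ e^{-aψ}`, with a
constant polynomial in `a`, for a cutoff function with `|∇η|² ≤ r`. -/
lemma exists_energy_estimate (hk : 1 ≤ k) (hkn : 2 * k ≤ n) :
    ∃ D : ℝ, 1 ≤ D ∧ ∃ N : ℕ, ∀ (ψ η : EuclideanSpace ℝ (Fin n) → ℝ) (ρ r a : ℝ),
      ContDiff ℝ 2 ψ → HasCompactSupport ψ → ContDiff ℝ 1 η → HasCompactSupport η →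
      (∀ x ∉ ball (0 : EuclideanSpace ℝ (Fin n)) ρ, η x = 0) →
      (∀ x, ∑ i, grad η x i ^ 2 ≤ r) →
      (∀ x ∈ ball (0 : EuclideanSpace ℝ (Fin n)) ρ,
        eigenvalues (F ψ x) ∈ closure (Gamma n k)) →
      (n : ℝ) ≤ a →
      energyTerm ψ η ρ a 0 k ≤
        D * a ^ N * (energyTerm ψ η ρ a k 0 + r ^ k * energyTerm ψ η ρ a 0 0) := by
  have hn1 : (1 : ℝ) ≤ n := by exact_mod_cast (by omega : 1 ≤ n)
  have hk1 : (1 : ℝ) ≤ k := by exact_mod_cast hk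
  obtain ⟨D, hD, N, h⟩ := exists_energy_chain k (C := descentConst k) (K := 4 * (n : ℝ) ^ 2)
    (by linarith [sixteen_mul_le_descentConst hk]) (by nlinarith) k
  refine ⟨D, hD, N, fun ψ η ρ r a hψ hψc hη hηc hη0 hr hcone ha => ?_⟩
  have hr0 : 0 ≤ r := (Finset.sum_nonneg fun i _ => sq_nonneg _).trans (hr 0)
  -- `J_j` is the energy term with `σ_j |∇ψ|^{2(k-j)}`, and `R_j` the one with `r^{k-j} σ_j`. Beyond
  -- `k` the sequences are irrelevant and set to zero.
  have := h a (fun j => if j ≤ k then energyTerm ψ η ρ a j (k - j) else 0)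
    (fun j => if j ≤ k then r ^ (k - j) * energyTerm ψ η ρ a j 0 else 0) (hn1.trans ha)
    (fun j => by
      split_ifs with hj
      · exact energyTerm_nonneg (by omega) hψ hcone hj _
      · exact le_rfl)
    (fun j => by
      split_ifs with hj
      · exact mul_nonneg (by positivity) (energyTerm_nonneg (by omega) hψ hcone hj _)
      · exact le_rfl)
    (fun j hj => by
      rw [if_pos hj.le, if_pos (show j + 1 ≤ k from hj), if_pos hj.le]
      exact energyTerm_le hk hkn hψ hψc hη hηc hη0 hr hcone ha hj)
    (fun j hj θ hθ hθ1 => by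
      rw [if_pos hj.le, if_pos (show j ≤ k by omega), if_pos (show j ≤ k by omega)]
      obtain ⟨m, hm⟩ : ∃ m, k = j + 2 + m := ⟨k - (j + 2), by omega⟩
      rw [show k - (j + 1) = m + 1 by omega, show k - j = m + 2 by omega]
      have e1 := energyTerm_succ_zero_le hkn hψ hψc hη hηc hη0 hr hcone ha hj
      have e2 := mul_energyTerm_one_le (η := η) (a := a) (by omega) hψ hη hr0 hcone
        (show j ≤ k by omega) m hθ hθ1
      have e3 := mul_le_mul_of_nonneg_left e1 (show 0 ≤ r ^ (m + 1) by positivity)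
      have n0 : 0 ≤ r ^ (m + 2) * energyTerm ψ η ρ a j 0 :=
        mul_nonneg (by positivity) (energyTerm_nonneg (by omega) hψ hcone (by omega) _)
      have hθi : 1 ≤ θ⁻¹ := (one_le_inv₀ hθ).2 hθ1
      have e4 : r ^ (m + 2) * energyTerm ψ η ρ a j 0 ≤
        θ⁻¹ * (r ^ (m + 2) * energyTerm ψ η ρ a j 0) := le_mul_of_one_le_left n0 hθi
      calc _ ≤ _ := e3
        _ = 4 * (n : ℝ) ^ 2 * a * (r ^ (m + 1) * energyTerm ψ η ρ a j 1
            + r ^ (m + 2) * energyTerm ψ η ρ a j 0) := by ring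
        _ ≤ 4 * (n : ℝ) ^ 2 * a * (θ * energyTerm ψ η ρ a j (m + 2)
            + 2 / θ * (r ^ (m + 2) * energyTerm ψ η ρ a j 0)) := by
          refine mul_le_mul_of_nonneg_left ?_ (by nlinarith)
          rw [show 2 / θ = θ⁻¹ + θ⁻¹ by ring]
          linarith) le_rfl
  simpa using this

end Energy

/-! ### Cutoff functions and the Sobolev inequality -/

section Cutoff

variable {n : ℕ}

lemma exists_abs_deriv_smoothTransition_le :
    ∃ L : ℝ, 1 ≤ L ∧ ∀ t, |deriv Real.smoothTransition t| ≤ L := by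
  have hc : Continuous (deriv Real.smoothTransition) :=
    (Real.smoothTransition.contDiff (n := 1)).continuous_deriv le_rfl
  obtain ⟨C, hC⟩ := (isCompact_Icc (a := (0 : ℝ)) (b := 1)).exists_bound_of_continuousOn
    hc.continuousOn
  refine ⟨max C 1, le_max_right _ _, fun t => ?_⟩
  rcases lt_or_ge t 0 with h | h
  · have : Real.smoothTransition =ᶠ[nhds t] fun _ => 0 := by
      filter_upwards [Iio_mem_nhds h] with s hs using
        Real.smoothTransition.zero_of_nonpos (le_of_lt hs)
    rw [this.deriv_eq]; simp
  rcases lt_or_ge 1 t with h' | h'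
  · have : Real.smoothTransition =ᶠ[nhds t] fun _ => 1 := by
      filter_upwards [Ioi_mem_nhds h'] with s hs using
        Real.smoothTransition.one_of_one_le (le_of_lt hs)
    rw [this.deriv_eq]; simp
  exact (hC t ⟨h, h'⟩).trans (le_max_left _ _)

lemma fderiv_eq_zero_of_nonneg {w : EuclideanSpace ℝ (Fin n) → ℝ} (hw : ∀ x, 0 ≤ w x)
    {x : EuclideanSpace ℝ (Fin n)} (hx : w x = 0) : fderiv ℝ w x = 0 :=
  IsLocalMin.fderiv_eq_zero (Filter.Eventually.of_forall fun y => by rw [hx]; exact hw y)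

/-- Cutoff functions between concentric balls, with the natural gradient bound. -/
lemma exists_cutoff (n : ℕ) : ∃ L : ℝ, 1 ≤ L ∧ ∀ ρ ρ' : ℝ, 0 ≤ ρ → ρ < ρ' →
    ∃ η : EuclideanSpace ℝ (Fin n) → ℝ, ContDiff ℝ 1 η ∧ HasCompactSupport η ∧
      (∀ x, 0 ≤ η x) ∧ (∀ x, η x ≤ 1) ∧ (∀ x ∈ ball 0 ρ, η x = 1) ∧ (∀ x ∉ ball 0 ρ', η x = 0) ∧
      ∀ x, ∑ i, grad η x i ^ 2 ≤ (L / (ρ' - ρ)) ^ 2 := by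
  obtain ⟨L, hL, hd⟩ := exists_abs_deriv_smoothTransition_le
  refine ⟨2 * L, by linarith, fun ρ ρ' hρ hρρ' => ?_⟩
  have hδ : 0 < ρ' ^ 2 - ρ ^ 2 := by nlinarith
  set g : EuclideanSpace ℝ (Fin n) → ℝ := fun x => (ρ' ^ 2 - ‖x‖ ^ 2) / (ρ' ^ 2 - ρ ^ 2) with hg
  set η : EuclideanSpace ℝ (Fin n) → ℝ := fun x => Real.smoothTransition (g x) with hη
  have hgc : ContDiff ℝ 1 g := (contDiff_const.sub (contDiff_norm_sq ℝ)).div_const _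
  have hηc : ContDiff ℝ 1 η := Real.smoothTransition.contDiff.comp hgc
  have hη0 : ∀ x, 0 ≤ η x := fun x => Real.smoothTransition.nonneg _
  have hz : ∀ x ∉ ball (0 : EuclideanSpace ℝ (Fin n)) ρ', η x = 0 := by
    intro x hx
    rw [mem_ball_zero_iff, not_lt] at hx
    refine Real.smoothTransition.zero_of_nonpos (div_nonpos_of_nonpos_of_nonneg ?_ hδ.le)
    nlinarith
  refine ⟨η, hηc, ?_, hη0, fun x => Real.smoothTransition.le_one _, ?_, hz, ?_⟩
  · refine HasCompactSupport.of_support_subset_isCompact (isCompact_closedBall 0 ρ') fun x hx => ?_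
    by_contra h
    exact hx (hz x fun h' => h (ball_subset_closedBall h'))
  · intro x hx
    rw [mem_ball_zero_iff] at hx
    refine Real.smoothTransition.one_of_one_le ((one_le_div hδ).2 ?_)
    nlinarith [norm_nonneg x]
  · intro x
    by_cases hx : x ∈ ball (0 : EuclideanSpace ℝ (Fin n)) ρ'
    swap
    · have : ∀ i, grad η x i = 0 := fun i => by
        rw [grad, partialDeriv, fderiv_eq_zero_of_nonneg hη0 (hz x hx)]; rfl
      simp only [this]
      simp; positivity
    rw [mem_ball_zero_iff] at hx
    have hgi (i : Fin n) : grad η x i =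
        deriv Real.smoothTransition (g x) * (-(2 * x i) / (ρ' ^ 2 - ρ ^ 2)) := by
      have h1 : HasFDerivAt (fun x : EuclideanSpace ℝ (Fin n) => ‖x‖ ^ 2) (2 • innerSL ℝ x) x :=
        (hasStrictFDerivAt_norm_sq x).hasFDerivAt
      have h2 : HasFDerivAt g ((ρ' ^ 2 - ρ ^ 2)⁻¹ •
          (-(2 • innerSL ℝ x : EuclideanSpace ℝ (Fin n) →L[ℝ] ℝ))) x :=
        (h1.const_sub (ρ' ^ 2)).mul_const ((ρ' ^ 2 - ρ ^ 2)⁻¹)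
      have h3 : HasDerivAt Real.smoothTransition (deriv Real.smoothTransition (g x)) (g x) :=
        ((Real.smoothTransition.contDiff (n := 1)).differentiable (by simp) _).hasDerivAt
      have h4 := h3.comp_hasFDerivAt x h2
      have h5 : fderiv ℝ η x = _ := h4.fderiv
      rw [grad, partialDeriv, h5]
      simp [EuclideanSpace.inner_single_right]
      ring
    have hnx : ∑ i, x i ^ 2 = ‖x‖ ^ 2 := (EuclideanSpace.real_norm_sq_eq x).symm
    have hsum : ∑ i, grad η x i ^ 2 =
        (deriv Real.smoothTransition (g x)) ^ 2 * (2 / (ρ' ^ 2 - ρ ^ 2)) ^ 2 * ‖x‖ ^ 2 := by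
      rw [← hnx, Finset.mul_sum]
      exact Finset.sum_congr rfl fun i _ => by rw [hgi]; ring
    rw [hsum]
    have hρ' : 0 < ρ' := hρ.trans_lt hρρ'
    have e1 : (deriv Real.smoothTransition (g x)) ^ 2 ≤ L ^ 2 := by
      rw [← sq_abs]; exact pow_le_pow_left₀ (abs_nonneg _) (hd _) 2
    have e2 : 2 / (ρ' ^ 2 - ρ ^ 2) * ‖x‖ ≤ 2 / (ρ' - ρ) := by
      have h1 : ρ' ^ 2 - ρ ^ 2 = (ρ' - ρ) * (ρ' + ρ) := by ring
      rw [h1, div_mul_eq_mul_div, div_le_div_iff₀ (by nlinarith) (by linarith)]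
      have h2 : 0 ≤ 2 * (ρ' - ρ) := by linarith
      nlinarith
    have e3 : (2 / (ρ' ^ 2 - ρ ^ 2) * ‖x‖) ^ 2 ≤ (2 / (ρ' - ρ)) ^ 2 :=
      pow_le_pow_left₀ (by positivity) e2 2
    calc _ = (deriv Real.smoothTransition (g x)) ^ 2 * (2 / (ρ' ^ 2 - ρ ^ 2) * ‖x‖) ^ 2 := by ring
      _ ≤ L ^ 2 * (2 / (ρ' - ρ)) ^ 2 := by gcongr
      _ = _ := by ring

end Cutoff

section Sobolev

variable {n : ℕ}

/-- Sobolev's inequality for functions supported in the unit ball, where the exponent `P` on the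
right is lowered to some `s < n` first, so that `P = n` is allowed. -/
lemma exists_sobolev {P s Q : ℝ} (hs : 1 ≤ s) (hsn : s < n) (hsP : s ≤ P) (hQ : 0 < Q)
    (hsQ : s⁻¹ - (n : ℝ)⁻¹ ≤ Q⁻¹) :
    ∃ C : ℝ, 1 ≤ C ∧ ∀ w : EuclideanSpace ℝ (Fin n) → ℝ, ContDiff ℝ 1 w → HasCompactSupport w →
      (∀ x, 0 ≤ w x) → (∀ x ∉ ball (0 : EuclideanSpace ℝ (Fin n)) 1, w x = 0) →
      (∫ x, ‖w x‖ ^ Q) ^ Q⁻¹ ≤ C * (∫ x, ‖fderiv ℝ w x‖ ^ P) ^ P⁻¹ := by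
  have hP : 1 ≤ P := hs.trans hsP
  set s' : ℝ≥0 := ⟨s, by linarith⟩
  set Q' : ℝ≥0 := ⟨Q, hQ.le⟩
  set P' : ℝ≥0 := ⟨P, by linarith⟩
  set B := ball (0 : EuclideanSpace ℝ (Fin n)) 1
  set C₁ := eLpNormLESNormFDerivOfLeConst ℝ (volume : Measure (EuclideanSpace ℝ (Fin n))) B s' Q'
  set C₂ : ℝ≥0∞ := (volume.restrict B) Set.univ ^ (1 / s - 1 / P)
  have hC₂ : C₂ ≠ ∞ := by
    refine ENNReal.rpow_ne_top_of_nonneg ?_ ?_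
    · rw [sub_nonneg]; gcongr
    · rw [Measure.restrict_apply_univ]; exact measure_ball_lt_top.ne
  refine ⟨max 1 (C₁ * C₂.toReal), le_max_left _ _, fun w hw hwc hw0 hwB => ?_⟩
  have hsupp : Function.support (fderiv ℝ w) ⊆ B := by
    intro x hx
    by_contra h
    exact hx (fderiv_eq_zero_of_nonneg hw0 (hwB x h))
  have hfc : Continuous (fderiv ℝ w) := hw.continuous_fderiv (by simp)
  have hfcs : HasCompactSupport (fderiv ℝ w) := hwc.fderiv ℝ
  have h1 : eLpNorm w Q' volume ≤ C₁ * eLpNorm (fderiv ℝ w) s' volume := by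
    refine eLpNorm_le_eLpNorm_fderiv_of_le (s := B) volume hw ?_ (by exact_mod_cast hs) ?_ ?_
      isBounded_ball
    · intro x hx
      by_contra h
      exact hx (hwB x h)
    · rw [finrank_euclideanSpace_fin]
      exact_mod_cast hsn
    · rw [finrank_euclideanSpace_fin]
      exact hsQ
  have h2 : eLpNorm (fderiv ℝ w) s' volume ≤ eLpNorm (fderiv ℝ w) P' volume * C₂ := by
    have hsupp' : Function.support (fun x => ‖fderiv ℝ w x‖) ⊆ B := fun x hx =>
      hsupp fun h => hx (by simp only [h, norm_zero])
    rw [← eLpNorm_norm, ← eLpNorm_restrict_eq_of_support_subset hsupp', eLpNorm_norm]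
    refine (eLpNorm_le_eLpNorm_mul_rpow_measure_univ (p := s') (q := P') ?_
      hfc.aestronglyMeasurable).trans ?_
    · exact_mod_cast hsP
    · exact mul_le_mul_left (eLpNorm_restrict_le _ _ _ _) _
  have m1 : MemLp w Q' volume := hw.continuous.memLp_of_hasCompactSupport hwc
  have m2 : MemLp (fderiv ℝ w) P' volume := hfc.memLp_of_hasCompactSupport hfcs
  have hQ0 : (Q' : ℝ≥0∞) ≠ 0 := by
    have : Q' ≠ 0 := fun h => hQ.ne' (congrArg NNReal.toReal h)
    exact_mod_cast this
  have hP0 : (P' : ℝ≥0∞) ≠ 0 := by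
    have : P' ≠ 0 := fun h => (zero_lt_one.trans_le hP).ne' (congrArg NNReal.toReal h)
    exact_mod_cast this
  have h3 := h1.trans (mul_le_mul_right h2 _)
  rw [m1.eLpNorm_eq_integral_rpow_norm hQ0 ENNReal.coe_ne_top,
    m2.eLpNorm_eq_integral_rpow_norm hP0 ENNReal.coe_ne_top] at h3
  have h4 := ENNReal.toReal_mono (by finiteness) h3
  rw [ENNReal.toReal_mul, ENNReal.toReal_mul, ENNReal.toReal_ofReal (by positivity),
    ENNReal.toReal_ofReal (by positivity)] at h4
  simp only [ENNReal.coe_toReal] at h4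
  change (∫ x, ‖w x‖ ^ Q) ^ Q⁻¹ ≤ C₁ * ((∫ x, ‖fderiv ℝ w x‖ ^ P) ^ P⁻¹ * C₂.toReal) at h4
  refine h4.trans ?_
  have h5 : 0 ≤ (∫ x, ‖fderiv ℝ w x‖ ^ P) ^ P⁻¹ := by positivity
  calc _ = (C₁ * C₂.toReal) * (∫ x, ‖fderiv ℝ w x‖ ^ P) ^ P⁻¹ := by ring
    _ ≤ _ := mul_le_mul_of_nonneg_right (le_max_right _ _) h5

/-- Exponents for the Sobolev inequality, with a gain over `2k` times the conjugate exponent of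
`p > n/(2k)`. -/
lemma exists_sobolev_exponents {k : ℕ} (hk : 1 ≤ k) (hkn : 2 * k ≤ n) {p p' : ℝ}
    (hpp : p.HolderConjugate p') (hp : (n : ℝ) / (2 * k) < p) :
    ∃ s Q : ℝ, 1 ≤ s ∧ s < n ∧ s ≤ 2 * k ∧ 2 * k * p' < Q ∧ s⁻¹ - (n : ℝ)⁻¹ ≤ Q⁻¹ := by
  have hk1 : (1 : ℝ) ≤ k := by exact_mod_cast hk
  have hnk : 2 * (k : ℝ) ≤ n := by exact_mod_cast hkn
  have hn : (2 : ℝ) ≤ n := by linarith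
  have hp0 := hpp.pos
  have hp0' := hpp.symm.pos
  set g : ℝ := (n : ℝ)⁻¹ - (2 * k * p)⁻¹ with hg
  have hg0 : 0 < g := by
    rw [hg, sub_pos]
    rw [div_lt_iff₀ (by positivity)] at hp
    exact inv_strictAnti₀ (by positivity) (by linarith)
  have hgn : g < (n : ℝ)⁻¹ := by
    have : 0 < (2 * k * p)⁻¹ := by positivity
    linarith
  have hn2 : (n : ℝ)⁻¹ ≤ 1 / 2 := by rw [inv_le_comm₀ (by positivity) (by norm_num)]; linarith
  have hk2 : (2 * (k : ℝ))⁻¹ ≤ 1 / 2 := by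
    rw [inv_le_comm₀ (by positivity) (by norm_num)]; linarith
  have hkn' : (n : ℝ)⁻¹ ≤ (2 * (k : ℝ))⁻¹ := inv_anti₀ (by positivity) hnk
  -- `σ = 1/s` lies above `1/(2k)`, so that `s < 2k ≤ n`, by less than the available gap `g`.
  set σ : ℝ := (2 * (k : ℝ))⁻¹ + g / 2 with hσ
  have hσ0 : 0 < σ := by positivity
  have hσn : 0 < σ - (n : ℝ)⁻¹ := by linarith
  refine ⟨σ⁻¹, (σ - (n : ℝ)⁻¹)⁻¹, ?_, ?_, ?_, ?_, ?_⟩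
  · rw [one_le_inv₀ hσ0]; linarith
  · rw [inv_lt_comm₀ hσ0 (by positivity)]; linarith
  · rw [inv_le_comm₀ hσ0 (by positivity)]; linarith
  · rw [lt_inv_comm₀ (by positivity) hσn]
    have h1 : (2 * k * p')⁻¹ = (2 * (k : ℝ))⁻¹ - (2 * k * p)⁻¹ := by
      have := hpp.inv_add_inv_eq_one
      rw [mul_inv _ p', mul_inv _ p, ← mul_one_sub, ← this]; ring
    rw [h1]
    linarith
  · simp

lemma norm_sq_le_sum_sq (l : EuclideanSpace ℝ (Fin n) →L[ℝ] ℝ) :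
    ‖l‖ ^ 2 ≤ ∑ i, l (EuclideanSpace.single i 1) ^ 2 := by
  have h : ‖l‖ ≤ √(∑ i, l (EuclideanSpace.single i 1) ^ 2) := by
    refine l.opNorm_le_bound (Real.sqrt_nonneg _) fun v => ?_
    have hv : l v = ∑ i, v i * l (EuclideanSpace.single i 1) := by
      conv_lhs => rw [← (EuclideanSpace.basisFun (Fin n) ℝ).sum_repr v, map_sum]
      exact Finset.sum_congr rfl fun i _ => by simp
    rw [Real.norm_eq_abs, hv, EuclideanSpace.norm_eq, mul_comm, ← Real.sqrt_mul (by positivity)]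
    refine Real.abs_le_sqrt ?_
    refine (Finset.sum_mul_sq_le_sq_mul_sq _ _ _).trans_eq ?_
    simp
  calc ‖l‖ ^ 2 ≤ √(∑ i, l (EuclideanSpace.single i 1) ^ 2) ^ 2 := by gcongr
    _ = _ := Real.sq_sqrt (Finset.sum_nonneg fun i _ => sq_nonneg _)

end Sobolev

/-! ### The reverse Hölder inequality -/

section ReverseHolder

open Matrix

variable {n k : ℕ}

/-- The integral `∫ e^{-bψ}` over the ball of radius `ρ`. -/
def expIntegral (ψ : EuclideanSpace ℝ (Fin n) → ℝ) (b ρ : ℝ) : ℝ :=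
  ∫ x in ball 0 ρ, Real.exp (-b * ψ x)

/-- The hypotheses on `ψ` used in the iteration: on the unit ball `λ(F[ψ])` lies in the closure of
`Γ_k`, and `σ_k` is bounded by `Λ` as a functional on the Lebesgue space with exponent `p'`. The
function `ψ` is defined and of class `C²` on the whole space. -/
structure IsAdmissible (k : ℕ) (p' Λ : ℝ) (ψ : EuclideanSpace ℝ (Fin n) → ℝ) : Prop where
  contDiff : ContDiff ℝ 2 ψ
  hasCompactSupport : HasCompactSupport ψ
  mem_closure : ∀ x ∈ ball (0 : EuclideanSpace ℝ (Fin n)) 1,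
    eigenvalues (F ψ x) ∈ closure (Gamma n k)
  integral_le : ∀ ρ ≤ 1, ∀ g : EuclideanSpace ℝ (Fin n) → ℝ, Continuous g → (∀ x, 0 ≤ g x) →
    ∫ x in ball 0 ρ, newtonSigma (F ψ x) k * g x ≤ Λ * (∫ x in ball 0 ρ, g x ^ p') ^ (1 / p')

lemma continuous_exp_mul {ψ : EuclideanSpace ℝ (Fin n) → ℝ} (hψ : Continuous ψ) (b : ℝ) :
    Continuous fun x => Real.exp (b * ψ x) := by fun_prop

lemma expIntegral_nonneg (ψ : EuclideanSpace ℝ (Fin n) → ℝ) (b ρ : ℝ) : 0 ≤ expIntegral ψ b ρ :=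
  integral_nonneg fun _ => (Real.exp_pos _).le

lemma exp_rpow (x y : ℝ) : Real.exp x ^ y = Real.exp (x * y) := by rw [Real.exp_mul]

lemma memLp_ball_of_continuous {f : EuclideanSpace ℝ (Fin n) → ℝ} (hf : Continuous f) (ρ : ℝ)
    (q : ℝ≥0∞) : MemLp f q (volume.restrict (ball 0 ρ)) := by
  have : IsFiniteMeasure (volume.restrict (ball (0 : EuclideanSpace ℝ (Fin n)) ρ)) :=
    ⟨by rw [Measure.restrict_apply_univ]; exact measure_ball_lt_top⟩
  obtain ⟨C, hC⟩ := (isCompact_closedBall (0 : EuclideanSpace ℝ (Fin n))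
    ρ).exists_bound_of_continuousOn hf.continuousOn
  exact MemLp.of_bound hf.aestronglyMeasurable C
    ((ae_restrict_mem measurableSet_ball).mono fun x hx => hC x (ball_subset_closedBall hx))

lemma expIntegral_le_rpow {ψ : EuclideanSpace ℝ (Fin n) → ℝ} (hψ : Continuous ψ) {p p' : ℝ}
    (hpp : p.HolderConjugate p') (a : ℝ) {ρ : ℝ} (hρ : ρ ≤ 1) :
    expIntegral ψ a ρ ≤ (1 + volume.real (ball (0 : EuclideanSpace ℝ (Fin n)) 1)) *
      expIntegral ψ (a * p') ρ ^ (1 / p') := by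
  have hp1 : 1 / p ≤ 1 := by
    rw [div_le_one hpp.pos]; exact hpp.lt.le
  have m1 : MemLp (fun _ : EuclideanSpace ℝ (Fin n) => (1 : ℝ)) (ENNReal.ofReal p)
      (volume.restrict (ball 0 ρ)) := memLp_ball_of_continuous continuous_const ρ _
  have m2 : MemLp (fun x => Real.exp (-a * ψ x)) (ENNReal.ofReal p')
      (volume.restrict (ball (0 : EuclideanSpace ℝ (Fin n)) ρ)) :=
    memLp_ball_of_continuous (continuous_exp_mul hψ (-a)) ρ _
  have h := integral_mul_le_Lp_mul_Lq_of_nonneg (μ := volume.restrict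
    (ball (0 : EuclideanSpace ℝ (Fin n)) ρ)) hpp (Filter.Eventually.of_forall fun _ => zero_le_one)
    (Filter.Eventually.of_forall fun x => (Real.exp_pos (-a * ψ x)).le) m1 m2
  simp only [one_mul, Real.one_rpow, exp_rpow] at h
  have e : ∀ x, -a * ψ x * p' = -(a * p') * ψ x := fun x => by ring
  simp only [e] at h
  refine h.trans (mul_le_mul_of_nonneg_right ?_ (Real.rpow_nonneg (expIntegral_nonneg _ _ _) _))
  have h1 : ∫ _ in ball (0 : EuclideanSpace ℝ (Fin n)) ρ, (1 : ℝ) =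
      volume.real (ball (0 : EuclideanSpace ℝ (Fin n)) ρ) := by simp
  have h2 : volume.real (ball (0 : EuclideanSpace ℝ (Fin n)) ρ) ≤
      volume.real (ball (0 : EuclideanSpace ℝ (Fin n)) 1) :=
    measureReal_mono (ball_subset_ball hρ) measure_ball_lt_top.ne
  rw [h1]
  have h3 : (0 : ℝ) ≤ volume.real (ball (0 : EuclideanSpace ℝ (Fin n)) ρ) := measureReal_nonneg
  calc _ ≤ (1 + volume.real (ball (0 : EuclideanSpace ℝ (Fin n)) 1)) ^ (1 / p) :=
        Real.rpow_le_rpow h3 (by linarith) (by have := hpp.pos; positivity)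
    _ ≤ (1 + volume.real (ball (0 : EuclideanSpace ℝ (Fin n)) 1)) ^ (1 : ℝ) :=
        Real.rpow_le_rpow_of_exponent_le (by linarith) hp1
    _ = _ := Real.rpow_one _

/-- The two terms of the right side are the integrands of energy terms. -/
lemma norm_fderiv_mul_exp_pow_le {ψ η : EuclideanSpace ℝ (Fin n) → ℝ} (hψ : ContDiff ℝ 1 ψ)
    (hη : ContDiff ℝ 1 η) (hk : 1 ≤ k) {a r : ℝ} (ha : 0 ≤ a) {x : EuclideanSpace ℝ (Fin n)}
    (hr : ∑ i, grad η x i ^ 2 ≤ r) :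
    ‖fderiv ℝ (fun x => η x * Real.exp (-(a / (2 * k)) * ψ x)) x‖ ^ (2 * k) ≤
      4 ^ k * (r ^ k + a ^ (2 * k) * ((∑ l, grad ψ x l ^ 2) * η x ^ 2) ^ k)
        * Real.exp (-a * ψ x) := by
  have hk1 : (1 : ℝ) ≤ k := by exact_mod_cast hk
  set c := a / (2 * (k : ℝ)) with hc
  have hc0 : 0 ≤ c := by positivity
  have hca : c ≤ a := by rw [hc]; exact div_le_self ha (by linarith)
  set s := ∑ l, grad ψ x l ^ 2 with hs
  have hs0 : 0 ≤ s := Finset.sum_nonneg fun i _ => sq_nonneg _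
  have hr0 : 0 ≤ r := (Finset.sum_nonneg fun i _ => sq_nonneg _).trans hr
  set E := Real.exp (-c * ψ x) with hE
  have hd (i : Fin n) : fderiv ℝ (fun x => η x * Real.exp (-c * ψ x)) x
      (EuclideanSpace.single i 1) = E * (grad η x i - c * η x * grad ψ x i) := by
    have h1 := (hη.differentiable (by simp) x).hasFDerivAt
    have h2 := (hψ.differentiable (by simp) x).hasFDerivAt
    have h3 := h1.mul (h2.const_mul (-c)).exp
    have h4 : fderiv ℝ (fun x => η x * Real.exp (-c * ψ x)) x = _ := h3.fderiv
    rw [h4]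
    simp only [grad, partialDeriv, hE]
    simp
    ring
  have h1 : ‖fderiv ℝ (fun x => η x * Real.exp (-c * ψ x)) x‖ ^ 2 ≤
      E ^ 2 * (2 * (r + a ^ 2 * (s * η x ^ 2))) := by
    refine (norm_sq_le_sum_sq _).trans ?_
    calc ∑ i, fderiv ℝ (fun x => η x * Real.exp (-c * ψ x)) x (EuclideanSpace.single i 1) ^ 2
        ≤ ∑ i, E ^ 2 * (2 * (grad η x i ^ 2 + c ^ 2 * (grad ψ x i ^ 2 * η x ^ 2))) := by
          refine Finset.sum_le_sum fun i _ => ?_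
          rw [hd, mul_pow]
          refine mul_le_mul_of_nonneg_left ?_ (sq_nonneg _)
          nlinarith [sq_nonneg (grad η x i + c * η x * grad ψ x i)]
      _ = E ^ 2 * (2 * (∑ i, grad η x i ^ 2 + c ^ 2 * (s * η x ^ 2))) := by
          rw [← Finset.mul_sum, ← Finset.mul_sum, Finset.sum_add_distrib, ← Finset.mul_sum,
            ← Finset.sum_mul]
      _ ≤ _ := by gcongr
  have h2 : E ^ (2 * k) = Real.exp (-a * ψ x) := by
    rw [hE, ← Real.exp_nat_mul, hc]
    congr 1
    push_cast
    field_simp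
  have h3 : (r + a ^ 2 * (s * η x ^ 2)) ^ k ≤
      2 ^ k * (r ^ k + a ^ (2 * k) * (s * η x ^ 2) ^ k) := by
    have h4 := add_pow_le hr0 (show 0 ≤ a ^ 2 * (s * η x ^ 2) by positivity) k
    rw [mul_pow (a ^ 2), ← pow_mul] at h4
    refine h4.trans (mul_le_mul_of_nonneg_right ?_ (by positivity))
    exact pow_le_pow_right₀ (by norm_num) (by omega)
  calc _ = (‖fderiv ℝ (fun x => η x * Real.exp (-c * ψ x)) x‖ ^ 2) ^ k := by rw [pow_mul]
    _ ≤ (E ^ 2 * (2 * (r + a ^ 2 * (s * η x ^ 2)))) ^ k := by gcongr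
    _ = E ^ (2 * k) * (2 ^ k * (r + a ^ 2 * (s * η x ^ 2)) ^ k) := by
        rw [mul_pow, mul_pow, ← pow_mul]
    _ ≤ E ^ (2 * k) * (2 ^ k * (2 ^ k * (r ^ k + a ^ (2 * k) * (s * η x ^ 2) ^ k))) := by gcongr
    _ = _ := by
        have h4 : (4 : ℝ) ^ k = 2 ^ k * 2 ^ k := by rw [← mul_pow]; norm_num
        rw [h2, h4]
        ring

/-- The gradient estimate for `η e^{-aψ/(2k)}`, from the energy estimate and Hölder's inequality. -/
lemma exists_integral_norm_fderiv_le (hk : 1 ≤ k) (hkn : 2 * k ≤ n) {p p' Λ : ℝ}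
    (hpp : p.HolderConjugate p') (hΛ : 0 ≤ Λ) :
    ∃ K : ℝ, 1 ≤ K ∧ ∃ N : ℕ, ∀ (ψ η : EuclideanSpace ℝ (Fin n) → ℝ) (ρ r a : ℝ),
      IsAdmissible k p' Λ ψ → ContDiff ℝ 1 η → HasCompactSupport η → ρ ≤ 1 →
      (∀ x, 0 ≤ η x) → (∀ x, η x ≤ 1) →
      (∀ x ∉ ball (0 : EuclideanSpace ℝ (Fin n)) ρ, η x = 0) →
      (∀ x, ∑ i, grad η x i ^ 2 ≤ r) → 1 ≤ r → (n : ℝ) ≤ a →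
      ∫ x, ‖fderiv ℝ (fun x => η x * Real.exp (-(a / (2 * k)) * ψ x)) x‖ ^ (2 * k) ≤
        K * a ^ N * r ^ k * expIntegral ψ (a * p') ρ ^ (1 / p') := by
  obtain ⟨D, hD, N, hen⟩ := exists_energy_estimate (n := n) hk hkn
  set V : ℝ := 1 + volume.real (ball (0 : EuclideanSpace ℝ (Fin n)) 1)
  have hV : 1 ≤ V := by
    have : (0 : ℝ) ≤ volume.real (ball (0 : EuclideanSpace ℝ (Fin n)) 1) := measureReal_nonneg
    linarith
  have hn1 : (1 : ℝ) ≤ n := by exact_mod_cast (by omega : 1 ≤ n)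
  refine ⟨4 ^ k * (V + D * (Λ + V)), ?_, N + 2 * k, ?_⟩
  · have h1 : (1 : ℝ) ≤ 4 ^ k := one_le_pow₀ (by norm_num)
    have h2 : 0 ≤ D * (Λ + V) := by positivity
    nlinarith
  intro ψ η ρ r a hadm hη hηc hρ hη0 hη1 hηB hr hr1 ha
  have ha1 : 1 ≤ a := hn1.trans ha
  have hψ := hadm.contDiff
  have hψ1 : ContDiff ℝ 1 ψ := hψ.of_le (by norm_num)
  set Z := expIntegral ψ (a * p') ρ ^ (1 / p') with hZ
  have hZ0 : 0 ≤ Z := Real.rpow_nonneg (expIntegral_nonneg _ _ _) _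
  have e00 : energyTerm ψ η ρ a 0 0 = expIntegral ψ a ρ := by simp [energyTerm, expIntegral]
  have e0 : energyTerm ψ η ρ a 0 0 ≤ V * Z := by
    rw [e00]; exact expIntegral_le_rpow hψ.continuous hpp a hρ
  have ek : energyTerm ψ η ρ a k 0 ≤ Λ * Z := by
    have hg : Continuous fun x => η x ^ (2 * k) * Real.exp (-a * ψ x) :=
      (hη.continuous.pow _).mul (continuous_exp_mul hψ.continuous _)
    have hg0 : ∀ x, 0 ≤ η x ^ (2 * k) * Real.exp (-a * ψ x) := fun x =>
      mul_nonneg (pow_nonneg (hη0 x) _) (Real.exp_pos _).le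
    have h1 := hadm.integral_le ρ hρ _ hg hg0
    have h2 : energyTerm ψ η ρ a k 0 =
        ∫ x in ball 0 ρ, newtonSigma (F ψ x) k * (η x ^ (2 * k) * Real.exp (-a * ψ x)) := by
      simp [energyTerm, mul_assoc]
    rw [h2]
    refine h1.trans (mul_le_mul_of_nonneg_left ?_ hΛ)
    have hp' := hpp.symm.pos
    refine Real.rpow_le_rpow (integral_nonneg fun x => Real.rpow_nonneg (hg0 x) _) ?_
      (by positivity)
    refine setIntegral_mono_on (integrableOn_ball_of_continuous
      (hg.rpow_const fun x => Or.inr hp'.le) 0 ρ)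
      (integrableOn_ball_of_continuous (continuous_exp_mul hψ.continuous _) 0 ρ)
      measurableSet_ball fun x _ => ?_
    have h3 : η x ^ (2 * k) * Real.exp (-a * ψ x) ≤ Real.exp (-a * ψ x) :=
      mul_le_of_le_one_left (Real.exp_pos _).le (pow_le_one₀ (hη0 x) (hη1 x))
    calc _ ≤ Real.exp (-a * ψ x) ^ p' := Real.rpow_le_rpow (hg0 x) h3 hp'.le
      _ = _ := by rw [exp_rpow]; congr 1; ring
  have hE := hen ψ η ρ r a hψ hadm.hasCompactSupport hη hηc hηB hr
    (fun x hx => hadm.mem_closure x (ball_subset_ball hρ hx)) ha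
  have hw0 : ∀ x, 0 ≤ η x * Real.exp (-(a / (2 * k)) * ψ x) := fun x =>
    mul_nonneg (hη0 x) (Real.exp_pos _).le
  have hint : ∫ x, ‖fderiv ℝ (fun x => η x * Real.exp (-(a / (2 * k)) * ψ x)) x‖ ^ (2 * k) =
      ∫ x in ball 0 ρ,
        ‖fderiv ℝ (fun x => η x * Real.exp (-(a / (2 * k)) * ψ x)) x‖ ^ (2 * k) := by
    refine (setIntegral_eq_integral_of_forall_compl_eq_zero fun x hx => ?_).symm
    rw [fderiv_eq_zero_of_nonneg hw0 (by rw [hηB x hx, zero_mul]), norm_zero,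
      zero_pow (by omega)]
  have hwc : ContDiff ℝ 1 fun x => η x * Real.exp (-(a / (2 * k)) * ψ x) :=
    hη.mul (Real.contDiff_exp.comp (contDiff_const.mul hψ1))
  have hmono := setIntegral_le_of_le (ρ := ρ)
    ((hwc.continuous_fderiv (by simp)).norm.pow (2 * k))
    (continuous_energyTerm_integrand (a := a) hψ hη 0 0)
    (continuous_energyTerm_integrand (a := a) hψ hη 0 k)
    (continuous_energyTerm_integrand (a := a) hψ hη 0 0) (4 ^ k * r ^ k) (4 ^ k * a ^ (2 * k)) 0
    fun x _ => (norm_fderiv_mul_exp_pow_le hψ1 hη hk (by linarith) (hr x)).trans_eq (by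
      simp; ring)
  rw [hint]
  refine hmono.trans ?_
  change 4 ^ k * r ^ k * energyTerm ψ η ρ a 0 0 + 4 ^ k * a ^ (2 * k) * energyTerm ψ η ρ a 0 k
    + 0 * _ ≤ _
  have hrk : 1 ≤ r ^ k := one_le_pow₀ hr1
  have haN : 1 ≤ a ^ (N + 2 * k) := one_le_pow₀ ha1
  have f1 : energyTerm ψ η ρ a 0 k ≤ D * a ^ N * ((Λ + V) * r ^ k * Z) := by
    refine hE.trans (mul_le_mul_of_nonneg_left ?_ (by positivity))
    have g1 : energyTerm ψ η ρ a k 0 ≤ Λ * r ^ k * Z := by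
      refine ek.trans ?_
      have : Λ * Z ≤ r ^ k * (Λ * Z) := le_mul_of_one_le_left (by positivity) hrk
      linarith
    have g2 := mul_le_mul_of_nonneg_left e0 (show 0 ≤ r ^ k by positivity)
    linarith
  have f2 : r ^ k * energyTerm ψ η ρ a 0 0 ≤ V * a ^ (N + 2 * k) * r ^ k * Z := by
    have g1 := mul_le_mul_of_nonneg_left e0 (show 0 ≤ r ^ k by positivity)
    have g2 : V * r ^ k * Z ≤ a ^ (N + 2 * k) * (V * r ^ k * Z) :=
      le_mul_of_one_le_left (by positivity) haN
    linarith
  have f3 : a ^ (2 * k) * energyTerm ψ η ρ a 0 k ≤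
      D * (Λ + V) * a ^ (N + 2 * k) * r ^ k * Z := by
    refine (mul_le_mul_of_nonneg_left f1 (show 0 ≤ a ^ (2 * k) by positivity)).trans_eq ?_
    rw [pow_add]; ring
  have f4 := mul_le_mul_of_nonneg_left (add_le_add f2 f3) (show (0 : ℝ) ≤ 4 ^ k by positivity)
  linarith

/-- The reverse Hölder inequality for `e^{-ψ}` on concentric balls. -/
lemma exists_reverse_holder (hk : 1 ≤ k) (hkn : 2 * k ≤ n) {p p' Λ : ℝ}
    (hpp : p.HolderConjugate p') (hp : (n : ℝ) / (2 * k) < p) (hΛ : 0 ≤ Λ) :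
    ∃ C ν κ b₀ : ℝ, 1 ≤ C ∧ 0 < ν ∧ 1 < κ ∧ 1 ≤ b₀ ∧
      ∀ ψ : EuclideanSpace ℝ (Fin n) → ℝ, IsAdmissible k p' Λ ψ →
      ∀ ρ ρ' b : ℝ, 0 ≤ ρ → ρ < ρ' → ρ' ≤ 1 → b₀ ≤ b →
      expIntegral ψ (κ * b) ρ ≤ (C * (b / (ρ' - ρ)) ^ ν * expIntegral ψ b ρ') ^ κ := by
  obtain ⟨s, Q, hs, hsn, hsk, hQ, hsQ⟩ := exists_sobolev_exponents hk hkn hpp hp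
  have hk1 : (1 : ℝ) ≤ k := by exact_mod_cast hk
  have hp' := hpp.symm.pos
  have hp1 : 1 ≤ p' := hpp.symm.lt.le
  have hQ0 : 0 < Q := lt_trans (by positivity) hQ
  have hn1 : (1 : ℝ) ≤ n := by exact_mod_cast (by omega : 1 ≤ n)
  obtain ⟨C, hC, hsob⟩ := exists_sobolev (n := n) hs hsn hsk hQ0 hsQ
  obtain ⟨K, hK, N, hgrad⟩ := exists_integral_norm_fderiv_le (n := n) hk hkn hpp hΛ
  obtain ⟨L, hL, hcut⟩ := exists_cutoff n
  set κ := Q / (2 * k * p') with hκ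
  have hκ1 : 1 < κ := (one_lt_div (by positivity)).2 hQ
  refine ⟨(C ^ (2 * k) * K * L ^ (2 * k)) ^ p', (N + 4 * k : ℕ) * p', κ, n * p',
    ?_, ?_, hκ1, ?_, ?_⟩
  · refine Real.one_le_rpow ?_ hp'.le
    have h1 : (1 : ℝ) ≤ C ^ (2 * k) := one_le_pow₀ hC
    have h2 : (1 : ℝ) ≤ L ^ (2 * k) := one_le_pow₀ hL
    exact one_le_mul_of_one_le_of_one_le (one_le_mul_of_one_le_of_one_le h1 hK) h2
  · have : (0 : ℝ) < (N + 4 * k : ℕ) := by exact_mod_cast (by omega : 0 < N + 4 * k)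
    positivity
  · exact one_le_mul_of_one_le_of_one_le hn1 hp1
  intro ψ hadm ρ ρ' b hρ hρρ' hρ' hb
  obtain ⟨η, hη, hηc, hη0, hη1, hηρ, hηB, hr⟩ := hcut ρ ρ' hρ hρρ'
  have hψ1 : ContDiff ℝ 1 ψ := hadm.contDiff.of_le (by norm_num)
  set δ := ρ' - ρ with hδ
  have hδ0 : 0 < δ := by linarith
  have hδ1 : δ ≤ 1 := by linarith
  have hLδ : 1 ≤ L / δ := by rw [le_div_iff₀ hδ0]; linarith
  set a := b / p' with ha
  have hab : a * p' = b := by rw [ha]; field_simp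
  have han : (n : ℝ) ≤ a := by rw [ha, le_div_iff₀ hp']; exact hb
  have ha1 : 1 ≤ a := hn1.trans han
  have hG := hgrad ψ η ρ' ((L / δ) ^ 2) a hadm hη hηc hρ' hη0 hη1 hηB hr (one_le_pow₀ hLδ) han
  rw [hab] at hG
  set Z := expIntegral ψ b ρ' with hZ
  have hZ0 : 0 ≤ Z := expIntegral_nonneg _ _ _
  set w : EuclideanSpace ℝ (Fin n) → ℝ := fun x => η x * Real.exp (-(a / (2 * k)) * ψ x) with hw
  have hw0 : ∀ x, 0 ≤ w x := fun x => mul_nonneg (hη0 x) (Real.exp_pos _).le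
  have hwc : ContDiff ℝ 1 w := hη.mul (Real.contDiff_exp.comp (contDiff_const.mul hψ1))
  have hwcs : HasCompactSupport w := hηc.mul_right
  have hwB : ∀ x ∉ ball (0 : EuclideanSpace ℝ (Fin n)) 1, w x = 0 := fun x hx => by
    simp [hw, hηB x fun h => hx (ball_subset_ball hρ' h)]
  have hS := hsob w hwc hwcs hw0 hwB
  set G := ∫ x, ‖fderiv ℝ w x‖ ^ (2 * k) with hGdef
  have hG0 : 0 ≤ G := integral_nonneg fun x => by positivity
  have hGr : ∫ x, ‖fderiv ℝ w x‖ ^ (2 * k : ℝ) = G := by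
    rw [hGdef]
    refine integral_congr_ae (Filter.Eventually.of_forall fun x => ?_)
    have : (2 * k : ℝ) = ((2 * k : ℕ) : ℝ) := by push_cast; ring
    simp only [this, Real.rpow_natCast]
  rw [hGr] at hS
  set t := b / δ with ht
  have hb1 : 1 ≤ b := (one_le_mul_of_one_le_of_one_le hn1 hp1).trans hb
  have hab' : a ≤ t := by
    rw [ha, ht]
    exact div_le_div_of_nonneg_left (by linarith) hδ0 (hδ1.trans hp1)
  have hδt : 1 / δ ≤ t := by rw [ht]; gcongr
  -- The lower bound of the left side of the Sobolev inequality.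
  have hlow : expIntegral ψ (κ * b) ρ ≤ ∫ x, ‖w x‖ ^ Q := by
    have hcont : Continuous fun x => ‖w x‖ ^ Q := hwc.continuous.norm.rpow_const
      fun x => Or.inr hQ0.le
    have hcs : HasCompactSupport fun x => ‖w x‖ ^ Q := by
      refine hwcs.mono fun x hx h => hx ?_
      simp only [h, norm_zero, Real.zero_rpow hQ0.ne']
    calc expIntegral ψ (κ * b) ρ = ∫ x in ball 0 ρ, ‖w x‖ ^ Q := by
          refine setIntegral_congr_fun measurableSet_ball fun x hx => ?_
          simp only [hw, hηρ x hx, one_mul, Real.norm_eq_abs, Real.abs_exp, exp_rpow]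
          congr 1
          rw [hκ, ← hab]
          field_simp
      _ ≤ _ := setIntegral_le_integral (hcont.integrable_of_hasCompactSupport hcs)
          (Filter.Eventually.of_forall fun x => by positivity)
  have hG1 : G ≤ K * L ^ (2 * k) * t ^ (N + 4 * k) * Z ^ (1 / p') := by
    refine hG.trans (mul_le_mul_of_nonneg_right ?_ (Real.rpow_nonneg hZ0 _))
    calc K * a ^ N * ((L / δ) ^ 2) ^ k = K * L ^ (2 * k) * (a ^ N * (1 / δ) ^ (2 * k)) := by
          rw [← pow_mul, div_pow, one_div, inv_pow]; ring
      _ ≤ K * L ^ (2 * k) * (t ^ N * t ^ (2 * k)) := by gcongr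
      _ ≤ K * L ^ (2 * k) * t ^ (N + 4 * k) := by
          rw [← pow_add]
          gcongr
          · exact ha1.trans hab'
          · omega
  have ht0 : 0 ≤ t := by positivity
  have hcomb : ∫ x, ‖w x‖ ^ Q ≤ (C ^ (2 * k) * G) ^ (p' * κ) := by
    have hW0 : 0 ≤ ∫ x, ‖w x‖ ^ Q := integral_nonneg fun x => by positivity
    have hC0 : 0 ≤ C := by linarith
    have hpκ : p' * κ = (2 * k : ℝ)⁻¹ * Q := by rw [hκ]; field_simp
    calc ∫ x, ‖w x‖ ^ Q = ((∫ x, ‖w x‖ ^ Q) ^ Q⁻¹) ^ Q := by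
          rw [← Real.rpow_mul hW0, inv_mul_cancel₀ hQ0.ne', Real.rpow_one]
      _ ≤ (C * G ^ (2 * k : ℝ)⁻¹) ^ Q := Real.rpow_le_rpow (by positivity) hS hQ0.le
      _ = (C ^ (2 * k) * G) ^ (p' * κ) := by
          rw [hpκ, Real.rpow_mul (by positivity), Real.mul_rpow (by positivity) hG0]
          congr 2
          have : (C ^ (2 * k) : ℝ) = C ^ (2 * k : ℝ) := by
            rw [← Real.rpow_natCast]; push_cast; rfl
          rw [this, ← Real.rpow_mul hC0, mul_inv_cancel₀ (by positivity), Real.rpow_one]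
  refine hlow.trans (hcomb.trans ?_)
  have hpκ0 : 0 ≤ p' * κ := by positivity
  calc (C ^ (2 * k) * G) ^ (p' * κ)
      ≤ (C ^ (2 * k) * (K * L ^ (2 * k) * t ^ (N + 4 * k) * Z ^ (1 / p'))) ^ (p' * κ) := by gcongr
    _ = _ := by
        rw [Real.rpow_mul (by positivity)]
        congr 1
        rw [show C ^ (2 * k) * (K * L ^ (2 * k) * t ^ (N + 4 * k) * Z ^ (1 / p')) =
          (C ^ (2 * k) * K * L ^ (2 * k)) * t ^ (N + 4 * k) * Z ^ (1 / p') by ring,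
          Real.mul_rpow (by positivity) (by positivity), Real.mul_rpow (by positivity)
          (by positivity), ← Real.rpow_natCast t, ← Real.rpow_mul ht0, ← Real.rpow_mul hZ0,
          one_div_mul_cancel hp'.ne', Real.rpow_one]

end ReverseHolder

/-! ### Moser iteration -/

section Moser

variable {n k : ℕ}

/-- The recursion behind Moser's iteration: a geometric loss in each step costs only a constant
factor in the limit. -/
lemma exists_recursion_bound {κ : ℝ} (hκ : 1 < κ) :
    ∃ β : ℝ, 0 < β ∧ ∀ (M : ℝ) (Y : ℕ → ℝ), 1 ≤ M → (∀ i, 0 ≤ Y i) →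
      (∀ i : ℕ, Y (i + 1) ≤ (M ^ (i + 1) * Y i) ^ κ) → ∀ i : ℕ, Y i ≤ (M ^ β * Y 0) ^ (κ ^ i) := by
  have hκ0 : 0 < κ - 1 := by linarith
  -- `α` and `β` solve `κ α = κ + α` and `κ β = κ + α + β`.
  set α := κ / (κ - 1) with hα
  have hα0 : 0 < α := by positivity
  set β := (κ + α) / (κ - 1) with hβ
  have hβ0 : 0 < β := by positivity
  refine ⟨β, hβ0, fun M Y hM hY h => ?_⟩
  have hM0 : 0 < M := by linarith
  set Z := M ^ β * Y 0 with hZ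
  have hZ0 : 0 ≤ Z := mul_nonneg (by positivity) (hY 0)
  have hi : ∀ i : ℕ, Y i ≤ M ^ (-(α * i + β)) * Z ^ (κ ^ i) := by
    intro i
    induction i with
    | zero =>
      rw [hZ]
      simp only [Nat.cast_zero, mul_zero, zero_add, pow_zero, Real.rpow_one]
      rw [← mul_assoc, ← Real.rpow_add hM0]
      simp
    | succ i ih =>
      calc Y (i + 1) ≤ (M ^ (i + 1) * Y i) ^ κ := h i
        _ ≤ (M ^ (i + 1) * (M ^ (-(α * i + β)) * Z ^ (κ ^ i))) ^ κ :=
            Real.rpow_le_rpow (mul_nonneg (by positivity) (hY i)) (by gcongr) (by linarith)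
        _ = _ := by
            rw [← mul_assoc, ← Real.rpow_natCast M (i + 1), ← Real.rpow_add hM0,
              Real.mul_rpow (by positivity) (by positivity), ← Real.rpow_mul hM0.le,
              ← Real.rpow_mul hZ0, ← pow_succ]
            congr 2
            push_cast
            rw [hβ, hα]
            field_simp
            ring
  intro i
  refine (hi i).trans (mul_le_of_le_one_left (by positivity) ?_)
  exact Real.rpow_le_one_of_one_le_of_nonpos hM (by have : 0 ≤ α * i := by positivity
                                                    linarith)

lemma expIntegral_mono {ψ : EuclideanSpace ℝ (Fin n) → ℝ} (hψ : Continuous ψ) (b : ℝ) {ρ ρ' : ℝ}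
    (h : ρ ≤ ρ') : expIntegral ψ b ρ ≤ expIntegral ψ b ρ' :=
  setIntegral_mono_set (integrableOn_ball_of_continuous (continuous_exp_mul hψ _) 0 ρ')
    (Filter.Eventually.of_forall fun _ => (Real.exp_pos _).le)
    (LE.le.eventuallyLE (ball_subset_ball h))

/-- The limit of the `L^{κ^i}` norms of the continuous function `e^{-bψ}` dominates it pointwise. -/
lemma exp_le_of_expIntegral_le {ψ : EuclideanSpace ℝ (Fin n) → ℝ} (hψ : Continuous ψ)
    {κ b ρ Z : ℝ} (hκ : 1 < κ) (hZ : 0 ≤ Z)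
    (h : ∀ i : ℕ, expIntegral ψ (κ ^ i * b) ρ ≤ Z ^ (κ ^ i))
    {x : EuclideanSpace ℝ (Fin n)} (hx : x ∈ ball 0 ρ) : Real.exp (-b * ψ x) ≤ Z := by
  by_contra! hlt
  obtain ⟨l, hZl, hl⟩ := exists_between hlt
  have hl0 : 0 < l := hZ.trans_lt hZl
  have hc := continuous_exp_mul hψ (-b)
  set O := ball (0 : EuclideanSpace ℝ (Fin n)) ρ ∩ {y | l < Real.exp (-b * ψ y)} with hO
  have hOo : IsOpen O := isOpen_ball.inter (isOpen_lt continuous_const hc)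
  have hOfin : volume O ≠ ∞ :=
    ((measure_mono Set.inter_subset_left).trans_lt measure_ball_lt_top).ne
  have hm : 0 < volume.real O :=
    ENNReal.toReal_pos (hOo.measure_pos volume ⟨x, hx, hl⟩).ne' hOfin
  have hbound : ∀ i : ℕ, volume.real O ≤ (Z / l) ^ (κ ^ i) := by
    intro i
    have hci := continuous_exp_mul hψ (-(κ ^ i * b))
    have hint := integrableOn_ball_of_continuous hci 0 ρ
    have h1 : ∫ _ in O, l ^ (κ ^ i) ≤ expIntegral ψ (κ ^ i * b) ρ :=
      calc ∫ _ in O, l ^ (κ ^ i) ≤ ∫ y in O, Real.exp (-(κ ^ i * b) * ψ y) := by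
            refine setIntegral_mono_on (integrableOn_const hOfin)
              (hint.mono_set Set.inter_subset_left) hOo.measurableSet fun y hy => ?_
            calc l ^ (κ ^ i) ≤ Real.exp (-b * ψ y) ^ (κ ^ i) :=
                  Real.rpow_le_rpow hl0.le hy.2.le (by positivity)
              _ = _ := by rw [exp_rpow]; congr 1; ring
        _ ≤ _ := setIntegral_mono_set hint
            (Filter.Eventually.of_forall fun _ => (Real.exp_pos _).le)
            (LE.le.eventuallyLE Set.inter_subset_left)
    rw [setIntegral_const, smul_eq_mul] at h1
    rw [Real.div_rpow hZ hl0.le, le_div_iff₀ (by positivity)]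
    exact h1.trans (h i)
  have hlim : Filter.Tendsto (fun i : ℕ => (Z / l) ^ (κ ^ i)) Filter.atTop (nhds 0) :=
    (tendsto_rpow_atTop_of_base_lt_one (Z / l) (by have : 0 ≤ Z / l := by positivity
                                                   linarith)
      ((div_lt_one hl0).2 hZl)).comp (tendsto_pow_atTop_atTop_of_one_lt hκ)
  exact absurd (ge_of_tendsto' hlim hbound) (not_le.2 hm)

/-- The local maximum principle for large exponents `b`, with the dependence on the radii. -/
lemma exists_exp_le_expIntegral (hk : 1 ≤ k) (hkn : 2 * k ≤ n) {p p' Λ : ℝ}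
    (hpp : p.HolderConjugate p') (hp : (n : ℝ) / (2 * k) < p) (hΛ : 0 ≤ Λ) :
    ∃ b₀ : ℝ, 1 ≤ b₀ ∧ ∀ b, b₀ ≤ b → ∃ C ν : ℝ, 0 < C ∧ 0 < ν ∧
      ∀ ψ : EuclideanSpace ℝ (Fin n) → ℝ, IsAdmissible k p' Λ ψ →
      ∀ ρ ρ' : ℝ, 0 ≤ ρ → ρ < ρ' → ρ' ≤ 1 → ∀ x ∈ ball (0 : EuclideanSpace ℝ (Fin n)) ρ,
      Real.exp (-b * ψ x) ≤ C * (ρ' - ρ) ^ (-ν) * expIntegral ψ b ρ' := by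
  obtain ⟨C, ν, κ, b₀, hC, hν, hκ, hb₀, hrev⟩ := exists_reverse_holder hk hkn hpp hp hΛ
  obtain ⟨β, hβ, hrec⟩ := exists_recursion_bound hκ
  refine ⟨b₀, hb₀, fun b hb => ⟨C ^ β * (2 * κ * b) ^ (ν * β), ν * β, ?_, by positivity, ?_⟩⟩
  · have : 0 < b := by linarith
    positivity
  intro ψ hadm ρ ρ' hρ hρρ' hρ' x hx
  have hψ := hadm.contDiff.continuous
  set δ := ρ' - ρ with hδ
  have hδ0 : 0 < δ := by linarith
  have hδ1 : δ ≤ 1 := by linarith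
  have hb1 : 1 ≤ b := hb₀.trans hb
  have hb0 : 0 < b := by linarith
  have hκ0 : 0 < κ := by linarith
  have hbδ : 1 ≤ b / δ := by rw [le_div_iff₀ hδ0]; linarith
  have hA1 : 1 ≤ 2 * κ * (b / δ) := by nlinarith
  set M := C * (2 * κ * (b / δ)) ^ ν with hM
  have hM1 : 1 ≤ M := one_le_mul_of_one_le_of_one_le hC (Real.one_le_rpow hA1 hν.le)
  set r : ℕ → ℝ := fun i => ρ + δ * (1 / 2) ^ i with hr
  have hstep (i : ℕ) : expIntegral ψ (κ ^ (i + 1) * b) (r (i + 1)) ≤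
      (M ^ (i + 1) * expIntegral ψ (κ ^ i * b) (r i)) ^ κ := by
    have hp0 : (0 : ℝ) < (1 / 2) ^ i := by positivity
    have hp1 : (1 / 2 : ℝ) ^ i ≤ 1 := pow_le_one₀ (by norm_num) (by norm_num)
    have hdiff : r i - r (i + 1) = δ * (1 / 2) ^ (i + 1) := by simp only [hr]; ring
    have hκi : 1 ≤ κ ^ i := one_le_pow₀ hκ.le
    have h1 := hrev ψ hadm (r (i + 1)) (r i) (κ ^ i * b) (by positivity)
      (by rw [← sub_pos, hdiff]; positivity) (by simp only [hr]; nlinarith)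
      (hb.trans (le_mul_of_one_le_left hb0.le hκi))
    rw [← mul_assoc, ← pow_succ', hdiff] at h1
    refine h1.trans (Real.rpow_le_rpow (mul_nonneg (by positivity) (expIntegral_nonneg _ _ _))
      (mul_le_mul_of_nonneg_right ?_ (expIntegral_nonneg _ _ _)) hκ0.le)
    have h2 : κ ^ i * b / (δ * (1 / 2) ^ (i + 1)) ≤ (2 * κ * (b / δ)) ^ (i + 1) := by
      have e : κ ^ i * b / (δ * (1 / 2) ^ (i + 1)) = 2 ^ (i + 1) * (κ ^ i * (b / δ)) := by
        rw [one_div, inv_pow]; field_simp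
      rw [e, mul_pow, mul_pow, mul_assoc]
      gcongr
      · exact hκ.le
      · omega
      · exact le_self_pow₀ hbδ (by omega)
    calc C * (κ ^ i * b / (δ * (1 / 2) ^ (i + 1))) ^ ν
        ≤ C ^ (i + 1) * ((2 * κ * (b / δ)) ^ (i + 1)) ^ ν := by
          gcongr
          exact le_self_pow₀ hC (by omega)
      _ = M ^ (i + 1) := by
          rw [hM, mul_pow C, Real.rpow_pow_comm (by positivity)]
  have hY := hrec M (fun i => expIntegral ψ (κ ^ i * b) (r i)) hM1
    (fun i => expIntegral_nonneg _ _ _) hstep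
  have hr0 : r 0 = ρ' := by simp only [hr, hδ]; ring
  simp only [pow_zero, one_mul, hr0] at hY
  have hMe : M ^ β = C ^ β * (2 * κ * b) ^ (ν * β) * δ ^ (-(ν * β)) := by
    rw [hM, Real.mul_rpow (by positivity) (by positivity), ← Real.rpow_mul (by positivity),
      ← mul_div_assoc, Real.div_rpow (by positivity) hδ0.le, Real.rpow_neg hδ0.le]
    ring
  rw [← hMe]
  refine exp_le_of_expIntegral_le hψ hκ (mul_nonneg (by positivity) (expIntegral_nonneg _ _ _))
    (fun i => (expIntegral_mono hψ _ ?_).trans (hY i)) hx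
  simp only [hr]
  have : 0 ≤ δ * (1 / 2) ^ i := by positivity
  linarith

/-- The local maximum principle for every positive exponent `q`. It follows from the one for a large
exponent `b` by maximising `(1 - |x|)^s e^{-ψ(x)}` over the unit ball. -/
lemma exists_exp_le_rpow_expIntegral (hk : 1 ≤ k) (hkn : 2 * k ≤ n) {p p' Λ q : ℝ}
    (hpp : p.HolderConjugate p') (hp : (n : ℝ) / (2 * k) < p) (hΛ : 0 ≤ Λ) (hq : 0 < q) :
    ∃ C : ℝ, 0 ≤ C ∧ ∀ ψ : EuclideanSpace ℝ (Fin n) → ℝ, IsAdmissible k p' Λ ψ →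
      ∀ x ∈ ball (0 : EuclideanSpace ℝ (Fin n)) (1 / 2),
      Real.exp (-ψ x) ≤ C * expIntegral ψ q 1 ^ q⁻¹ := by
  obtain ⟨b₀, hb₀, hmax⟩ := exists_exp_le_expIntegral hk hkn hpp hp hΛ
  obtain ⟨C, ν, hC, hν, hsup⟩ := hmax (max b₀ q) (le_max_left _ _)
  set b := max b₀ q with hb
  have hqb : q ≤ b := le_max_right _ _
  set s := ν / q with hs
  have hs0 : 0 < s := by positivity
  refine ⟨2 ^ s * (C * 3 ^ ν * (3 ^ s) ^ (b - q)) ^ q⁻¹, by positivity, fun ψ hadm x hx => ?_⟩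
  have hψ := hadm.contDiff.continuous
  have hvc : Continuous fun y : EuclideanSpace ℝ (Fin n) => (1 - ‖y‖) ^ s * Real.exp (-ψ y) :=
    ((continuous_const.sub continuous_norm).rpow_const fun _ => Or.inr hs0.le).mul
      (Real.continuous_exp.comp hψ.neg)
  obtain ⟨x₀, hx₀, hx₀max⟩ := (isCompact_closedBall (0 : EuclideanSpace ℝ (Fin n)) 1).exists_isMaxOn
    ⟨0, by simp⟩ hvc.continuousOn
  have hle : ∀ y : EuclideanSpace ℝ (Fin n), ‖y‖ ≤ 1 →
      (1 - ‖y‖) ^ s * Real.exp (-ψ y) ≤ (1 - ‖x₀‖) ^ s * Real.exp (-ψ x₀) := fun y hy =>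
    hx₀max (by simpa using hy)
  have hx₀1 : ‖x₀‖ ≤ 1 := by simpa using hx₀
  set t := 1 - ‖x₀‖ with ht
  have ht0 : 0 < t := by
    rcases (show 0 ≤ t by linarith).lt_or_eq with h | h
    · exact h
    · have h1 := hle 0 (by simp)
      rw [← h, Real.zero_rpow hs0.ne'] at h1
      have := Real.exp_pos (-ψ 0)
      simp at h1
      linarith
  set N := Real.exp (-ψ x₀) with hN
  have hN0 : 0 < N := Real.exp_pos _
  -- In the ball of radius `|x₀| + 2t/3` the choice of `x₀` bounds `e^{-ψ}` by a multiple of `N`.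
  have hnb : ∀ y ∈ ball (0 : EuclideanSpace ℝ (Fin n)) (‖x₀‖ + 2 * t / 3),
      Real.exp (-ψ y) ≤ 3 ^ s * N := by
    intro y hy
    have hy' : ‖y‖ < ‖x₀‖ + 2 * t / 3 := by simpa using hy
    have h1 := hle y (by linarith)
    have h2 : (t / 3) ^ s ≤ (1 - ‖y‖) ^ s :=
      Real.rpow_le_rpow (by positivity) (by linarith) hs0.le
    have h3 : (t / 3) ^ s * Real.exp (-ψ y) ≤ t ^ s * N :=
      (mul_le_mul_of_nonneg_right h2 (Real.exp_pos _).le).trans h1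
    rw [Real.div_rpow ht0.le (by norm_num), div_mul_eq_mul_div, div_le_iff₀ (by positivity)] at h3
    have h4 : 0 < t ^ s := by positivity
    refine le_of_mul_le_mul_left ?_ h4
    linarith
  set X := expIntegral ψ q 1 with hX
  have hX0 : 0 ≤ X := expIntegral_nonneg _ _ _
  have hYb : expIntegral ψ b (‖x₀‖ + 2 * t / 3) ≤ (3 ^ s * N) ^ (b - q) * X := by
    calc expIntegral ψ b (‖x₀‖ + 2 * t / 3)
        ≤ ∫ y in ball 0 (‖x₀‖ + 2 * t / 3), (3 ^ s * N) ^ (b - q) * Real.exp (-q * ψ y) := by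
          refine setIntegral_mono_on
            (integrableOn_ball_of_continuous (continuous_exp_mul hψ _) 0 _)
            (integrableOn_ball_of_continuous
              (continuous_const.mul (continuous_exp_mul hψ _)) 0 _)
            measurableSet_ball fun y hy => ?_
          calc Real.exp (-b * ψ y) = Real.exp (-ψ y) ^ (b - q) * Real.exp (-q * ψ y) := by
                rw [exp_rpow, ← Real.exp_add]; congr 1; ring
            _ ≤ _ := mul_le_mul_of_nonneg_right (Real.rpow_le_rpow (Real.exp_pos _).le (hnb y hy)
                (by linarith)) (Real.exp_pos _).le
      _ = (3 ^ s * N) ^ (b - q) * expIntegral ψ q (‖x₀‖ + 2 * t / 3) := integral_const_mul _ _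
      _ ≤ _ := mul_le_mul_of_nonneg_left (expIntegral_mono hψ _ (by linarith)) (by positivity)
  have hsx := hsup ψ hadm (‖x₀‖ + t / 3) (‖x₀‖ + 2 * t / 3) (by positivity) (by linarith)
    (by linarith) x₀ (by simp; positivity)
  -- The choice `s = ν / q` makes the powers of `t` cancel.
  have hMq : (t ^ s * N) ^ q ≤ C * 3 ^ ν * (3 ^ s) ^ (b - q) * X := by
    have h1 : N ^ b ≤ C * (t / 3) ^ (-ν) * ((3 ^ s * N) ^ (b - q) * X) := by
      have e1 : N ^ b = Real.exp (-b * ψ x₀) := by rw [hN, exp_rpow]; congr 1; ring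
      have e2 : ‖x₀‖ + 2 * t / 3 - (‖x₀‖ + t / 3) = t / 3 := by ring
      rw [e2, ← e1] at hsx
      exact hsx.trans (mul_le_mul_of_nonneg_left hYb (by positivity))
    have e3 : N ^ b = N ^ (b - q) * N ^ q := by
      rw [← Real.rpow_add hN0]; congr 1; ring
    rw [e3, Real.mul_rpow (by positivity) hN0.le] at h1
    have h2 : N ^ q ≤ C * (t / 3) ^ (-ν) * ((3 ^ s) ^ (b - q) * X) := by
      refine le_of_mul_le_mul_left (h1.trans_eq ?_) (show 0 < N ^ (b - q) by positivity)
      ring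
    have e4 : (t ^ s) ^ q = t ^ ν := by
      rw [← Real.rpow_mul ht0.le, hs, div_mul_cancel₀ _ hq.ne']
    rw [Real.mul_rpow (by positivity) hN0.le, e4]
    refine (mul_le_mul_of_nonneg_left h2 (by positivity)).trans_eq ?_
    rw [Real.rpow_neg (by positivity), Real.div_rpow ht0.le (by norm_num)]
    have : t ^ ν ≠ 0 := by positivity
    field_simp
  have hM : t ^ s * N ≤ (C * 3 ^ ν * (3 ^ s) ^ (b - q)) ^ q⁻¹ * X ^ q⁻¹ := by
    rw [← Real.mul_rpow (by positivity) hX0]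
    calc t ^ s * N = ((t ^ s * N) ^ q) ^ q⁻¹ := by
          rw [← Real.rpow_mul (by positivity), mul_inv_cancel₀ hq.ne', Real.rpow_one]
      _ ≤ _ := Real.rpow_le_rpow (by positivity) hMq (by positivity)
  have hx' : ‖x‖ < 1 / 2 := by simpa using hx
  have h1 := hle x (by linarith)
  have h2 : (1 / 2 : ℝ) ^ s ≤ (1 - ‖x‖) ^ s :=
    Real.rpow_le_rpow (by norm_num) (by linarith) hs0.le
  have h3 : (1 / 2 : ℝ) ^ s * Real.exp (-ψ x) ≤ t ^ s * N :=
    (mul_le_mul_of_nonneg_right h2 (Real.exp_pos _).le).trans h1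
  rw [Real.div_rpow (by norm_num) (by norm_num), Real.one_rpow, div_mul_eq_mul_div, one_mul,
    div_le_iff₀ (by positivity)] at h3
  rw [mul_assoc]
  exact h3.trans ((mul_le_mul_of_nonneg_right hM (by positivity)).trans_eq (mul_comm _ _))

end Moser

/-! ### Localisation and the choice of constants -/

section Localisation

variable {n k : ℕ}

/-- A `C²` function on the ball of radius `2` agrees near every point of the unit ball with a
compactly supported `C²` function on the whole space. -/
lemma exists_contDiff_eventuallyEq {ψ : EuclideanSpace ℝ (Fin n) → ℝ}
    (hψ : ContDiffOn ℝ 2 ψ (ball 0 2)) :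
    ∃ φ : EuclideanSpace ℝ (Fin n) → ℝ, ContDiff ℝ 2 φ ∧ HasCompactSupport φ ∧
      ∀ x ∈ ball (0 : EuclideanSpace ℝ (Fin n)) 1, φ =ᶠ[nhds x] ψ := by
  let η : ContDiffBump (0 : EuclideanSpace ℝ (Fin n)) := ⟨1, 3 / 2, by norm_num, by norm_num⟩
  refine ⟨fun x => η x * ψ x, contDiff_iff_contDiffAt.2 fun x => ?_, η.hasCompactSupport.mul_right,
    fun x hx => (η.eventuallyEq_one_of_mem_ball hx).mono fun y hy => by simp [hy]⟩
  by_cases hx : x ∈ ball (0 : EuclideanSpace ℝ (Fin n)) 2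
  · exact η.contDiff.contDiffAt.mul (hψ.contDiffAt (isOpen_ball.mem_nhds hx))
  · have hx' : x ∉ tsupport η := by
      rw [η.tsupport_eq]
      simp only [mem_ball, dist_zero_right, not_lt] at hx
      simp only [mem_closedBall, dist_zero_right, not_le]
      change 3 / 2 < ‖x‖
      linarith
    refine (contDiffAt_const (c := (0 : ℝ))).congr_of_eventuallyEq ?_
    exact (notMem_tsupport_iff_eventuallyEq.1 hx').mono fun y hy => by simp [hy]

lemma F_congr {φ ψ : EuclideanSpace ℝ (Fin n) → ℝ} {x : EuclideanSpace ℝ (Fin n)}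
    (h : φ =ᶠ[nhds x] ψ) : F φ x = F ψ x := by
  simp only [F, partialDeriv, h.fderiv.fderiv_eq, h.fderiv_eq]

/-- Hölder's inequality turns an `L^p` bound of `σ_k` into admissibility. -/
lemma isAdmissible_of_eLpNorm_le {p p' : ℝ} (hpp : p.HolderConjugate p') {Λ : ℝ} (hΛ : 0 ≤ Λ)
    {φ f : EuclideanSpace ℝ (Fin n) → ℝ} (hφ : ContDiff ℝ 2 φ) (hφc : HasCompactSupport φ)
    (hf : MemLp f (ENNReal.ofReal p) (volume.restrict (ball 0 1)))
    (hfΛ : eLpNorm f (ENNReal.ofReal p) (volume.restrict (ball 0 1)) ≤ ENNReal.ofReal Λ)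
    (hmem : ∀ x ∈ ball (0 : EuclideanSpace ℝ (Fin n)) 1,
      eigenvalues (F φ x) ∈ closure (Gamma n k))
    (hle : ∀ᵐ x ∂(volume.restrict (ball (0 : EuclideanSpace ℝ (Fin n)) 1)),
      sigma k (eigenvalues (F φ x)) ≤ f x) : IsAdmissible k p' Λ φ := by
  refine ⟨hφ, hφc, hmem, fun ρ hρ g hg hg0 => ?_⟩
  have hμ : volume.restrict (ball (0 : EuclideanSpace ℝ (Fin n)) ρ) ≤ volume.restrict (ball 0 1) :=
    Measure.restrict_mono (ball_subset_ball hρ) le_rfl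
  have hp := hpp.pos
  have hfρ := (hf.mono_measure hμ).norm
  have hgρ := memLp_ball_of_continuous hg ρ (ENNReal.ofReal p')
  have hnorm : (∫ x in ball 0 ρ, ‖f x‖ ^ p) ^ (1 / p) ≤ Λ := by
    have h1 := (hf.mono_measure hμ).eLpNorm_eq_integral_rpow_norm (by simpa using hp) (by simp)
    rw [ENNReal.toReal_ofReal hp.le, ← one_div] at h1
    exact (ENNReal.ofReal_le_ofReal_iff hΛ).1
      (h1.symm.trans_le ((eLpNorm_mono_measure f hμ).trans hfΛ))
  have hint : Integrable (fun x => ‖f x‖ * g x) (volume.restrict (ball 0 ρ)) := by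
    have : ENNReal.HolderConjugate (ENNReal.ofReal p) (ENNReal.ofReal p') := hpp.ennrealOfReal
    exact hfρ.integrable_mul hgρ
  have hcont : Continuous fun x => newtonSigma (F φ x) k * g x :=
    ((continuous_newtonSigma k).comp (continuous_F hφ)).mul hg
  calc ∫ x in ball 0 ρ, newtonSigma (F φ x) k * g x ≤ ∫ x in ball 0 ρ, ‖f x‖ * g x := by
        refine integral_mono_ae (integrableOn_ball_of_continuous hcont 0 ρ) hint ?_
        filter_upwards [ae_mono hμ hle] with x hx
        refine mul_le_mul_of_nonneg_right ?_ (hg0 x)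
        have hA : (F φ x).IsHermitian := F_isHermitian isOpen_univ hφ.contDiffOn (Set.mem_univ x)
        rw [newtonSigma_isHermitian hA, ← sigma_eq_esymmOn]
        rw [eigenvalues, dif_pos hA] at hx
        exact hx.trans (Real.le_norm_self _)
    _ ≤ (∫ x in ball 0 ρ, ‖f x‖ ^ p) ^ (1 / p) * (∫ x in ball 0 ρ, g x ^ p') ^ (1 / p') :=
        integral_mul_le_Lp_mul_Lq_of_nonneg hpp (Filter.Eventually.of_forall fun _ => norm_nonneg _)
          (Filter.Eventually.of_forall hg0) hfρ hgρ
    _ ≤ _ := mul_le_mul_of_nonneg_right hnorm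
        (Real.rpow_nonneg (integral_nonneg fun x => Real.rpow_nonneg (hg0 x) _) _)

lemma eLpNorm_exp_eq {φ : EuclideanSpace ℝ (Fin n) → ℝ} (hφ : Continuous φ) {q : ℝ} (hq : 0 < q) :
    eLpNorm (fun x => Real.exp (-φ x)) (ENNReal.ofReal q) (volume.restrict (ball 0 1)) =
      ENNReal.ofReal (expIntegral φ q 1 ^ q⁻¹) := by
  have hm := memLp_ball_of_continuous (Real.continuous_exp.comp hφ.neg) 1 (ENNReal.ofReal q)
  have h1 := hm.eLpNorm_eq_integral_rpow_norm (by simpa using hq) (by simp)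
  rw [ENNReal.toReal_ofReal hq.le] at h1
  refine h1.trans ?_
  congr 3
  ext x
  simp only [Function.comp_apply, Pi.neg_apply, Real.norm_eq_abs, Real.abs_exp, exp_rpow]
  congr 1
  ring

/-- The estimate for a single `k`. -/
lemma exists_eLpNorm_exp_le (hk : 1 ≤ k) (hkn : 2 * k ≤ n) {p : ℝ≥0∞}
    (hp : (n : ℝ≥0∞) / (2 * (k : ℝ≥0∞)) < p) {q : ℝ} (hq : 0 < q) (Λ : ℝ≥0) :
    ∃ C : ℝ≥0, ∀ ψ f : EuclideanSpace ℝ (Fin n) → ℝ,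
        ContDiffOn ℝ 2 ψ (ball 0 2) →
        MemLp f p (volume.restrict (ball 0 2)) →
        eLpNorm f p (volume.restrict (ball 0 2)) ≤ Λ →
        (∀ x ∈ ball (0 : EuclideanSpace ℝ (Fin n)) 2,
          eigenvalues (F ψ x) ∈ closure (Gamma n k)) →
        (∀ᵐ x ∂(volume.restrict (ball (0 : EuclideanSpace ℝ (Fin n)) 2)),
          sigma k (eigenvalues (F ψ x)) ≤ f x) →
        eLpNorm (fun x => Real.exp (-ψ x)) ∞ (volume.restrict (ball 0 (1 / 2)))
          ≤ C * eLpNorm (fun x => Real.exp (-ψ x)) (ENNReal.ofReal q)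
              (volume.restrict (ball 0 1)) := by
  have hk1 : (1 : ℝ) ≤ k := by exact_mod_cast hk
  -- A finite exponent `r` replaces `p`, which may be infinite.
  obtain ⟨r, -, hr, hrp⟩ := ENNReal.lt_iff_exists_real_btwn.1 hp
  have hr' : (n : ℝ) / (2 * k) < r := by
    have e : (n : ℝ≥0∞) / (2 * (k : ℝ≥0∞)) = ENNReal.ofReal ((n : ℝ) / (2 * k)) := by
      rw [ENNReal.ofReal_div_of_pos (by positivity), ENNReal.ofReal_mul (by norm_num)]
      simp
    rw [e] at hr
    exact ((ENNReal.ofReal_lt_ofReal_iff_of_nonneg (by positivity)).1 hr)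
  have hnk : 1 ≤ (n : ℝ) / (2 * k) := by
    rw [le_div_iff₀ (by positivity), one_mul]
    exact_mod_cast hkn
  have hpp := Real.HolderConjugate.conjExponent (hnk.trans_lt hr')
  set V : ℝ≥0∞ := volume.restrict (ball (0 : EuclideanSpace ℝ (Fin n)) 2) Set.univ ^
    (1 / (ENNReal.ofReal r).toReal - 1 / p.toReal) with hV
  have hfin : IsFiniteMeasure (volume.restrict (ball (0 : EuclideanSpace ℝ (Fin n)) 2)) :=
    ⟨by rw [Measure.restrict_apply_univ]; exact measure_ball_lt_top⟩
  have hVfin : (Λ : ℝ≥0∞) * V ≠ ∞ := by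
    refine ENNReal.mul_ne_top ENNReal.coe_ne_top (ENNReal.rpow_ne_top_of_nonneg ?_
      (measure_ne_top _ _))
    have hr0 : 0 < r := by linarith
    rw [ENNReal.toReal_ofReal hr0.le, sub_nonneg]
    rcases eq_or_ne p ∞ with rfl | hpt
    · simp [hr0.le]
    · exact one_div_le_one_div_of_le hr0 ((ENNReal.ofReal_le_iff_le_toReal hpt).1 hrp.le)
  obtain ⟨C, hC, hmain⟩ := exists_exp_le_rpow_expIntegral (n := n) hk hkn hpp hr'
    (ENNReal.toReal_nonneg (a := Λ * V)) hq
  refine ⟨C.toNNReal, fun ψ f hψ hf hfΛ hmem hle => ?_⟩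
  obtain ⟨φ, hφ, hφc, hφψ⟩ := exists_contDiff_eventuallyEq hψ
  have hμ : volume.restrict (ball (0 : EuclideanSpace ℝ (Fin n)) 1) ≤ volume.restrict (ball 0 2) :=
    Measure.restrict_mono (ball_subset_ball (by norm_num)) le_rfl
  have hadm : IsAdmissible k (Real.conjExponent r) ((Λ : ℝ≥0∞) * V).toReal φ := by
    refine isAdmissible_of_eLpNorm_le hpp ENNReal.toReal_nonneg hφ hφc
      ((hf.mono_exponent hrp.le).mono_measure hμ) ?_ (fun x hx => ?_) ?_
    · rw [ENNReal.ofReal_toReal hVfin]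
      exact (eLpNorm_mono_measure f hμ).trans
        ((eLpNorm_le_eLpNorm_mul_rpow_measure_univ hrp.le hf.1).trans (mul_le_mul_left hfΛ _))
    · rw [F_congr (hφψ x hx)]
      exact hmem x (ball_subset_ball (by norm_num) hx)
    · filter_upwards [ae_mono hμ hle, ae_restrict_mem measurableSet_ball] with x hx hxB
      rwa [F_congr (hφψ x hxB)]
  have hcongr : eLpNorm (fun x => Real.exp (-ψ x)) (ENNReal.ofReal q)
      (volume.restrict (ball 0 1)) = ENNReal.ofReal (expIntegral φ q 1 ^ q⁻¹) := by
    rw [← eLpNorm_exp_eq hφ.continuous hq]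
    refine eLpNorm_congr_ae ?_
    filter_upwards [ae_restrict_mem measurableSet_ball] with x hx
    rw [(hφψ x hx).eq_of_nhds]
  rw [hcongr, eLpNorm_exponent_top, ← ENNReal.ofReal, ← ENNReal.ofReal_mul hC]
  refine eLpNormEssSup_le_of_ae_bound ?_
  filter_upwards [ae_restrict_mem measurableSet_ball] with x hx
  rw [Real.norm_eq_abs, Real.abs_exp,
    ← (hφψ x (ball_subset_ball (by norm_num) hx)).eq_of_nhds]
  exact hmain φ hadm x hx

end Localisation

end SigmaK

end

theorem proposition4p1 (n : ℕ) (p : ℝ≥0∞) (q₁ : ℝ) (hq₁ : 0 < q₁) (Λ : ℝ≥0) :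
    ∃ C : ℝ≥0, 0 < C ∧
      ∀ k : ℕ, 1 ≤ k → 2 * k ≤ n → (n : ℝ≥0∞) / (2 * (k : ℝ≥0∞)) < p →
      ∀ ψ f : EuclideanSpace ℝ (Fin n) → ℝ,
        ContDiffOn ℝ 2 ψ (ball 0 2) →
        MemLp f p (volume.restrict (ball 0 2)) →
        eLpNorm f p (volume.restrict (ball 0 2)) ≤ Λ →
        (∀ x ∈ ball (0 : EuclideanSpace ℝ (Fin n)) 2,
          SigmaK.eigenvalues (SigmaK.F ψ x) ∈ closure (SigmaK.Gamma n k)) →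
        (∀ᵐ x ∂(volume.restrict (ball (0 : EuclideanSpace ℝ (Fin n)) 2)),
          SigmaK.sigma k (SigmaK.eigenvalues (SigmaK.F ψ x)) ≤ f x) →
        eLpNorm (fun x => Real.exp (-ψ x)) ∞ (volume.restrict (ball 0 (1 / 2)))
          ≤ C * eLpNorm (fun x => Real.exp (-ψ x)) (ENNReal.ofReal q₁)
              (volume.restrict (ball 0 1)) := by
  have hex : ∀ k : ℕ, ∃ C : ℝ≥0, (hk : 1 ≤ k) → (hkn : 2 * k ≤ n) →
      (hp : (n : ℝ≥0∞) / (2 * (k : ℝ≥0∞)) < p) → _ :=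
    fun k => by
      by_cases h : 1 ≤ k ∧ 2 * k ≤ n ∧ (n : ℝ≥0∞) / (2 * (k : ℝ≥0∞)) < p
      · obtain ⟨C, hC⟩ := SigmaK.exists_eLpNorm_exp_le h.1 h.2.1 h.2.2 hq₁ Λ
        exact ⟨C, fun _ _ _ => hC⟩
      · exact ⟨0, fun h1 h2 h3 => absurd ⟨h1, h2, h3⟩ h⟩
  choose C hC using hex
  refine ⟨1 + ∑ j ∈ Finset.range (n + 1), C j, by positivity, ?_⟩
  intro k hk hkn hp ψ f hψ hf hfΛ hmem hle
  refine (hC k hk hkn hp ψ f hψ hf hfΛ hmem hle).trans (mul_le_mul_left ?_ _)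
  have h1 : C k ≤ ∑ j ∈ Finset.range (n + 1), C j :=
    Finset.single_le_sum (f := C) (fun _ _ => zero_le) (Finset.mem_range.2 (by omega))
  exact_mod_cast h1.trans le_add_self
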